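/- Steps are steps of a deterministic multitape Turing machine, numbers being coded in binary; machines are given by finite tables. Let $\mathbb{N}=\{1,2,\dots\}$. A PIO algorithm for $f:\mathbb{N}\to\mathbb{Z}$ is a machine that, for some constants $c,k\in\mathbb{N}$ and every input $n\in\mathbb{N}$, computes $f(n)$ in at most $c\,m_f(n)^k$ steps, where $m_f(n)=\log(1+n)+\log(2+|f(n)|)$; $f$ is a PIO function if it has a PIO algorithm. Let $1\le g_1<g_2<\cdots$ be a nonempty, finite or infinite, increasing sequence of natural numbers, let $A=\{g_1,g_2,\dots\}$, and let $f(n)=f_A(n)$ be the number of partitions of $n$ all of whose nonzero multiplicities of parts lie in $A$, so that $$\sum_{n\ge0}f(n)q^n=\prod_{i\ge1}\Bigl(1+\sum_{j\ge1}q^{i g_j}\Bigr).$$ Suppose that $n\mapsto g_n$ is computable in $\mathrm{poly}(n)$ steps, that is, some machine, for some constants $c,k$ and every input $n\in\mathbb{N}$, outputs in at most $c(1+n)^k$ steps the number $g_n$, or $0$ if the sequence has fewer than $n$ terms. Then $f$ is a PIO function. Moreover, the PIO algorithm can be computed from the data: there is a computable function $\Phi$ such that, for every such sequence, every machine $M$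 computing $n\mapsto g_n$ in $\mathrm{poly}(n)$ steps as above, $d=\gcd(A)$, and every finite set $B\subset A$ (given as a list of its elements) with $\gcd(B)=d$, the machine $\Phi(M,d,B)$ is a PIO algorithm for $f_A$. -/

import Mathlib

open scoped PowerSeries.WithPiTopology

/-! ### Deterministic multitape Turing machines, as finite tables -/

namespace Pio

/-- `Turing.Dir` (left or right) as a type of finite codes. -/
instance : Primcodable Turing.Dir :=
  Primcodable.ofEquiv Bool
    { toFun := fun d => match d with
        | Turing.Dir.left => false
        | Turing.Dir.right => true
      invFun := fun b => match b with
        | false => Turing.Dir.left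
        | true => Turing.Dir.right
      left_inv := fun d => by cases d <;> rfl
      right_inv := fun b => by cases b <;> rfl }

/-- What a transition does on one tape: an optional symbol to write on the scanned cell
(`none`: the cell is left as it is), then an optional move of the head (`none`: it stays). -/
abbrev Action := Option ℕ × Option Turing.Dir

/-- A transition rule `((q, reads), (q', actions))`. It applies in state `q` when, for every
`t`-th entry `some a` of `reads`, the head of tape `t` scans the symbol `a` (an entry `none`, or a
missing entry, puts no condition on that tape). It leads to state `q'` and performs the `t`-th entry
of `actions` on tape `t` (nothing, if that entry is missing). -/
abbrev Rule := (ℕ × List (Option ℕ)) × (ℕ × List Action)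

/-- A deterministic multitape Turing machine is a finite table of rules, of which the first
applicable one is carried out; it halts when no rule applies. The initial state is `0` and the blank
symbol is `0`. As the table is finite, only finitely many states, tape symbols and tapes can
ever play a role, so this is a finite description of an ordinary multitape Turing machine. -/
abbrev Machine := List Rule

/-- A configuration: the current state and the contents of the tapes with head positions. -/
structure Cfg where
  /-- the current state -/
  state : ℕ
  /-- the tapes -/
  tape : ℕ → Turing.Tape ℕ

/-- Does the rule apply in the given configuration? -/
def Rule.applies (r : Rule) (c : Cfg) : Bool :=
  (c.state == r.1.1) && r.1.2.zipIdx.all fun p => p.1.all fun a => (c.tape p.2).head == a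

/-- The effect of an action on a tape: write, then move. -/
def Action.run (x : Action) (T : Turing.Tape ℕ) : Turing.Tape ℕ :=
  let T' := match x.1 with
    | none => T
    | some a => T.write a
  match x.2 with
  | none => T'
  | some d => T'.move d

/-- The configuration obtained by carrying out a rule. -/
def Rule.run (r : Rule) (c : Cfg) : Cfg where
  state := r.2.1
  tape t := Action.run (r.2.2.getD t (none, none)) (c.tape t)

/-- One step of the machine; `none` means that the machine has halted. -/
def Machine.step (M : Machine) (c : Cfg) : Option Cfg :=
  (M.find? fun r => Rule.applies r c).map fun r => Rule.run r c

/-- A binary word as a word of tape symbols: `0` is the blank, the bits are the symbols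
`1` (for bit zero) and `2` (for bit one). -/
def tapeWord (w : List Bool) : List ℕ := w.map fun b => if b then 2 else 1

/-- The initial configuration: the input word is on tape `0` with the head on its first letter, all
other tapes are blank. -/
def Machine.init (w : List Bool) : Cfg where
  state := 0
  tape t := if t = 0 then Turing.Tape.mk₁ (tapeWord w) else Turing.Tape.mk₁ []

/-- On input word `w`, the machine `M` halts after at most `s` steps with output word `v`: on tape
`1` the head is on the first letter of `v`, and `v` is followed by blanks only. -/
def Machine.ComputesWithin (M : Machine) (w v : List Bool) (s : ℝ) : Prop :=
  ∃ k : ℕ, (k : ℝ) ≤ s ∧ ∃ c : Cfg,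
    (fun o : Option Cfg => o.bind (Machine.step M))^[k] (some (Machine.init w)) = some c ∧
    Machine.step M c = none ∧
    (c.tape 1).right₀ = Turing.ListBlank.mk (tapeWord v)

/-! ### PIO functions -/

/-- The binary code of an integer: a sign bit, then the binary digits of the absolute value (least
significant digit first). -/
def encodeInt (z : ℤ) : List Bool := decide (z < 0) :: Computability.encodeNat z.natAbs

/-- The combined complexity `m_f(n) = log (1 + n) + log (2 + |f n|)` of the input and the output. -/
noncomputable def complexity (f : ℕ → ℤ) (n : ℕ) : ℝ :=
  Real.log (1 + (n : ℝ)) + Real.log (2 + |(f n : ℝ)|)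

/-- `M` is a PIO algorithm for the counting function `f` on the positive integers: for constants
`c, d` it computes, for every `n ≥ 1`, the binary code of `f n` from that of `n` in at most
`c * m_f(n) ^ d` steps. -/
def IsPIOAlgorithm (M : Machine) (f : ℕ → ℤ) : Prop :=
  ∃ c d : ℕ, ∀ n : ℕ, 1 ≤ n →
    Machine.ComputesWithin M (Computability.encodeNat n) (encodeInt (f n))
      (c * complexity f n ^ d)

/-- `f` is a PIO function. -/
def IsPIO (f : ℕ → ℤ) : Prop := ∃ M : Machine, IsPIOAlgorithm M f

/-! ### Poly-time computable sequences, finite or infinite -/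

/-- `g 1 < g 2 < ⋯` is a nonempty increasing sequence of positive integers, of finite or infinite
length `N`; the values of `g` at `0` and beyond `N` play no role. -/
def IsIncreasingSeq (N : ℕ∞) (g : ℕ → ℕ) : Prop :=
  1 ≤ N ∧ 1 ≤ g 1 ∧ ∀ i j : ℕ, 1 ≤ i → i < j → (j : ℕ∞) ≤ N → g i < g j

/-- The set `A = {g 1, g 2, …}` of the terms of a sequence of length `N`. -/
def terms (N : ℕ∞) (g : ℕ → ℕ) : Set ℕ :=
  {a | ∃ i : ℕ, 1 ≤ i ∧ (i : ℕ∞) ≤ N ∧ g i = a}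

open Classical in
/-- `M` computes the sequence `n ↦ g n` of length `N` in `poly(n)` steps: on input `n ≥ 1` (in
binary) it outputs `g n` (in binary) if the sequence has an `n`-th term, and reports that it has
none, by the output `0`, otherwise. -/
def IsPolyAlgorithm (M : Machine) (N : ℕ∞) (g : ℕ → ℕ) : Prop :=
  ∃ c d : ℕ, ∀ n : ℕ, 1 ≤ n →
    Machine.ComputesWithin M (Computability.encodeNat n)
      (Computability.encodeNat (if (n : ℕ∞) ≤ N then g n else 0))
      (c * (1 + (n : ℝ)) ^ d)

/-! ### The counting function -/

open Classical in
/-- The number of partitions of `n` all of whose nonzero multiplicities lie in `A`. -/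
noncomputable def restMult (A : Set ℕ) (n : ℕ) : ℕ :=
  (Finset.univ.filter fun p : n.Partition => ∀ i ∈ p.parts, p.parts.count i ∈ A).card

/-- `d` is the greatest common divisor of the set `S` of natural numbers. -/
def IsGcd (S : Set ℕ) (d : ℕ) : Prop := ∀ k : ℕ, k ∣ d ↔ ∀ a ∈ S, k ∣ a

end Pio

namespace Pio

/-! ### Runs of a machine -/

/-! The number `n` is the sum of its parts weighted by their multiplicities, so `d ∣ n` whenever all
multiplicities lie in `A` (`restMult_eq_zero`). If `d ∤ n`, the answer is `0`, and one only has to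
reduce `n` modulo the constant `d`, in time polynomial in the number of digits of `n`.

If `d ∣ n`, the value is large: at least `2 ^ s` as soon as `n ≥ C (s + 1) ^ 2`
(`exists_pow_le_restMult`). Indeed, fix `a ∈ A`. Some admissible multiset, with sum bounded
independently of `n`, has a sum congruent to `n` modulo `a`; the rest `n - sum = a m` is spent on
parts of multiplicity exactly `a`, namely an arbitrary subset of `s` medium-sized parts and one big
part that fills up to `m`. Hence `n` is at most a constant times `m_f(n) ^ 2`
(`exists_le_complexity_sq`), and any algorithm polynomial in `n` itself is fast enough.

Such an algorithm is Kronecker substitution. Only parts and multiplicities up to `n` matter, and the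
latter are among `g 1, …, g n` because `j ≤ g j`. The truncated product is evaluated at `2 ^ W` with
`W = (n + 1) ^ 2`; its coefficients are smaller than `2 ^ W`, so the wanted one is a block of `W`
binary digits (`kronecker_digit`). The product is obtained by shifts and additions.

The rest turns this into an honest Turing machine, uniformly in `M` and `d`. A small structured
language is compiled to tables of rules; the compiler is correct step by step (`Exec.steps`) and
primitive recursive in `(M, d)` (`Cmd.primrec_code`). The parameter `d` enters as the number of
copies of a block, and `M` as a block of rules on tapes of its own. After each call these tapes must
be blank again, so a clock records how far `M` can have strayed and governs the erasure
(`runs_call`). Finally, `Sem` counts operations: an operation lengthens the numbers by at most one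
digit, or to at most `D` digits, at linear cost, so polynomially many operations take polynomial
time. Everything is assembled in `isPIOAlgorithm_pioProg`. -/

/-- The machine goes from `c` to `c'` in `k` steps. -/
def Steps (R : Machine) (c : Cfg) (k : ℕ) (c' : Cfg) : Prop :=
  (fun o : Option Cfg => o.bind (Machine.step R))^[k] (some c) = some c'

theorem Steps.trans {R : Machine} {c₁ c₂ c₃ : Cfg} {k l : ℕ} (h : Steps R c₁ k c₂)
    (h' : Steps R c₂ l c₃) : Steps R c₁ (k + l) c₃ := by
  unfold Steps at *
  rw [Nat.add_comm, Function.iterate_add_apply, h, h']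

theorem Steps.single {R : Machine} {c c' : Cfg} (h : Machine.step R c = some c') :
    Steps R c 1 c' := by
  simpa [Steps] using h

/-- On the states from `s` to `e - 1`, the machine `R` behaves like the table `C`. -/
def Agrees (R C : Machine) (s e : ℕ) : Prop :=
  ∀ c : Cfg, s ≤ c.state → c.state < e → Machine.step R c = Machine.step C c

theorem step_append_left {C₁ C₂ : Machine} {c : Cfg} (h : ∀ r ∈ C₂, r.1.1 ≠ c.state) :
    Machine.step (C₁ ++ C₂) c = Machine.step C₁ c := by
  have : C₂.find? (fun r => Rule.applies r c) = none := by
    rw [List.find?_eq_none]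
    intro r hr
    simp [Rule.applies, (h r hr).symm]
  simp [Machine.step, List.find?_append, this]

theorem step_append_right {C₁ C₂ : Machine} {c : Cfg} (h : ∀ r ∈ C₁, r.1.1 ≠ c.state) :
    Machine.step (C₁ ++ C₂) c = Machine.step C₂ c := by
  have : C₁.find? (fun r => Rule.applies r c) = none := by
    rw [List.find?_eq_none]
    intro r hr
    simp [Rule.applies, (h r hr).symm]
  simp [Machine.step, List.find?_append, this]

theorem step_eq_none {C : Machine} {c : Cfg} (h : ∀ r ∈ C, r.1.1 ≠ c.state) :
    Machine.step C c = none := by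
  simp only [Machine.step, Option.map_eq_none_iff, List.find?_eq_none]
  intro r hr
  simp [Rule.applies, (h r hr).symm]

/-- Blocks of a table own disjoint intervals of states, so within the interval of one block no rule
of the other can fire, whatever the order of the rules. -/
theorem Agrees.append {R C₁ C₂ : Machine} {s m e : ℕ} (h : Agrees R (C₁ ++ C₂) s e)
    (h₁ : ∀ r ∈ C₁, s ≤ r.1.1 ∧ r.1.1 < m) (h₂ : ∀ r ∈ C₂, m ≤ r.1.1 ∧ r.1.1 < e)
    (hs : s ≤ m) (he : m ≤ e) : Agrees R C₁ s m ∧ Agrees R C₂ m e := by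
  constructor
  · intro c h3 h4
    rw [h c h3 (by omega), step_append_left]
    intro r hr
    have := h₂ r hr
    omega
  · intro c h3 h4
    rw [h c (by omega) h4, step_append_right]
    intro r hr
    have := h₁ r hr
    omega

/-! ### A structured language for multitape machines -/

/-- The number of program tapes; the tapes of the simulated machine are the ones from there on. -/
def numTapes : ℕ := 16

/-- The tape on which the steps of the simulated machine are counted. -/
def clockTape : ℕ := 15

/-- Structured programs. -/
inductive Cmd
  /-- an action on a tape -/
  | act (t : ℕ) (x : Action)
  /-- one program after the other -/
  | seq (p q : Cmd)
  /-- `p` if the head of tape `t` scans `a`, and `q` if not -/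
  | ite (t a : ℕ) (p q : Cmd)
  /-- repeat `p` until the head of tape `t` scans `a` -/
  | loop (t a : ℕ) (p : Cmd)
  /-- `p` for a number of times that is a parameter of the program -/
  | rep (p : Cmd)
  /-- run the machine that is a parameter of the program, counting steps on the clock tape -/
  | sim
  /-- erase the scanned cells of all tapes of the simulated machine, and move its heads -/
  | wipe (x : Turing.Dir)

/-- Write a mark and move right. -/
def tick : Action := (some 2, some Turing.Dir.right)

/-- A bound for the states of a machine. -/
def stateBound (M : Machine) : ℕ := M.foldr (fun r n => r.1.1 + r.2.1 + n) 1

/-- A bound for the tapes that a machine changes. -/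
def tapeBound (M : Machine) : ℕ := M.foldr (fun r n => r.2.2.length + n) 2

/-- The number of states of the compiled program. -/
def Cmd.size (P : Machine × ℕ) : Cmd → ℕ
  | .act _ _ => 1
  | .seq p q => p.size P + q.size P
  | .ite _ _ p q => 2 + p.size P + q.size P
  | .loop _ _ p => 2 + p.size P
  | .rep p => P.2 * p.size P
  | .sim => stateBound P.1
  | .wipe _ => 1

/-- An unconditional jump. -/
def jump (s e : ℕ) : Rule := ((s, []), (e, []))

/-- A rule of the simulated machine, as a rule of the simulating one. -/
def simRule (s : ℕ) (r : Rule) : Rule :=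
  ((s + r.1.1, List.replicate numTapes none ++ r.1.2),
    (s + r.2.1, (List.replicate clockTape (none, none) ++ [tick]) ++ r.2.2))

/-- The table of a program that starts in state `s` and ends in state `s + p.size P`. -/
def Cmd.code (P : Machine × ℕ) : Cmd → ℕ → List Rule
  | .act t x, s => [((s, []), (s + 1, List.replicate t (none, none) ++ [x]))]
  | .seq p q, s => p.code P s ++ q.code P (s + p.size P)
  | .ite t a p q, s =>
    [((s, List.replicate t none ++ [some a]), (s + 1, [])), jump s (s + 2 + p.size P)] ++
    (p.code P (s + 1) ++ ([jump (s + 1 + p.size P) (s + (2 + p.size P + q.size P))] ++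
    q.code P (s + 2 + p.size P)))
  | .loop t a p, s =>
    [((s, List.replicate t none ++ [some a]), (s + (2 + p.size P), [])), jump s (s + 1)] ++
    (p.code P (s + 1) ++ [jump (s + 1 + p.size P) s])
  | .rep p, s => (List.range P.2).flatMap fun i => p.code P (s + i * p.size P)
  | .sim, s => P.1.map (simRule s) ++
    (List.range (stateBound P.1)).map fun q => jump (s + q) (s + stateBound P.1)
  | .wipe x, s => [((s, []), (s + 1, List.replicate numTapes (none, none) ++
      List.replicate (tapeBound P.1) (some 0, some x)))]

theorem lt_stateBound {M : Machine} {r : Rule} (h : r ∈ M) :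
    r.1.1 < stateBound M ∧ r.2.1 < stateBound M := by
  induction M with
  | nil => simp at h
  | cons a M ih =>
    have h1 : 1 ≤ stateBound M := by
      clear ih h
      induction M with
      | nil => simp [stateBound]
      | cons a M ih => simp only [stateBound, List.foldr_cons] at *; omega
    rcases List.mem_cons.1 h with rfl | h
    · simp only [stateBound, List.foldr_cons] at *; omega
    · have := ih h
      simp only [stateBound, List.foldr_cons] at *; omega

theorem stateBound_pos (M : Machine) : 0 < stateBound M := by
  induction M with
  | nil => simp [stateBound]
  | cons a M ih => simp only [stateBound, List.foldr_cons] at *; omega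

theorem two_le_tapeBound (M : Machine) : 2 ≤ tapeBound M := by
  induction M with
  | nil => simp [tapeBound]
  | cons a M ih => simp only [tapeBound, List.foldr_cons] at *; omega

theorem length_le_tapeBound {M : Machine} {r : Rule} (h : r ∈ M) :
    r.2.2.length ≤ tapeBound M := by
  induction M with
  | nil => simp at h
  | cons a M ih =>
    rcases List.mem_cons.1 h with rfl | h
    · simp only [tapeBound, List.foldr_cons]; omega
    · have := ih h
      simp only [tapeBound, List.foldr_cons] at *; omega

/-- This is what makes compilation compositional. It also shows that the exit state `s + p.size P`
has no rule, so that a compiled program halts there. -/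
theorem Cmd.code_state {P : Machine × ℕ} {p : Cmd} {s : ℕ} {r : Rule} (h : r ∈ p.code P s) :
    s ≤ r.1.1 ∧ r.1.1 < s + p.size P := by
  induction p generalizing s r with
  | act t x => simp [code] at h; simp [h, size]
  | seq p q ihp ihq =>
    rcases List.mem_append.1 h with h | h
    · have := ihp h; simp only [size]; omega
    · have := ihq h; simp only [size]; omega
  | ite t a p q ihp ihq =>
    simp only [code, List.mem_append, List.mem_cons, List.not_mem_nil, or_false] at h
    simp only [size]
    rcases h with (h | h) | h | h | h
    · subst h; dsimp; omega
    · subst h; dsimp [jump]; omega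
    · have := ihp h; omega
    · subst h; dsimp [jump]; omega
    · have := ihq h; omega
  | loop t a p ihp =>
    simp only [code, List.mem_append, List.mem_cons, List.not_mem_nil, or_false] at h
    simp only [size]
    rcases h with (h | h) | h | h
    · subst h; dsimp; omega
    · subst h; dsimp [jump]; omega
    · have := ihp h; omega
    · subst h; dsimp [jump]; omega
  | rep p ihp =>
    simp only [code, List.mem_flatMap, List.mem_range] at h
    obtain ⟨i, hi, h⟩ := h
    have := ihp h
    have h2 : (i + 1) * p.size P ≤ P.2 * p.size P := Nat.mul_le_mul_right _ hi
    simp only [size]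
    rw [Nat.succ_mul] at h2
    omega
  | sim =>
    simp only [code, List.mem_append, List.mem_map, List.mem_range] at h
    simp only [size]
    rcases h with ⟨r', h, rfl⟩ | ⟨q, h, rfl⟩
    · have := lt_stateBound h
      simp only [simRule]; omega
    · simp only [jump]; omega
  | wipe x => simp [code] at h; simp [h, size]

/-! ### Big-step semantics of programs and correctness of the compiler -/

/-- The contents of the tapes. -/
abbrev Tapes := ℕ → Turing.Tape ℕ

/-- The tapes of the simulated machine. -/
def Tapes.inner (T : Tapes) : Tapes := fun t => T (numTapes + t)

/-- The tapes after a simulation of `k` steps that ends with the tapes `T'`. -/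
def Tapes.simulated (T T' : Tapes) (k : ℕ) : Tapes := fun t =>
  if numTapes ≤ t then T' (t - numTapes)
  else if t = clockTape then (Action.run tick)^[k] (T t) else T t

/-- The tapes after a `wipe`. -/
def Tapes.wiped (m : ℕ) (x : Turing.Dir) (T : Tapes) : Tapes := fun t =>
  if numTapes ≤ t ∧ t < numTapes + m then Action.run (some 0, some x) (T t) else T t

/-- Big-step semantics: the program takes the first tapes to the second ones in `k` steps. -/
inductive Exec (P : Machine × ℕ) : Cmd → Tapes → ℕ → Tapes → Prop
  | act (t : ℕ) (x : Action) (T : Tapes) :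
    Exec P (.act t x) T 1 (Function.update T t (x.run (T t)))
  | seq {p q : Cmd} {T₁ T₂ T₃ : Tapes} {k l : ℕ} :
    Exec P p T₁ k T₂ → Exec P q T₂ l T₃ → Exec P (.seq p q) T₁ (k + l) T₃
  | ite_pos {t a : ℕ} {p : Cmd} (q : Cmd) {T₁ T₂ : Tapes} {k : ℕ} :
    (T₁ t).head = a → Exec P p T₁ k T₂ → Exec P (.ite t a p q) T₁ (1 + k + 1) T₂
  | ite_neg {t a : ℕ} (p : Cmd) {q : Cmd} {T₁ T₂ : Tapes} {k : ℕ} :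
    (T₁ t).head ≠ a → Exec P q T₁ k T₂ → Exec P (.ite t a p q) T₁ (1 + k) T₂
  | loop_end {t a : ℕ} (p : Cmd) {T : Tapes} :
    (T t).head = a → Exec P (.loop t a p) T 1 T
  | loop_step {t a : ℕ} {p : Cmd} {T₁ T₂ T₃ : Tapes} {k l : ℕ} :
    (T₁ t).head ≠ a → Exec P p T₁ k T₂ → Exec P (.loop t a p) T₂ l T₃ →
    Exec P (.loop t a p) T₁ (1 + k + 1 + l) T₃
  | rep {p : Cmd} (T : ℕ → Tapes) (k : ℕ → ℕ) :
    (∀ i < P.2, Exec P p (T i) (k i) (T (i + 1))) →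
    Exec P (.rep p) (T 0) (∑ i ∈ Finset.range P.2, k i) (T P.2)
  | sim {T : Tapes} {k : ℕ} {c : Cfg} :
    Steps P.1 ⟨0, T.inner⟩ k c → Machine.step P.1 c = none →
    Exec P .sim T (k + 1) (T.simulated c.tape k)
  | wipe (x : Turing.Dir) (T : Tapes) :
    Exec P (.wipe x) T 1 (T.wiped (tapeBound P.1) x)

theorem Action.run_none (T : Turing.Tape ℕ) : Action.run (none, none) T = T := rfl

theorem jump_step {R : Machine} {s e : ℕ} {T : Tapes} :
    Machine.step (jump s e :: R) ⟨s, T⟩ = some ⟨e, T⟩ := by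
  simp [Machine.step, jump, Rule.applies, Rule.run, Action.run_none]

theorem test_applies {s t a e : ℕ} {T : Tapes} {acts : List Action} :
    Rule.applies ((s, List.replicate t none ++ [some a]), (e, acts)) ⟨s, T⟩ =
      ((T t).head == a) := by
  simp only [Rule.applies, beq_self_eq_true, Bool.true_and, List.zipIdx_append, List.all_append]
  have : ((List.replicate t (none : Option ℕ)).zipIdx.all
      fun p => p.1.all fun a => (T p.2).head == a) = true := by
    rw [List.all_eq_true]
    intro p hp
    have := List.fst_mem_of_mem_zipIdx hp
    rw [List.eq_of_mem_replicate this]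
    rfl
  rw [this]
  simp

theorem test_step_pos {R : Machine} {s t a e : ℕ} {T : Tapes} (h : (T t).head = a) :
    Machine.step (((s, List.replicate t none ++ [some a]), (e, [])) :: R) ⟨s, T⟩ =
      some ⟨e, T⟩ := by
  simp [Machine.step, test_applies, h, Rule.run, Action.run_none]

theorem test_step_neg {R : Machine} {s t a e : ℕ} {T : Tapes} (h : (T t).head ≠ a) :
    Machine.step (((s, List.replicate t none ++ [some a]), (e, [])) :: R) ⟨s, T⟩ =
      Machine.step R ⟨s, T⟩ := by
  simp [Machine.step, test_applies, h]

theorem simRule_applies {s : ℕ} {r : Rule} {q : ℕ} {T : Tapes} :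
    Rule.applies (simRule s r) ⟨s + q, T⟩ = Rule.applies r ⟨q, T.inner⟩ := by
  simp only [Rule.applies, simRule, List.zipIdx_append, List.all_append]
  have : ((List.replicate numTapes (none : Option ℕ)).zipIdx.all
      fun p => p.1.all fun a => (T p.2).head == a) = true := by
    rw [List.all_eq_true]
    intro p hp
    have := List.fst_mem_of_mem_zipIdx hp
    rw [List.eq_of_mem_replicate this]
    rfl
  rw [this, Bool.true_and, List.zipIdx_eq_map_add, List.all_map]
  congr 1
  · rw [Bool.eq_iff_iff]; simp

theorem simulated_zero (T : Tapes) : T.simulated T.inner 0 = T := by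
  funext t
  by_cases h : numTapes ≤ t
  · simp [Tapes.simulated, h, Tapes.inner]
  · simp [Tapes.simulated, h]

/-- The padded action list has three ranges: nothing below the clock tape, a tick on it, and the
original actions from tape `numTapes` on. -/
theorem simRule_run {s : ℕ} {r : Rule} {q k : ℕ} {T T' : Tapes} :
    Rule.run (simRule s r) ⟨s + q, T.simulated T' k⟩ =
      ⟨s + r.2.1, T.simulated (Rule.run r ⟨q, T'⟩).tape (k + 1)⟩ := by
  simp only [Rule.run, simRule, Cfg.mk.injEq, true_and]
  funext t
  by_cases h : numTapes ≤ t
  · rw [List.getD_append_right _ _ _ _ (by simpa [clockTape, numTapes] using h)]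
    simp only [Tapes.simulated, h, if_true]
    simp [clockTape, numTapes]
  · rw [List.getD_append _ _ _ _ (by simpa [clockTape, numTapes] using h)]
    simp only [Tapes.simulated, h, if_false]
    by_cases h2 : t = clockTape
    · subst h2
      rw [List.getD_append_right _ _ _ _ (by simp)]
      simp [Function.iterate_succ_apply']
    · have h3 : t < clockTape := by simp [clockTape, numTapes] at *; omega
      rw [List.getD_append _ _ _ _ (by simpa using h3)]
      simp [h2, h3, Action.run_none]

theorem map_simRule_step {M : Machine} {s q k : ℕ} {T T' : Tapes} :
    Machine.step (M.map (simRule s)) ⟨s + q, T.simulated T' k⟩ =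
      (Machine.step M ⟨q, T'⟩).map fun c => ⟨s + c.state, T.simulated c.tape (k + 1)⟩ := by
  have hi : (T.simulated T' k).inner = T' := by
    funext t; simp [Tapes.inner, Tapes.simulated]
  simp only [Machine.step, List.find?_map, Option.map_map]
  have : ((fun r => Rule.applies r ⟨s + q, T.simulated T' k⟩) ∘ simRule s) =
      fun r => Rule.applies r ⟨q, T'⟩ := by
    funext r
    simp only [Function.comp, simRule_applies, hi]
  rw [this]
  congr 1
  funext r
  simp only [Function.comp, simRule_run]
  rfl

theorem state_lt_of_step {M : Machine} {c c' : Cfg} (h : Machine.step M c = some c') :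
    c'.state < stateBound M := by
  simp only [Machine.step, Option.map_eq_some_iff] at h
  obtain ⟨r, h, rfl⟩ := h
  exact (lt_stateBound (List.mem_of_find?_eq_some h)).2

theorem Steps.succ_iff {R : Machine} {c c' : Cfg} {k : ℕ} :
    Steps R c (k + 1) c' ↔ ∃ c₁, Steps R c k c₁ ∧ Machine.step R c₁ = some c' := by
  simp only [Steps, Function.iterate_succ_apply', Option.bind_eq_some_iff]

/-- The exit jumps stand behind the translated rules, and the first applicable rule is taken; hence
no jump fires while the simulated machine can still move. -/
theorem sim_steps {M R : Machine} {s k : ℕ} {T : Tapes} {c : Cfg}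
    (hR : Agrees R (M.map (simRule s) ++
      (List.range (stateBound M)).map fun q => jump (s + q) (s + stateBound M)) s
      (s + stateBound M)) (h : Steps M ⟨0, T.inner⟩ k c) :
    c.state < stateBound M ∧ Steps R ⟨s, T⟩ k ⟨s + c.state, T.simulated c.tape k⟩ := by
  induction k generalizing c with
  | zero =>
    obtain rfl : (⟨0, T.inner⟩ : Cfg) = c := by simpa [Steps] using h
    exact ⟨stateBound_pos M, by simp [Steps, simulated_zero]⟩
  | succ k ih =>
    obtain ⟨c₁, h1, h2⟩ := Steps.succ_iff.1 h
    obtain ⟨h3, h4⟩ := ih h1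
    refine ⟨state_lt_of_step h2, h4.trans (Steps.single ?_)⟩
    rw [hR _ (by simp) (by simpa using h3)]
    have : Machine.step (M.map (simRule s)) ⟨s + c₁.state, T.simulated c₁.tape k⟩ =
        some ⟨s + c.state, T.simulated c.tape (k + 1)⟩ := by
      rw [map_simRule_step, h2]; rfl
    simp only [Machine.step, List.find?_append] at this ⊢
    cases h5 : List.find? (fun r => Rule.applies r ⟨s + c₁.state, T.simulated c₁.tape k⟩)
        (M.map (simRule s)) with
    | none => simp [h5] at this
    | some r => simpa [h5] using this

/-- A halting configuration is one to which no rule applies, so exactly then the search falls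
through to the jump of the current state. -/
theorem exit_sim {M : Machine} {s k : ℕ} {T T' : Tapes} {q : ℕ} (hq : q < stateBound M)
    (h : Machine.step M ⟨q, T'⟩ = none) :
    Machine.step (M.map (simRule s) ++
      (List.range (stateBound M)).map fun q => jump (s + q) (s + stateBound M))
      ⟨s + q, T.simulated T' k⟩ = some ⟨s + stateBound M, T.simulated T' k⟩ := by
  have h1 : Machine.step (M.map (simRule s)) ⟨s + q, T.simulated T' k⟩ = none := by
    rw [map_simRule_step, h]; rfl
  have h2 : List.find? (fun r => Rule.applies r ⟨s + q, T.simulated T' k⟩)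
      (M.map (simRule s)) = none := by simpa [Machine.step] using h1
  simp only [Machine.step, List.find?_append, h2, Option.none_or]
  have h3 : ((List.range (stateBound M)).map fun q => jump (s + q) (s + stateBound M)).find?
      (fun r => Rule.applies r ⟨s + q, T.simulated T' k⟩) =
      some (jump (s + q) (s + stateBound M)) := by
    rw [List.find?_map]
    have : (List.range (stateBound M)).find? ((fun r => Rule.applies r
        ⟨s + q, T.simulated T' k⟩) ∘ fun q => jump (s + q) (s + stateBound M)) = some q := by
      rw [List.find?_range_eq_some]
      refine ⟨by simp [jump, Rule.applies], by simpa using hq, ?_⟩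
      intro j hj
      simp [jump, Rule.applies]
      omega
    rw [this]; rfl
  rw [h3]
  simp [jump, Rule.run, Action.run_none]

theorem Agrees.rep {R : Machine} {P : Machine × ℕ} {p : Cmd} {s : ℕ}
    (h : Agrees R (Cmd.code P (.rep p) s) s (s + Cmd.size P (.rep p))) {i : ℕ} (hi : i < P.2) :
    Agrees R (p.code P (s + i * p.size P)) (s + i * p.size P)
      (s + i * p.size P + p.size P) := by
  intro c h1 h2
  have h3 : (i + 1) * p.size P ≤ P.2 * p.size P := Nat.mul_le_mul_right _ hi
  rw [Nat.succ_mul] at h3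
  rw [h c (by omega) (by simp only [Cmd.size]; omega)]
  simp only [Cmd.code]
  -- The copies split into those before number `i`, copy `i` itself and those after it; the outer
  -- two groups own no state of the interval in question.
  obtain ⟨m, hm⟩ : ∃ m, P.2 = i + (1 + m) := ⟨P.2 - i - 1, by omega⟩
  rw [hm, List.range_add, List.flatMap_append, step_append_right, Nat.add_comm 1 m,
    List.range_succ_eq_map, List.map_cons, List.flatMap_cons, step_append_left]
  · rfl
  · intro r hr
    simp only [List.map_map, List.mem_flatMap, List.mem_map, List.mem_range,
      Function.comp] at hr
    obtain ⟨_, ⟨j, _, rfl⟩, hr⟩ := hr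
    have := (Cmd.code_state hr).1
    have h4 : (i + 1) * p.size P ≤ (i + j.succ) * p.size P :=
      Nat.mul_le_mul_right _ (by omega)
    rw [Nat.succ_mul] at h4
    omega
  · intro r hr
    simp only [List.mem_flatMap, List.mem_range] at hr
    obtain ⟨j, hj, hr⟩ := hr
    have := (Cmd.code_state hr).2
    have h4 : (j + 1) * p.size P ≤ i * p.size P := Nat.mul_le_mul_right _ hj
    rw [Nat.succ_mul] at h4
    omega

/-- The table of a program carries out the program. -/
theorem Exec.steps {P : Machine × ℕ} {p : Cmd} {T T' : Tapes} {k : ℕ} (h : Exec P p T k T') :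
    ∀ (R : Machine) (s : ℕ), Agrees R (p.code P s) s (s + p.size P) →
      Steps R ⟨s, T⟩ k ⟨s + p.size P, T'⟩ := by
  induction h with
  | act t x T =>
    intro R s hR
    refine Steps.single ?_
    rw [hR _ (by simp) (by simp [Cmd.size])]
    simp only [Cmd.code, Machine.step, Rule.applies, Rule.run]
    simp only [beq_self_eq_true, List.zipIdx_nil, List.all_nil, Bool.and_self,
        List.find?_cons_of_pos, Option.map_some, Cmd.size, Option.some.injEq, Cfg.mk.injEq,
        true_and]
    funext t'
    rcases lt_trichotomy t' t with h | rfl | h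
    · rw [List.getD_append _ _ _ _ (by simpa using h)]
      simp [h, h.ne, Action.run_none]
    · rw [List.getD_append_right _ _ _ _ (by simp)]
      simp
    · rw [List.getD_eq_default _ _ (by simp; omega)]
      simp [h.ne', Action.run_none]
  | @seq p q T₁ T₂ T₃ k l _ _ ih1 ih2 =>
    intro R s hR
    simp only [Cmd.code, Cmd.size, ← Nat.add_assoc] at hR ⊢
    obtain ⟨h1, h2⟩ := hR.append (fun r => Cmd.code_state) (fun r => Cmd.code_state)
      (by omega) (by omega)
    exact (ih1 R s h1).trans (ih2 R _ h2)
  | @ite_pos t a p q T₁ T₂ k ht _ ih =>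
    intro R s hR
    simp only [Cmd.code, Cmd.size] at hR ⊢
    have hj := hR
    obtain ⟨h1, h2⟩ := hR.append (m := s + 1) (by simp [jump])
      (fun r hr => by
        simp only [List.mem_append, List.mem_singleton] at hr
        rcases hr with hr | rfl | hr
        · have := Cmd.code_state hr; omega
        · dsimp [jump]; omega
        · have := Cmd.code_state hr; omega) (by omega) (by omega)
    obtain ⟨h2, h3⟩ := h2.append (m := s + 1 + p.size P) (fun r => Cmd.code_state)
      (fun r hr => by
        simp only [List.mem_append, List.mem_singleton] at hr
        rcases hr with rfl | hr
        · dsimp [jump]; omega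
        · have := Cmd.code_state hr; omega) (by omega) (by omega)
    refine (Steps.trans (Steps.single ?_) (ih R _ h2)).trans (Steps.single ?_)
    · rw [h1 _ (by simp) (by simp)]
      exact test_step_pos ht
    · rw [h3 _ (by simp) (by dsimp; omega)]
      exact jump_step
  | @ite_neg t a p q T₁ T₂ k ht _ ih =>
    intro R s hR
    simp only [Cmd.code, Cmd.size] at hR ⊢
    obtain ⟨h1, h2⟩ := hR.append (m := s + 1) (by simp [jump])
      (fun r hr => by
        simp only [List.mem_append, List.mem_singleton] at hr
        rcases hr with hr | rfl | hr
        · have := Cmd.code_state hr; omega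
        · dsimp [jump]; omega
        · have := Cmd.code_state hr; omega) (by omega) (by omega)
    obtain ⟨h2, h3⟩ := h2.append (m := s + 1 + p.size P) (fun r => Cmd.code_state)
      (fun r hr => by
        simp only [List.mem_append, List.mem_singleton] at hr
        rcases hr with rfl | hr
        · dsimp [jump]; omega
        · have := Cmd.code_state hr; omega) (by omega) (by omega)
    obtain ⟨_, h4⟩ := h3.append (m := s + 2 + p.size P) (by simp [jump])
      (fun r hr => by have := Cmd.code_state hr; omega) (by omega) (by omega)
    have h5 := ih R (s + 2 + p.size P)
      (by rwa [show s + 2 + p.size P + q.size P = s + (2 + p.size P + q.size P) by omega])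
    rw [show s + 2 + p.size P + q.size P = s + (2 + p.size P + q.size P) by omega] at h5
    refine (Steps.single ?_).trans h5
    rw [h1 _ (by simp) (by simp)]
    rw [test_step_neg ht]
    exact jump_step
  | @loop_end t a p T ht =>
    intro R s hR
    simp only [Cmd.code, Cmd.size] at hR ⊢
    refine Steps.single ?_
    rw [hR _ (by simp) (by dsimp; omega)]
    exact test_step_pos ht
  | @loop_step t a p T₁ T₂ T₃ k l ht _ _ ih1 ih2 =>
    intro R s hR
    have h0 := ih2 R s hR
    simp only [Cmd.code, Cmd.size] at hR h0 ⊢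
    obtain ⟨h1, h2⟩ := hR.append (m := s + 1) (by simp [jump])
      (fun r hr => by
        simp only [List.mem_append, List.mem_singleton] at hr
        rcases hr with hr | rfl
        · have := Cmd.code_state hr; omega
        · dsimp [jump]; omega) (by omega) (by omega)
    obtain ⟨h2, h3⟩ := h2.append (m := s + 1 + p.size P) (fun r => Cmd.code_state)
      (fun r hr => by
        simp only [List.mem_singleton] at hr
        subst hr
        dsimp [jump]; omega) (by omega) (by omega)
    refine ((Steps.trans (Steps.single ?_) (ih1 R _ h2)).trans (Steps.single ?_)).trans h0
    · rw [h1 _ (by simp) (by simp)]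
      rw [test_step_neg ht]
      exact jump_step
    · rw [h3 _ (by simp) (by dsimp; omega)]
      exact jump_step
  | @rep p T k _ ih =>
    intro R s hR
    have : ∀ m ≤ P.2, Steps R ⟨s, T 0⟩ (∑ i ∈ Finset.range m, k i)
        ⟨s + m * p.size P, T m⟩ := by
      intro m
      induction m with
      | zero => simp [Steps]
      | succ m ihm =>
        intro hm
        rw [Finset.sum_range_succ]
        have := ih m hm R _ (hR.rep hm)
        rw [Nat.add_assoc, ← Nat.succ_mul] at this
        exact (ihm (by omega)).trans this
    exact this _ le_rfl
  | @sim T k c h hc =>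
    intro R s hR
    obtain ⟨h1, h2⟩ := sim_steps hR h
    refine h2.trans (Steps.single ?_)
    rw [hR _ (by simp) (by simpa [Cmd.size] using h1)]
    exact exit_sim h1 hc
  | wipe x T =>
    intro R s hR
    refine Steps.single ?_
    rw [hR _ (by simp) (by simp [Cmd.size])]
    simp only [Cmd.code, Machine.step, Rule.applies, Rule.run]
    simp only [beq_self_eq_true, List.zipIdx_nil, List.all_nil, Bool.and_self,
        List.find?_cons_of_pos, Option.map_some, Cmd.size, Option.some.injEq, Cfg.mk.injEq,
        true_and]
    funext t
    by_cases h : numTapes ≤ t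
    · rw [List.getD_append_right _ _ _ _ (by simpa using h)]
      by_cases h2 : t < numTapes + tapeBound P.1
      · have h3 : t - numTapes < tapeBound P.1 := by omega
        simp [Tapes.wiped, h, h2, h3]
      · have h3 : ¬ t - numTapes < tapeBound P.1 := by omega
        simp [Tapes.wiped, h, h2, h3, Action.run_none]
    · rw [List.getD_append _ _ _ _ (by simpa using h)]
      simp [Tapes.wiped, h, Action.run_none]

/-! ### The table of a program can be computed from its parameters -/

theorem primrec_stateBound : Primrec stateBound := by
  refine Primrec.list_foldr (α := Machine) (β := Rule) (f := fun M => M) (g := fun _ => 1)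
    (h := fun _ x => x.1.1.1 + x.1.2.1 + x.2) Primrec.id (Primrec.const 1) ?_
  have h : Primrec fun x : Machine × (Rule × ℕ) => x.2.1 :=
    Primrec.fst.comp Primrec.snd
  exact Primrec.nat_add.comp (Primrec.nat_add.comp
    (Primrec.fst.comp (Primrec.fst.comp h)) (Primrec.fst.comp (Primrec.snd.comp h)))
    (Primrec.snd.comp Primrec.snd)

theorem primrec_tapeBound : Primrec tapeBound := by
  refine Primrec.list_foldr (α := Machine) (β := Rule) (f := fun M => M) (g := fun _ => 2)
    (h := fun _ x => x.1.2.2.length + x.2) Primrec.id (Primrec.const 2) ?_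
  have h : Primrec fun x : Machine × (Rule × ℕ) => x.2.1 :=
    Primrec.fst.comp Primrec.snd
  exact Primrec.nat_add.comp
    (Primrec.list_length.comp (Primrec.snd.comp (Primrec.snd.comp h)))
    (Primrec.snd.comp Primrec.snd)

theorem Cmd.primrec_size (p : Cmd) : Primrec fun P : Machine × ℕ => p.size P := by
  induction p with
  | act t x => exact Primrec.const 1
  | seq p q ihp ihq => exact Primrec.nat_add.comp ihp ihq
  | ite t a p q ihp ihq =>
    exact Primrec.nat_add.comp (Primrec.nat_add.comp (Primrec.const 2) ihp) ihq
  | loop t a p ihp => exact Primrec.nat_add.comp (Primrec.const 2) ihp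
  | rep p ihp => exact Primrec.nat_mul.comp Primrec.snd ihp
  | sim => exact primrec_stateBound.comp Primrec.fst
  | wipe x => exact Primrec.const 1

theorem primrec_replicate {α : Type*} [Primcodable α] (a : α) :
    Primrec fun n : ℕ => List.replicate n a := by
  have h : Primrec fun n : ℕ => (List.range n).map fun _ => a :=
    Primrec.list_map Primrec.list_range (Primrec.const a).to₂
  exact h.of_eq fun n => by simp

section
variable {α : Type*} [Primcodable α] {f g : α → ℕ}

theorem primrec_jump (hf : Primrec f) (hg : Primrec g) : Primrec fun a => jump (f a) (g a) :=
  Primrec.pair (Primrec.pair hf (Primrec.const [])) (Primrec.pair hg (Primrec.const []))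

theorem primrec_rule (l : List (Option ℕ)) (l' : List Action) (hf : Primrec f)
    (hg : Primrec g) : Primrec fun a => (((f a, l), (g a, l')) : Rule) :=
  Primrec.pair (Primrec.pair hf (Primrec.const l)) (Primrec.pair hg (Primrec.const l'))

end

theorem primrec_simRule : Primrec₂ simRule := by
  have hs : Primrec fun x : ℕ × Rule => x.1 := Primrec.fst
  have h1 : Primrec fun x : ℕ × Rule => x.2.1 := Primrec.fst.comp Primrec.snd
  have h2 : Primrec fun x : ℕ × Rule => x.2.2 := Primrec.snd.comp Primrec.snd
  exact Primrec.pair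
    (Primrec.pair (Primrec.nat_add.comp hs (Primrec.fst.comp h1))
      (Primrec.list_append.comp (Primrec.const _) (Primrec.snd.comp h1)))
    (Primrec.pair (Primrec.nat_add.comp hs (Primrec.fst.comp h2))
      (Primrec.list_append.comp (Primrec.const _) (Primrec.snd.comp h2)))

/-- The program is fixed and only its parameters vary, so the recursion over `p` happens outside:
each clause is a composition of primitive recursive list functions. -/
theorem Cmd.primrec_code (p : Cmd) : Primrec₂ fun (P : Machine × ℕ) (s : ℕ) => p.code P s := by
  have hs : Primrec fun x : (Machine × ℕ) × ℕ => x.2 := Primrec.snd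
  have hc (p : Cmd) : Primrec fun x : (Machine × ℕ) × ℕ => p.size x.1 :=
    p.primrec_size.comp Primrec.fst
  have hk (k : ℕ) : Primrec fun _ : (Machine × ℕ) × ℕ => k := Primrec.const k
  have single {α : Type} [Primcodable α] {f : α → Rule} (hf : Primrec f) :
      Primrec fun a => [f a] := Primrec.list_cons.comp hf (Primrec.const [])
  induction p with
  | act t x => exact single (primrec_rule _ _ hs (Primrec.nat_add.comp hs (hk 1)))
  | seq p q ihp ihq =>
    exact Primrec.list_append.comp (ihp.comp Primrec.fst hs)
      (ihq.comp Primrec.fst (Primrec.nat_add.comp hs (hc p)))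
  | ite t a p q ihp ihq =>
    have h1 := Primrec.nat_add.comp hs (hk 1)
    have h2 := Primrec.nat_add.comp (Primrec.nat_add.comp hs (hk 2)) (hc p)
    exact Primrec.list_append.comp
      (Primrec.list_cons.comp (primrec_rule _ _ hs h1) (single (primrec_jump hs h2)))
      (Primrec.list_append.comp (ihp.comp Primrec.fst h1)
        (Primrec.list_append.comp (single (primrec_jump (Primrec.nat_add.comp h1 (hc p))
          (Primrec.nat_add.comp hs
            (Primrec.nat_add.comp (Primrec.nat_add.comp (hk 2) (hc p)) (hc q)))))
          (ihq.comp Primrec.fst h2)))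
  | loop t a p ihp =>
    have h1 := Primrec.nat_add.comp hs (hk 1)
    exact Primrec.list_append.comp
      (Primrec.list_cons.comp (primrec_rule _ _ hs
        (Primrec.nat_add.comp hs (Primrec.nat_add.comp (hk 2) (hc p))))
        (single (primrec_jump hs h1)))
      (Primrec.list_append.comp (ihp.comp Primrec.fst h1)
        (single (primrec_jump (Primrec.nat_add.comp h1 (hc p)) hs)))
  | rep p ihp =>
    refine Primrec.list_flatMap
      (Primrec.list_range.comp (Primrec.snd.comp Primrec.fst)) ?_
    exact ihp.comp (Primrec.fst.comp Primrec.fst)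
      (Primrec.nat_add.comp (Primrec.snd.comp Primrec.fst)
        (Primrec.nat_mul.comp Primrec.snd ((hc p).comp Primrec.fst)))
  | sim =>
    have hb : Primrec fun x : (Machine × ℕ) × ℕ => stateBound x.1.1 :=
      primrec_stateBound.comp (Primrec.fst.comp Primrec.fst)
    refine Primrec.list_append.comp
      (Primrec.list_map (Primrec.fst.comp Primrec.fst)
        (primrec_simRule.comp (Primrec.snd.comp Primrec.fst) Primrec.snd))
      (Primrec.list_map (Primrec.list_range.comp hb) ?_)
    exact primrec_jump (Primrec.nat_add.comp (Primrec.snd.comp Primrec.fst) Primrec.snd)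
      (Primrec.nat_add.comp (Primrec.snd.comp Primrec.fst) (hb.comp Primrec.fst))
  | wipe x =>
    refine Primrec.list_cons.comp (Primrec.pair (Primrec.pair hs (Primrec.const []))
      (Primrec.pair (Primrec.nat_add.comp hs (hk 1)) (Primrec.list_append.comp (Primrec.const _)
        ((primrec_replicate _).comp (primrec_tapeBound.comp (Primrec.fst.comp Primrec.fst))))))
      (Primrec.const [])

/-! ### Binary numbers on tapes -/

/-- The tape with `L` (read from right to left) on the left of the head and `R` from the head on. -/
def zip (L R : List ℕ) : Turing.Tape ℕ :=
  Turing.Tape.mk' (Turing.ListBlank.mk L) (Turing.ListBlank.mk R)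

theorem mk_cons (a : ℕ) (l : List ℕ) :
    Turing.ListBlank.mk (a :: l) = (Turing.ListBlank.mk l).cons a := rfl

/-- Half-tapes are lists up to trailing blanks; this is the source of all rules below in which an
erased border cell disappears. -/
theorem mk_zero : (Turing.ListBlank.mk [0] : Turing.ListBlank ℕ) = Turing.ListBlank.mk [] :=
  Turing.ListBlank.cons_head_tail (Turing.ListBlank.mk [])

theorem zip_zero_right (L : List ℕ) : zip L [0] = zip L [] := by
  simp only [zip, mk_zero]

theorem zip_zero_left (R : List ℕ) : zip [0] R = zip [] R := by
  simp only [zip, mk_zero]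

theorem zip_cons_zero (L : List ℕ) (a : ℕ) : zip L [a, 0] = zip L [a] := by
  rw [zip, mk_cons, mk_zero]; rfl

theorem zip_head_nil (L : List ℕ) : (zip L []).head = 0 := rfl

theorem zip_head_cons (L : List ℕ) (a : ℕ) (R : List ℕ) : (zip L (a :: R)).head = a := rfl

theorem zip_right (L R : List ℕ) (a : ℕ) :
    Action.run (none, some Turing.Dir.right) (zip L (a :: R)) = zip (a :: L) R := rfl

theorem zip_write (L R : List ℕ) (a b : ℕ) :
    Action.run (some b, none) (zip L (a :: R)) = zip L (b :: R) := rfl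

theorem zip_write_nil (L : List ℕ) (b : ℕ) :
    Action.run (some b, none) (zip L []) = zip L [b] := rfl

theorem zip_write_right (L R : List ℕ) (a b : ℕ) :
    Action.run (some b, some Turing.Dir.right) (zip L (a :: R)) = zip (b :: L) R := rfl

theorem zip_write_right_nil (L : List ℕ) (b : ℕ) :
    Action.run (some b, some Turing.Dir.right) (zip L []) = zip (b :: L) [] := rfl

theorem zip_left (L R : List ℕ) (a : ℕ) :
    Action.run (none, some Turing.Dir.left) (zip (a :: L) R) = zip L (a :: R) := by
  cases R with
  | nil => exact Turing.Tape.move_left_mk' _ _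
  | cons b R => rfl

theorem zip_left_nil (R : List ℕ) :
    Action.run (none, some Turing.Dir.left) (zip [] R) = zip [] (0 :: R) := by
  rw [← zip_zero_left, zip_left]

theorem zip_erase_left (L : List ℕ) (a b : ℕ) :
    Action.run (some 0, some Turing.Dir.left) (zip (b :: L) [a]) = zip L [b] := by
  rw [← zip_cons_zero L b]; rfl

theorem zip_erase_left_nil (a : ℕ) :
    Action.run (some 0, some Turing.Dir.left) (zip [] [a]) = zip [] [] := by
  rw [← zip_zero_left, zip_erase_left, zip_zero_right]

/-- The tape word of a natural number. -/
def digits (x : ℕ) : List ℕ := tapeWord (Computability.encodeNat x)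

/-- The tape that holds a natural number. -/
def num (x : ℕ) : Turing.Tape ℕ := zip [] (digits x)

theorem digits_zero : digits 0 = [] := rfl

theorem digits_odd (x : ℕ) : digits (2 * x + 1) = 2 :: digits x := by
  have h : ((2 * x + 1 : ℕ) : Num) = Num.bit1 (x : Num) := by
    have := Num.ofNat'_bit true x
    simpa [Num.ofNat'_eq, Nat.bit] using this
  unfold digits Computability.encodeNat
  rw [h]
  cases (x : Num) <;> rfl

theorem digits_even {x : ℕ} (hx : x ≠ 0) : digits (2 * x) = 1 :: digits x := by
  have h : ((2 * x : ℕ) : Num) = Num.bit0 (x : Num) := by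
    have := Num.ofNat'_bit false x
    simpa [Num.ofNat'_eq, Nat.bit] using this
  unfold digits Computability.encodeNat
  rw [h]
  cases hx' : (x : Num) with
  | zero =>
    have : ((x : Num) : ℕ) = 0 := by rw [hx']; rfl
    simp at this
    omega
  | pos n => rfl

/-- Induction along the binary digits. -/
theorem binary_induction {p : ℕ → Prop} (h0 : p 0) (h1 : ∀ x, x ≠ 0 → p x → p (2 * x))
    (h2 : ∀ x, p x → p (2 * x + 1)) (x : ℕ) : p x := by
  induction x using Nat.strong_induction_on with
  | _ x ih =>
    rcases Nat.even_or_odd' x with ⟨y, rfl | rfl⟩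
    · rcases Nat.eq_zero_or_pos y with rfl | hy
      · exact h0
      · exact h1 y hy.ne' (ih y (by omega))
    · exact h2 y (ih y (by omega))

theorem digits_ne_zero (x : ℕ) : ∀ a ∈ digits x, a ≠ 0 := by
  intro a ha
  simp only [digits, tapeWord, List.mem_map] at ha
  obtain ⟨b, _, rfl⟩ := ha
  split <;> simp

theorem length_digits (x : ℕ) : (digits x).length = x.size := by
  induction x using binary_induction with
  | h0 => rfl
  | h1 x hx ih =>
    rw [digits_even hx, List.length_cons, ih]
    have := Nat.size_bit (b := false) (n := x) (by simp [Nat.bit]; omega)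
    simpa [Nat.bit] using this.symm
  | h2 x ih =>
    rw [digits_odd, List.length_cons, ih]
    have := Nat.size_bit (b := true) (n := x) (by simp [Nat.bit])
    simpa [Nat.bit] using this.symm

theorem num_zero : num 0 = zip [] [] := rfl

/-- The digits are nonblank and least significant first, so looking at a single cell decides whether
a number is zero and, by the next lemma, whether it is odd. -/
theorem head_num_eq_zero {x : ℕ} : (num x).head = 0 ↔ x = 0 := by
  induction x using binary_induction with
  | h0 => simp [num, digits_zero, zip_head_nil]
  | h1 x hx ih => simp [num, digits_even hx, zip_head_cons, hx]
  | h2 x ih => simp [num, digits_odd, zip_head_cons]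

theorem head_num_eq_two {x : ℕ} : (num x).head = 2 ↔ x % 2 = 1 := by
  induction x using binary_induction with
  | h0 => simp [num, digits_zero, zip_head_nil]
  | h1 x hx ih => simp [num, digits_even hx, zip_head_cons]
  | h2 x ih => simp [num, digits_odd, zip_head_cons]

/-! ### Runs of programs within a time bound -/

/-- The program takes the first tapes to the second ones in at most `k` steps. -/
def Runs (P : Machine × ℕ) (p : Cmd) (T : Tapes) (k : ℕ) (T' : Tapes) : Prop :=
  ∃ l ≤ k, Exec P p T l T'

variable {P : Machine × ℕ}

theorem Runs.mono {p : Cmd} {T T' : Tapes} {k l : ℕ} (h : Runs P p T k T') (hkl : k ≤ l) :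
    Runs P p T l T' :=
  let ⟨m, hm, h⟩ := h
  ⟨m, hm.trans hkl, h⟩

theorem Runs.to {p : Cmd} {T T' T'' : Tapes} {k l : ℕ} (h : Runs P p T k T') (hkl : k ≤ l)
    (hT : T' = T'') : Runs P p T l T'' := hT ▸ h.mono hkl

theorem Runs.act (t : ℕ) (x : Action) (T : Tapes) :
    Runs P (.act t x) T 1 (Function.update T t (x.run (T t))) := ⟨1, le_rfl, .act t x T⟩

theorem Runs.seq {p q : Cmd} {T₁ T₂ T₃ : Tapes} {k l : ℕ} (h : Runs P p T₁ k T₂)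
    (h' : Runs P q T₂ l T₃) : Runs P (.seq p q) T₁ (k + l) T₃ :=
  let ⟨_, hm, h⟩ := h
  let ⟨_, hn, h'⟩ := h'
  ⟨_, Nat.add_le_add hm hn, h.seq h'⟩

theorem Runs.ite_pos {t a : ℕ} {p : Cmd} (q : Cmd) {T₁ T₂ : Tapes} {k : ℕ}
    (ht : (T₁ t).head = a) (h : Runs P p T₁ k T₂) : Runs P (.ite t a p q) T₁ (k + 2) T₂ :=
  let ⟨_, hm, h⟩ := h
  ⟨_, by omega, h.ite_pos q ht⟩

theorem Runs.ite_neg {t a : ℕ} (p : Cmd) {q : Cmd} {T₁ T₂ : Tapes} {k : ℕ}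
    (ht : (T₁ t).head ≠ a) (h : Runs P q T₁ k T₂) : Runs P (.ite t a p q) T₁ (k + 2) T₂ :=
  let ⟨_, hm, h⟩ := h
  ⟨_, by omega, h.ite_neg p ht⟩

theorem Runs.loop_end {t a : ℕ} (p : Cmd) {T : Tapes} (ht : (T t).head = a) :
    Runs P (.loop t a p) T 1 T := ⟨1, le_rfl, .loop_end p ht⟩

theorem Runs.loop_step {t a : ℕ} {p : Cmd} {T₁ T₂ T₃ : Tapes} {k l : ℕ}
    (ht : (T₁ t).head ≠ a) (h : Runs P p T₁ k T₂) (h' : Runs P (.loop t a p) T₂ l T₃) :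
    Runs P (.loop t a p) T₁ (k + 2 + l) T₃ :=
  let ⟨_, hm, h⟩ := h
  let ⟨_, hn, h'⟩ := h'
  ⟨_, by omega, h.loop_step ht h'⟩

theorem Runs.act' {t : ℕ} {x : Action} {T : Tapes} {S S' : Turing.Tape ℕ} (h : T t = S)
    (h' : x.run S = S') : Runs P (.act t x) T 1 (Function.update T t S') := by
  subst h h'; exact Runs.act t x T

/-- Move the head to the first letter of the word that it is on, or just behind. -/
def rewind (t : ℕ) : Cmd :=
  .seq (.act t (none, some .left))
    (.seq (.loop t 0 (.act t (none, some .left))) (.act t (none, some .right)))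

theorem runs_left {t : ℕ} {L : List ℕ} (hL : ∀ a ∈ L, a ≠ 0) {a : ℕ} (ha : a ≠ 0) {R : List ℕ}
    {T : Tapes} (hT : T t = zip L (a :: R)) :
    Runs P (.loop t 0 (.act t (none, some .left))) T (3 * L.length + 4)
      (Function.update T t (zip [] (0 :: (L.reverse ++ a :: R)))) := by
  induction L generalizing a R T with
  | nil =>
    refine (Runs.loop_step (by rw [hT]; exact ha) (Runs.act' hT (zip_left_nil _))
      (Runs.loop_end _ ?_)).mono (by simp)
    simp [zip_head_cons]
  | cons b L ih =>
    have := ih (fun x hx => hL x (by simp [hx])) (a := b) (hL b (by simp)) (R := a :: R)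
      (T := Function.update T t (zip L (b :: a :: R))) (by simp)
    refine (Runs.loop_step (by rw [hT]; exact ha) (Runs.act' hT (zip_left _ _ _))
      (by simpa using this)).mono ?_
    simp; omega

/-- The first move to the left is unconditional, because the head may stand on the blank behind the
word, where the loop would end at once. -/
theorem runs_rewind {t : ℕ} {L R : List ℕ} (hL : ∀ a ∈ L, a ≠ 0) {T : Tapes}
    (hT : T t = zip L R) :
    Runs P (rewind t) T (3 * L.length + 4) (Function.update T t (zip [] (L.reverse ++ R))) := by
  cases L with
  | nil =>
    have h1 : Runs P (.loop t 0 (.act t (none, some .left)))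
        (Function.update T t (zip [] (0 :: R))) 1 _ := Runs.loop_end _ (by simp [zip_head_cons])
    have h := Runs.seq (Runs.act' hT (zip_left_nil _)) (h1.seq
      (Runs.act' (t := t) (S := zip [] (0 :: R)) (by simp) (zip_right _ _ _)))
    exact h.to (by simp) (by simp [zip_zero_left])
  | cons a L =>
    have h1 := runs_left (P := P) (t := t) (L := L) (fun b hb => hL b (by simp [hb])) (a := a)
      (hL a (by simp)) (R := R) (T := Function.update T t (zip L (a :: R))) (by simp)
    have h := Runs.seq (Runs.act' hT (zip_left _ _ _)) (h1.seq
      (Runs.act' (t := t) (S := zip [] (0 :: (L.reverse ++ a :: R))) (by simp) (zip_right _ _ _)))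
    exact h.to (by simp; omega) (by simp [zip_zero_left])

/-! ### Binary arithmetic on tapes -/

/-- The tape that holds the carry in arithmetic operations. -/
def flagTape : ℕ := 14

/-- The tape that holds the carry `b`. -/
def flag (b : Bool) : Turing.Tape ℕ := if b then zip [] [2] else zip [] []

theorem head_flag (b : Bool) : (flag b).head = if b then 2 else 0 := by
  cases b <;> rfl

theorem flag_set (b : Bool) : Action.run (some 2, none) (flag b) = flag true := by
  cases b <;> rfl

theorem flag_clear (b : Bool) : Action.run (some 0, none) (flag b) = flag false := by
  cases b
  · exact zip_zero_right []
  · exact zip_zero_right []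

/-- Add a carry to the number that starts at the head. -/
def propagate (t : ℕ) : Cmd :=
  .loop flagTape 0 (.ite t 2 (.act t (some 1, some .right))
    (.seq (.act t (some 2, some .right)) (.act flagTape (some 0, none))))

/-- Outside of the tapes in `s`, nothing has changed. -/
def SameOff (s : List ℕ) (T T' : Tapes) : Prop := ∀ t, t ∉ s → T' t = T t

/-- A carry turns ones into zeros until it meets a zero or the end of the word, where it is
absorbed. The word is split as `u ++ R` at the final head position; rewinding is left to the caller,
since in `add` the word extends further to the left, into `L`. -/
theorem runs_propagate {t : ℕ} (ht : t ≠ flagTape) (a : ℕ) {b : Bool} {T : Tapes} {L : List ℕ}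
    (h1 : T t = zip L (digits a)) (h2 : T flagTape = flag b) :
    ∃ T' u R, Runs P (propagate t) T (6 * a.size + 7) T' ∧ T' t = zip (u.reverse ++ L) R ∧
      T' flagTape = flag false ∧ SameOff [t, flagTape] T T' ∧
      u ++ R = digits (a + b.toNat) ∧ (∀ x ∈ u, x ≠ 0) ∧ u.length ≤ a.size + 1 := by
  cases b with
  | false =>
    exact ⟨T, [], digits a, (Runs.loop_end _ (by rw [h2]; rfl)).mono (by omega), h1, h2,
      fun _ _ => rfl, rfl, by simp, by simp⟩
  | true =>
  induction a using binary_induction generalizing T L with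
  | h0 =>
    have h3 := Runs.act' (P := P) h1 (zip_write_right_nil L 2)
    have h4 := h3.seq (Runs.act' (t := flagTape) (by simp [ht.symm, h2]) (flag_clear true))
    have h5 : Runs P (propagate t) T _ _ := Runs.loop_step (by rw [h2]; simp [head_flag])
      (Runs.ite_neg (a := 2) (.act t (some 1, some .right))
          (by rw [h1]; exact Nat.zero_ne_add_one 1) h4)
      (Runs.loop_end _ (by simp [head_flag]))
    refine ⟨_, [2], [], h5.mono (by omega), by simp [ht], by simp, ?_, ?_, by simp, by simp⟩
    · intro x hx
      simp at hx
      simp [hx]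
    · exact (digits_odd 0).symm
  | h1 a ha ih =>
    rw [digits_even ha] at h1
    have h3 := Runs.act' (P := P) h1 (zip_write_right L (digits a) 1 2)
    have h4 := h3.seq (Runs.act' (t := flagTape) (by simp [ht.symm, h2]) (flag_clear true))
    have h5 : Runs P (propagate t) T _ _ := Runs.loop_step (by rw [h2]; simp [head_flag])
      (Runs.ite_neg (a := 2) (.act t (some 1, some .right)) (by simp [h1, zip_head_cons]) h4)
      (Runs.loop_end _ (by simp [head_flag]))
    refine ⟨_, [2], digits a, h5.mono (by omega), by simp [ht], by simp, ?_, ?_, by simp,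
      by simp⟩
    · intro x hx
      simp at hx
      simp [hx]
    · exact (digits_odd a).symm
  | h2 a ih =>
    rw [digits_odd] at h1
    have h3 := Runs.act' (P := P) h1 (zip_write_right L (digits a) 2 1)
    obtain ⟨T', u, R, h4, h5, h6, h7, h8, h9, h10⟩ := ih (T := Function.update T t
      (zip (1 :: L) (digits a))) (L := 1 :: L) (by simp) (by simp [ht.symm, h2])
    have h11 : Runs P (propagate t) T _ _ := Runs.loop_step (by rw [h2]; simp [head_flag])
      (Runs.ite_pos (a := 2) _ (by simp [h1, zip_head_cons]) h3) h4
    have h12 : (2 * a + 1).size = a.size + 1 := by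
      rw [← length_digits, ← length_digits, digits_odd]; rfl
    refine ⟨T', 1 :: u, R, h11.mono (by omega), by simp [h5], h6, ?_, ?_, by simpa using h9,
      by simp; omega⟩
    · intro x hx
      rw [h7 x hx]
      simp at hx
      simp [hx]
    · have : digits (2 * (a + 1)) = 1 :: digits (a + 1) := digits_even (by omega)
      rw [List.cons_append, h8, Bool.toNat_true, ← this]
      congr 1

/-- Increase the number on a tape. -/
def inc (t : ℕ) : Cmd :=
  .seq (.act flagTape (some 2, none)) (.seq (propagate t) (rewind t))

theorem runs_inc {t : ℕ} (ht : t ≠ flagTape) {a : ℕ} {T : Tapes} (h1 : T t = num a)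
    (h2 : T flagTape = num 0) :
    Runs P (inc t) T (9 * a.size + 15) (Function.update T t (num (a + 1))) := by
  have h3 := Runs.act' (P := P) (t := flagTape) (S := flag false) h2 (flag_set false)
  obtain ⟨T', u, R, h4, h5, h6, h7, h8, h9, h10⟩ := runs_propagate (P := P) ht a (b := true)
    (T := Function.update T flagTape (flag true)) (L := []) (by simp [ht, h1, num]) (by simp)
  have h11 := runs_rewind (P := P) (T := T') (t := t) (L := u.reverse) (R := R)
    (by simpa using h9) (by simpa using h5)
  refine (h3.seq (h4.seq h11)).to (by simp; omega) ?_
  funext x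
  by_cases hx : x = t
  · subst hx; simp [h8, num]
  · by_cases hx2 : x = flagTape
    · subst hx2; simp [hx, h6, h2]; rfl
    · simp [hx, h7 x (by simp [hx, hx2]), hx2]

/-- Subtract the carry from the positive number that starts at the head. -/
def borrow (t : ℕ) : Cmd :=
  .loop flagTape 0 (.ite t 1 (.act t (some 2, some .right))
      (.seq (.act flagTape (some 0, none)) (.seq (.act t (none, some .right))
        (.ite t 0 (.seq (.act t (none, some .left)) (.act t (some 0, none)))
          (.seq (.act t (none, some .left)) (.act t (some 1, none)))))))

/-- Decrease the positive number on a tape. -/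
def dec (t : ℕ) : Cmd :=
  .seq (.act flagTape (some 2, none)) (.seq (borrow t) (rewind t))

theorem size_even {a : ℕ} (ha : a ≠ 0) : (2 * a).size = a.size + 1 := by
  rw [← length_digits, ← length_digits, digits_even ha]; rfl

theorem size_odd (a : ℕ) : (2 * a + 1).size = a.size + 1 := by
  rw [← length_digits, ← length_digits, digits_odd]; rfl

/-- A borrow turns zeros into ones up to the lowest one, which is cleared. As `a ≠ 0`, such a digit
exists and the loop ends. -/
theorem runs_borrow {t : ℕ} (ht : t ≠ flagTape) (a : ℕ) (ha : a ≠ 0) {T : Tapes} {L : List ℕ}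
    (h1 : T t = zip L (digits a)) (h2 : T flagTape = flag true) :
    ∃ T' u R, Runs P (borrow t) T (11 * a.size) T' ∧
      T' t = zip (u.reverse ++ L) R ∧
      T' flagTape = flag false ∧ SameOff [t, flagTape] T T' ∧
      u ++ R = digits (a - 1) ∧ (∀ x ∈ u, x ≠ 0) ∧ u.length ≤ a.size := by
  induction a using binary_induction generalizing T L with
  | h0 => exact absurd rfl ha
  | h1 a ha' ih =>
    rw [digits_even ha'] at h1
    have h3 := Runs.act' (P := P) h1 (zip_write_right L (digits a) 1 2)
    obtain ⟨T', u, R, h4, h5, h6, h7, h8, h9, h10⟩ := ih ha' (T := Function.update T t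
      (zip (2 :: L) (digits a))) (L := 2 :: L) (by simp) (by simp [ht.symm, h2])
    have h11 : Runs P (borrow t) T _ _ := Runs.loop_step (t := flagTape) (a := 0)
        (by rw [h2]; simp [head_flag])
      (Runs.ite_pos (a := 1) _ (by simp [h1, zip_head_cons]) h3) h4
    have h12 := size_even ha'
    refine ⟨T', 2 :: u, R, h11.mono (by omega), by simp [h5], h6, ?_, ?_, by simpa using h9,
      by simp; omega⟩
    · intro x hx
      rw [h7 x hx]
      simp at hx
      simp [hx]
    · have : digits (2 * (a - 1) + 1) = 2 :: digits (a - 1) := digits_odd _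
      rw [List.cons_append, h8, ← this]
      congr 1
      omega
  | h2 a ih =>
    rw [digits_odd] at h1
    have h12 := size_odd a
    have h3 := Runs.act' (P := P) (t := flagTape) h2 (flag_clear true)
    have h4 := Runs.act' (P := P) (T := Function.update T flagTape (flag false)) (t := t)
      (by simpa [ht] using h1) (zip_right _ _ _)
    -- If no digits follow, the cleared digit is the leading one and has to become a blank, since
    -- number words have no leading zeros; this is why the program peeks at the next cell.
    rcases Nat.eq_zero_or_pos a with rfl | ha
    · have h5 := Runs.act' (P := P) (T := Function.update (Function.update T flagTape (flag false))
        t (zip (2 :: L) [])) (t := t) (by simp) (zip_left L [] 2)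
      have h6 := h5.seq (Runs.act' (t := t) (x := (some 0, none)) (S := zip L [2]) (by simp)
        (zip_write L [] 2 0))
      have h7 : Runs P (borrow t) T _ _ := Runs.loop_step (t := flagTape) (a := 0)
          (by rw [h2]; simp [head_flag])
        (Runs.ite_neg (t := t) (a := 1) (.act t (some 2, some .right)) (by simp [h1, zip_head_cons])
        (h3.seq (h4.seq (Runs.ite_pos (t := t) (a := 0) _ (by simp [digits_zero, zip_head_nil])
            h6))))
        (Runs.loop_end _ (by simp [head_flag, ht.symm]))
      refine ⟨_, [], [], h7.mono (by omega), by simp [zip_zero_right], by simp [ht.symm], ?_, rfl,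
        by simp, by simp⟩
      intro x hx
      simp at hx
      simp [hx]
    · have h5 := Runs.act' (P := P) (T := Function.update (Function.update T flagTape (flag false))
        t (zip (2 :: L) (digits a))) (t := t) (by simp) (zip_left L (digits a) 2)
      have h6 := h5.seq (Runs.act' (t := t) (x := (some 1, none)) (S := zip L (2 :: digits a))
          (by simp)
        (zip_write L (digits a) 2 1))
      have h7 : Runs P (borrow t) T _ _ := Runs.loop_step (t := flagTape) (a := 0)
          (by rw [h2]; simp [head_flag])
        (Runs.ite_neg (t := t) (a := 1) (.act t (some 2, some .right)) (by simp [h1, zip_head_cons])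
        (h3.seq (h4.seq (Runs.ite_neg (t := t) (a := 0) _ (by
          simp only [Function.update_self]
          intro h
          obtain ⟨b, l, hb⟩ := List.exists_cons_of_length_pos (l := digits a)
            (by rw [length_digits]; exact Nat.size_pos.2 ha)
          rw [hb] at h
          exact digits_ne_zero a b (by simp [hb]) h) h6))))
        (Runs.loop_end _ (by simp [head_flag, ht.symm]))
      refine ⟨_, [], 1 :: digits a, h7.mono (by omega), by simp, by simp [ht.symm], ?_,
        (digits_even ha.ne').symm, by simp, by simp⟩
      intro x hx
      simp at hx
      simp [hx]

theorem runs_dec {t : ℕ} (ht : t ≠ flagTape) {a : ℕ} (ha : a ≠ 0) {T : Tapes}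
    (h1 : T t = num a) (h2 : T flagTape = num 0) :
    Runs P (dec t) T (14 * a.size + 5) (Function.update T t (num (a - 1))) := by
  have h3 := Runs.act' (P := P) (t := flagTape) (S := flag false) h2 (flag_set false)
  obtain ⟨T', u, R, h4, h5, h6, h7, h8, h9, h10⟩ := runs_borrow (P := P) ht a ha
    (T := Function.update T flagTape (flag true)) (L := []) (by simp [ht, h1, num]) (by simp)
  have h11 := runs_rewind (P := P) (T := T') (t := t) (L := u.reverse) (R := R)
    (by simpa using h9) (by simpa using h5)
  refine (h3.seq (h4.seq h11)).to (by simp; omega) ?_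
  funext x
  by_cases hx : x = t
  · subst hx; simp [h8, num]
  · by_cases hx2 : x = flagTape
    · subst hx2; simp [hx, h6, h2]; rfl
    · simp [hx, h7 x (by simp [hx, hx2]), hx2]

/-- Do nothing. -/
def skip : Cmd := .act 0 (none, none)

theorem runs_skip (T : Tapes) : Runs P skip T 1 T :=
  (Runs.act 0 (none, none) T).to le_rfl (by simp [Action.run_none])

/-- Halve the number on a tape. -/
def pop (t : ℕ) : Cmd := .act t (some 0, some .right)

/-- The scanned digit is the lowest one; once erased, it is indistinguishable from the blanks to the
left of the word. -/
theorem run_pop (x : ℕ) : Action.run (some 0, some .right) (num x) = num (x / 2) := by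
  cases x using binary_induction with
  | h0 => rw [num_zero, zip_write_right_nil, zip_zero_left]
  | h1 x hx _ =>
    rw [num, digits_even hx, zip_write_right, zip_zero_left, num]
    congr 2; omega
  | h2 x _ =>
    rw [num, digits_odd, zip_write_right, zip_zero_left, num]
    congr 2; omega

theorem runs_pop {t x : ℕ} {T : Tapes} (h : T t = num x) :
    Runs P (pop t) T 1 (Function.update T t (num (x / 2))) := Runs.act' h (run_pop x)

/-- Erase the number on a tape. -/
def zero (t : ℕ) : Cmd := .loop t 0 (pop t)

theorem runs_zero {t x : ℕ} {T : Tapes} (h : T t = num x) :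
    Runs P (zero t) T (3 * x.size + 1) (Function.update T t (num 0)) := by
  induction x using binary_induction generalizing T with
  | h0 => exact (Runs.loop_end _ (by rw [h]; rfl)).to (by simp) (by simp [← h])
  | h1 x hx ih =>
    have h2 := ih (T := Function.update T t (num (2 * x / 2)))
      (by rw [Function.update_self, Nat.mul_div_cancel_left _ two_pos])
    have h3 := Runs.loop_step (t := t) (a := 0)
      (by rw [h, Ne, head_num_eq_zero]; omega) (runs_pop h) h2
    exact h3.to (by rw [size_even hx]; omega) (by simp)
  | h2 x ih =>
    have h2 := ih (T := Function.update T t (num ((2 * x + 1) / 2)))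
      (by rw [Function.update_self]; congr 1; omega)
    have h3 := Runs.loop_step (t := t) (a := 0)
      (by rw [h, Ne, head_num_eq_zero]; omega) (runs_pop h) h2
    exact h3.to (by rw [size_odd]; omega) (by simp)

/-- Double the number on a tape. -/
def dbl (t : ℕ) : Cmd :=
  .ite t 0 skip (.seq (.act t (none, some .left)) (.act t (some 1, none)))

theorem runs_dbl {t x : ℕ} {T : Tapes} (h : T t = num x) :
    Runs P (dbl t) T 4 (Function.update T t (num (2 * x))) := by
  -- Zero is treated apart: a digit in front of the empty word would be a leading zero.
  rcases Nat.eq_zero_or_pos x with rfl | hx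
  · exact (Runs.ite_pos _ (by rw [h]; rfl) (runs_skip T)).to (by simp) (by simp [← h])
  · refine (Runs.ite_neg _ (by rw [h, Ne, head_num_eq_zero]; omega) (Runs.seq
      (Runs.act' h (zip_left_nil _)) (Runs.act' (t := t) (x := (some 1, none))
      (S := zip [] (0 :: digits x)) (by simp) (zip_write _ _ _ _)))).to (by simp) ?_
    simp [num, digits_even hx.ne']

theorem digits_cons {s x : ℕ} (hs : s < 2) (h : x ≠ 0 ∨ s = 1) :
    digits (2 * x + s) = (s + 1) :: digits x := by
  interval_cases s
  · exact digits_even (by simpa using h)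
  · exact digits_odd x

/-- Add the scanned digit of tape `y` and the carry to the scanned digit of tape `x`. -/
def addDigit (x y : ℕ) : Cmd :=
  .ite y 2
    (.ite flagTape 2
      (.ite x 0 (.act x (some 1, some .right)) (.act x (none, some .right)))
      (.ite x 2 (.seq (.act x (some 1, some .right)) (.act flagTape (some 2, none)))
        (.act x (some 2, some .right))))
    (.ite flagTape 2
      (.ite x 2 (.act x (some 1, some .right))
        (.seq (.act x (some 2, some .right)) (.act flagTape (some 0, none))))
      (.ite x 0 (.act x (some 1, some .right)) (.act x (none, some .right))))

theorem run_write_digit (L : List ℕ) (a b : ℕ) :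
    Action.run (some b, some .right) (zip L (digits a)) = zip (b :: L) (digits (a / 2)) := by
  cases a using binary_induction with
  | h0 => rfl
  | h1 x hx _ =>
    rw [digits_even hx, zip_write_right, Nat.mul_div_cancel_left _ two_pos]
  | h2 x _ =>
    rw [digits_odd, zip_write_right, show (2 * x + 1) / 2 = x by omega]

theorem run_keep_digit (L : List ℕ) {a : ℕ} (ha : a ≠ 0) :
    Action.run (none, some .right) (zip L (digits a)) =
      zip ((a % 2 + 1) :: L) (digits (a / 2)) := by
  cases a using binary_induction with
  | h0 => exact absurd rfl ha
  | h1 x hx _ =>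
    rw [digits_even hx, zip_right, Nat.mul_div_cancel_left _ two_pos, Nat.mul_mod_right]
  | h2 x _ =>
    rw [digits_odd, zip_right, show (2 * x + 1) / 2 = x by omega,
      show (2 * x + 1) % 2 = 1 by omega]

theorem head_zip_digits_zero {L : List ℕ} {a : ℕ} : (zip L (digits a)).head = 0 ↔ a = 0 :=
  head_num_eq_zero (x := a)

theorem head_zip_digits_two {L : List ℕ} {a : ℕ} : (zip L (digits a)).head = 2 ↔ a % 2 = 1 :=
  head_num_eq_two (x := a)

/-- A blank on tape `x` counts as the digit zero, but a resulting zero must be written explicitly,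
for a blank would cut the word. This explains the tests for a blank in the two cases where digit and
carry otherwise stay unchanged. -/
theorem runs_addDigit {x y : ℕ} (hx : x ≠ flagTape) {a e : ℕ}
    {c : Bool} {T : Tapes} {L : List ℕ} (he : e < 2) (h1 : T x = zip L (digits a))
    (h2 : (T y).head = e + 1) (h3 : T flagTape = flag c) :
    Runs P (addDigit x y) T 8 (Function.update (Function.update T x
      (zip (((a % 2 + e + c.toNat) % 2 + 1) :: L) (digits (a / 2)))) flagTape
        (flag (decide (2 ≤ a % 2 + e + c.toNat)))) := by
  have hf : ∀ b S, b = c → Function.update (Function.update T x S) flagTape (flag b) =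
      Function.update T x S := by
    rintro b S rfl
    rw [← h3, Function.update_eq_self_iff]
    simp [hx.symm]
  have hset (b : Bool) (s : ℕ) := Runs.act' (P := P) (t := flagTape)
    (T := Function.update T x (zip (s :: L) (digits (a / 2))))
    (S := flag c) (x := (some (if b then 2 else 0), none)) (by simp [hx.symm, h3])
    (S' := flag b) (by cases b <;> simp [flag_set, flag_clear])
  have hw (s : ℕ) := Runs.act' (P := P) h1 (run_write_digit L a s)
  have hk (ha : a ≠ 0) := Runs.act' (P := P) h1 (run_keep_digit L ha)
  have hx0 : (T x).head = 0 ↔ a = 0 := by rw [h1, head_zip_digits_zero]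
  have hx2 : (T x).head = 2 ↔ a % 2 = 1 := by rw [h1, head_zip_digits_two]
  have hm := Nat.mod_lt a two_pos
  interval_cases e
  · refine Runs.mono (Runs.ite_neg _ (by rw [h2]; decide) (k := 6) ?_) le_rfl
    cases c with
    | true =>
      refine Runs.mono (Runs.ite_pos _ (by rw [h3]; rfl) (k := 4) ?_) le_rfl
      by_cases ha : a % 2 = 1
      · exact (Runs.ite_pos _ (hx2.2 ha) (hw 1)).to (by simp) (by
          rw [hf _ _ (by simp [ha])]; simp [ha])
      · have ha' : a % 2 = 0 := by omega
        exact (Runs.ite_neg _ (hx2.not.2 ha) ((hw 2).seq (hset false 2))).to (by simp) (by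
          simp [ha'])
    | false =>
      refine Runs.mono (Runs.ite_neg _ (by rw [h3]; decide) (k := 4) ?_) le_rfl
      by_cases ha : a = 0
      · exact (Runs.ite_pos _ (hx0.2 ha) (hw 1)).to (by simp) (by
          rw [hf _ _ (by simp [ha])]; simp [ha])
      · exact (Runs.ite_neg _ (hx0.not.2 ha) (hk ha)).to (by simp) (by
          rw [hf _ _ (by simp; omega)]; simp)
  · refine Runs.mono (Runs.ite_pos _ (by rw [h2]) (k := 6) ?_) le_rfl
    cases c with
    | true =>
      refine Runs.mono (Runs.ite_pos _ (by rw [h3]; rfl) (k := 4) ?_) le_rfl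
      by_cases ha : a = 0
      · exact (Runs.ite_pos _ (hx0.2 ha) (hw 1)).to (by simp) (by
          rw [hf _ _ (by simp)]; simp [ha])
      · exact (Runs.ite_neg _ (hx0.not.2 ha) (hk ha)).to (by simp) (by
          rw [hf _ _ (by simp)]; simp [Nat.add_assoc])
    | false =>
      refine Runs.mono (Runs.ite_neg _ (by rw [h3]; decide) (k := 4) ?_) le_rfl
      by_cases ha : a % 2 = 1
      · exact (Runs.ite_pos _ (hx2.2 ha) ((hw 1).seq (hset true 1))).to (by simp) (by
          simp [ha])
      · have ha' : a % 2 = 0 := by omega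
        exact (Runs.ite_neg _ (hx2.not.2 ha) (hw 2)).to (by simp) (by
          rw [hf _ _ (by simp [ha'])]; simp [ha'])

/-- The loop stops when the digits of `b` are used up. The invariant is that the finished digits
`u`, followed by those of the remainder `a'` with the pending carry added, spell the sum;
`propagate` then discharges the carry. -/
theorem runs_addLoop {x y : ℕ} (hx : x ≠ flagTape) (hy : y ≠ flagTape) (hxy : x ≠ y) (b : ℕ)
    {a : ℕ} {c : Bool} {T : Tapes} {L L' : List ℕ} (h1 : T x = zip L (digits a))
    (h2 : T y = zip L' (digits b)) (h3 : T flagTape = flag c) :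
    ∃ T' u a' c', Runs P (.loop y 0 (.seq (addDigit x y) (.act y (none, some .right)))) T
        (11 * b.size + 1) T' ∧
      T' x = zip (u.reverse ++ L) (digits a') ∧ T' y = zip ((digits b).reverse ++ L') [] ∧
      T' flagTape = flag c' ∧ SameOff [x, y, flagTape] T T' ∧
      u ++ digits (a' + c'.toNat) = digits (a + b + c.toNat) ∧ (∀ z ∈ u, z ≠ 0) ∧
      u.length ≤ b.size ∧ a'.size ≤ a.size := by
  -- Both inductive cases of the binary induction at once: `e` is the lowest digit of the second
  -- summand and `b` the number formed by the others.
  have key : ∀ e < 2, ∀ b, (b ≠ 0 ∨ e = 1) → (∀ {a : ℕ} {c : Bool} {T : Tapes} {L L' : List ℕ},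
    T x = zip L (digits a) → T y = zip L' (digits b) → T flagTape = flag c →
    ∃ T' u a' c', Runs P (.loop y 0 (.seq (addDigit x y) (.act y (none, some .right)))) T
        (11 * b.size + 1) T' ∧
      T' x = zip (u.reverse ++ L) (digits a') ∧ T' y = zip ((digits b).reverse ++ L') [] ∧
      T' flagTape = flag c' ∧ SameOff [x, y, flagTape] T T' ∧
      u ++ digits (a' + c'.toNat) = digits (a + b + c.toNat) ∧ (∀ z ∈ u, z ≠ 0) ∧
      u.length ≤ b.size ∧ a'.size ≤ a.size) → ∀ {a : ℕ} {c : Bool} {T : Tapes} {L L' : List ℕ},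
    T x = zip L (digits a) → T y = zip L' (digits (2 * b + e)) → T flagTape = flag c →
    ∃ T' u a' c', Runs P (.loop y 0 (.seq (addDigit x y) (.act y (none, some .right)))) T
        (11 * (2 * b + e).size + 1) T' ∧
      T' x = zip (u.reverse ++ L) (digits a') ∧
      T' y = zip ((digits (2 * b + e)).reverse ++ L') [] ∧
      T' flagTape = flag c' ∧ SameOff [x, y, flagTape] T T' ∧
      u ++ digits (a' + c'.toNat) = digits (a + (2 * b + e) + c.toNat) ∧ (∀ z ∈ u, z ≠ 0) ∧
      u.length ≤ (2 * b + e).size ∧ a'.size ≤ a.size := by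
    intro e he b hb ih a c T L L' h1 h2 h3
    rw [digits_cons he hb] at h2 ⊢
    have hs : (2 * b + e).size = b.size + 1 := by
      rw [← length_digits, ← length_digits, digits_cons he hb]; rfl
    have h4 := runs_addDigit (P := P) (y := y) hx he h1 (by rw [h2]; rfl) h3
    set c₁ := decide (2 ≤ a % 2 + e + c.toNat) with hc₁
    set s := (a % 2 + e + c.toNat) % 2 with hsdef
    have h5 := h4.seq (Runs.act' (t := y) (by simpa [hy, hxy.symm] using h2) (zip_right _ _ _))
    obtain ⟨T', u, a', c', g1, g2, g3, g4, g5, g6, g7, g8, g9⟩ := ih (a := a / 2) (c := c₁)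
      (L := (s + 1) :: L) (L' := (e + 1) :: L')
      (T := Function.update (Function.update (Function.update T x
        (zip ((s + 1) :: L) (digits (a / 2)))) flagTape (flag c₁)) y
        (zip ((e + 1) :: L') (digits b))) (by simp [hxy, hx]) (by simp) (by simp [hy.symm])
    have hsum : a % 2 + e + c.toNat = 2 * c₁.toNat + s := by
      have := Bool.toNat_lt c
      by_cases h : 2 ≤ a % 2 + e + c.toNat
      · simp only [hc₁, h, decide_true, Bool.toNat_true, hsdef]; omega
      · simp only [hc₁, h, decide_false, Bool.toNat_false, hsdef]; omega
    refine ⟨T', (s + 1) :: u, a', c', ?_, by simp [g2], by simp [g3], g4, ?_, ?_, ?_, ?_, ?_⟩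
    · exact (Runs.loop_step (by rw [h2]; simp [zip_head_cons]) h5 g1).mono (by omega)
    · intro t ht
      rw [g5 t ht]
      simp at ht
      simp [ht]
    · rw [List.cons_append, g6, ← digits_cons (by omega)]
      · congr 1; omega
      -- The digit `s` must not be a leading zero. If nothing remains above it, then `b = 0`, hence
      -- `e = 1`, and with no outgoing carry `s = 1`.
      · rcases Nat.eq_zero_or_pos (a / 2 + b + c₁.toNat) with h0 | h0
        · right; omega
        · left; omega
    · simpa using g7
    · simp; omega
    · exact g9.trans (Nat.size_le_size (Nat.div_le_self _ _))
  induction b using binary_induction generalizing a c T L L' with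
  | h0 =>
    exact ⟨T, [], a, c, (Runs.loop_end _ (by rw [h2]; rfl)).mono (by omega), h1, h2, h3,
      fun _ _ => rfl, rfl, by simp, by simp, le_rfl⟩
  | h1 b hb ih => exact key 0 two_pos b (.inl hb) ih h1 h2 h3
  | h2 b ih => exact key 1 one_lt_two b (.inr rfl) ih h1 h2 h3

/-- Add the number on tape `y` to the one on tape `x`. -/
def add (x y : ℕ) : Cmd :=
  .seq (.loop y 0 (.seq (addDigit x y) (.act y (none, some .right))))
    (.seq (propagate x) (.seq (rewind x) (rewind y)))

theorem runs_add {x y : ℕ} (hx : x ≠ flagTape) (hy : y ≠ flagTape) (hxy : x ≠ y) {a b : ℕ}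
    {T : Tapes} (h1 : T x = num a) (h2 : T y = num b) (h3 : T flagTape = num 0) :
    Runs P (add x y) T (20 * (a.size + b.size + 1)) (Function.update T x (num (a + b))) := by
  obtain ⟨T₁, u, a', c', g1, g2, g3, g4, g5, g6, g7, g8, g9⟩ := runs_addLoop (P := P) hx hy hxy b
    (c := false) h1 h2 h3
  obtain ⟨T₂, v, R, k1, k2, k3, k4, k5, k6, k7⟩ := runs_propagate (P := P) hx a' g2 g4
  have l1 := runs_rewind (P := P) (T := T₂) (t := x) (L := v.reverse ++ u.reverse) (R := R)
    (by intro z hz; simp at hz; exact hz.elim (k6 z) (g7 z)) (by simpa using k2)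
  have l2 := runs_rewind (P := P) (t := y) (L := (digits b).reverse) (R := [])
    (T := Function.update T₂ x (zip [] ((v.reverse ++ u.reverse).reverse ++ R)))
    (by simpa using digits_ne_zero b) (by
      simp [hxy.symm, k4 y (by simp [hxy.symm, hy]), g3])
  refine (g1.seq (k1.seq (l1.seq l2))).to ?_ ?_
  · simp only [List.length_append, List.length_reverse, length_digits]; omega
  · funext t
    by_cases ht : t = x
    · subst ht; simp [hxy, num, k5, g6]
    · by_cases ht2 : t = y
      · subst ht2; simp [ht, h2, num]
      · by_cases ht3 : t = flagTape
        · subst ht3; simp [ht, ht2, k3, h3]; rfl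
        · simp [ht, ht2, k4 t (by simp [ht, ht3]), g5 t (by simp [ht, ht2, ht3])]

/-! ### Calling the machine that is a parameter of the program -/

/-- All nonblank cells of the tape are within distance less than `R` from the head. -/
def Near (R : ℕ) (T : Turing.Tape ℕ) : Prop := ∀ i : ℤ, (R : ℤ) ≤ |i| → T.nth i = 0

theorem Near.mono {R S : ℕ} {T : Turing.Tape ℕ} (h : Near R T) (hRS : R ≤ S) : Near S T :=
  fun i hi => h i (le_trans (by exact_mod_cast hRS) hi)

/-- A move shifts the contents by one cell. The condition `1 ≤ R` puts the scanned cell, which may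
be written on, inside the radius. -/
theorem Near.run {R : ℕ} {T : Turing.Tape ℕ} (hR : 1 ≤ R) (h : Near R T) (x : Action) :
    Near (R + 1) (x.run T) := by
  have hw : ∀ i : ℤ, (R : ℤ) ≤ |i| → (match x.1 with
      | none => T
      | some a => T.write a : Turing.Tape ℕ).nth i = 0 := by
    intro i hi
    have hi0 : i ≠ 0 := by rintro rfl; simp at hi; omega
    cases x.1 with
    | none => exact h i hi
    | some a => simpa [Turing.Tape.write_nth, hi0] using h i hi
  intro i hi
  push_cast at hi
  unfold Action.run
  match x.2 with
  | none => exact hw i (by omega)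
  | some .left =>
    simp only [Turing.Tape.move_left_nth]
    exact hw _ (by cases abs_cases i <;> cases abs_cases (i - 1) <;> omega)
  | some .right =>
    simp only [Turing.Tape.move_right_nth]
    exact hw _ (by cases abs_cases i <;> cases abs_cases (i + 1) <;> omega)

theorem tape_eq_blank {T : Turing.Tape ℕ} (h : ∀ i, T.nth i = 0) : T = zip [] [] := by
  obtain ⟨a, L, R⟩ := T
  have h1 : a = 0 := h 0
  have h2 : L = Turing.ListBlank.mk [] := by
    refine Turing.ListBlank.ext fun i => ?_
    have : L.nth i = 0 := h (Int.negSucc i)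
    rw [this, Turing.ListBlank.nth_mk]; rfl
  have h3 : R = Turing.ListBlank.mk [] := by
    refine Turing.ListBlank.ext fun i => ?_
    have : R.nth i = 0 := h (Int.ofNat (i + 1))
    rw [this, Turing.ListBlank.nth_mk]; rfl
  subst h1 h2 h3
  rfl

theorem near_blank (R : ℕ) : Near R (zip [] []) := by
  intro i _
  match i with
  | Int.ofNat 0 => rfl
  | Int.ofNat (n + 1) =>
    change (Turing.ListBlank.mk ([] : List ℕ)).nth n = 0
    rw [Turing.ListBlank.nth_mk]; rfl
  | Int.negSucc n =>
    change (Turing.ListBlank.mk ([] : List ℕ)).nth n = 0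
    rw [Turing.ListBlank.nth_mk]; rfl

theorem zip_nth (L w : List ℕ) (i : ℕ) : (zip L w).nth i = w.getI i := by
  rw [zip, Turing.Tape.mk'_nth_nat, Turing.ListBlank.nth_mk]

theorem near_word (w : List ℕ) : Near (w.length + 1) (zip [] w) := by
  intro i hi
  match i with
  | Int.ofNat n =>
    have : (zip [] w).nth (Int.ofNat n) = w.getI n := zip_nth [] w n
    rw [this, List.getI_eq_default]
    · rfl
    · simp at hi; omega
  | Int.negSucc n =>
    change (Turing.ListBlank.mk ([] : List ℕ)).nth n = 0
    rw [Turing.ListBlank.nth_mk]; rfl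

/-- Together with `Steps.near`, this bounds the length of an output by the input length and the
running time. -/
theorem Near.length_le {R : ℕ} {L w : List ℕ} (h : Near R (zip L w)) (hw : ∀ a ∈ w, a ≠ 0) :
    w.length ≤ R := by
  by_contra! hlt
  have h1 := h R (by simp)
  rw [zip_nth, List.getI_eq_getElem _ hlt] at h1
  exact hw _ (List.getElem_mem hlt) h1

theorem Steps.near {M : Machine} {R k : ℕ} {c c' : Cfg} (hR : 1 ≤ R) (h : Steps M c k c')
    (hc : ∀ t, Near R (c.tape t)) : ∀ t, Near (R + k) (c'.tape t) := by
  induction k generalizing c' with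
  | zero =>
    obtain rfl : c = c' := by simpa [Steps] using h
    exact hc
  | succ k ih =>
    obtain ⟨c₁, h1, h2⟩ := Steps.succ_iff.1 h
    simp only [Machine.step, Option.map_eq_some_iff] at h2
    obtain ⟨r, _, rfl⟩ := h2
    intro t
    exact (ih h1 t).run (by omega) _

theorem Steps.tape_eq {M : Machine} {k : ℕ} {c c' : Cfg} (h : Steps M c k c') {t : ℕ}
    (ht : tapeBound M ≤ t) : c'.tape t = c.tape t := by
  induction k generalizing c' with
  | zero =>
    obtain rfl : c = c' := by simpa [Steps] using h
    rfl
  | succ k ih =>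
    obtain ⟨c₁, h1, h2⟩ := Steps.succ_iff.1 h
    simp only [Machine.step, Option.map_eq_some_iff] at h2
    obtain ⟨r, hr, rfl⟩ := h2
    have := length_le_tapeBound (List.mem_of_find?_eq_some hr)
    simp only [Rule.run]
    rw [List.getD_eq_default _ _ (by omega), Action.run_none, ih h1]

theorem wipe_left_nth (T : Turing.Tape ℕ) (i : ℤ) :
    (Action.run (some 0, some .left) T).nth i = if i = 1 then 0 else T.nth (i - 1) := by
  simp only [Action.run, Turing.Tape.move_left_nth, Turing.Tape.write_nth]
  congr 1
  simp [sub_eq_zero]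

theorem wipe_right_nth (T : Turing.Tape ℕ) (i : ℤ) :
    (Action.run (some 0, some .right) T).nth i = if i = -1 then 0 else T.nth (i + 1) := by
  simp only [Action.run, Turing.Tape.move_right_nth, Turing.Tape.write_nth]
  congr 1
  simp [add_eq_zero_iff_eq_neg]

/-- The `R` wipes to the left bring the head to the left border of the nonblank zone, and `2 R`
wipes to the right then sweep all of it. The positions of possible nonblank cells are tracked
relative to the moving head. -/
theorem Near.wiped {R : ℕ} {T : Turing.Tape ℕ} (h : Near R T) :
    (Action.run (some 0, some .right))^[R + R] ((Action.run (some 0, some .left))^[R] T) =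
      zip [] [] := by
  have h1 : ∀ k : ℕ, ∀ i : ℤ, (i ≤ k - R ∨ k + R ≤ i) →
      ((Action.run (some 0, some .left))^[k] T).nth i = 0 := by
    intro k
    induction k with
    | zero =>
      intro i hi
      exact h i (by cases abs_cases i <;> push_cast at hi <;> omega)
    | succ k ih =>
      intro i hi
      rw [Function.iterate_succ_apply', wipe_left_nth]
      split
      · rfl
      · exact ih _ (by push_cast at hi; omega)
  have h2 : ∀ k : ℕ, ∀ i : ℤ, (i < 0 ∨ 2 * R - k ≤ i) →
      ((Action.run (some 0, some .right))^[k] ((Action.run (some 0, some .left))^[R] T)).nth i =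
        0 := by
    intro k
    induction k with
    | zero =>
      intro i hi
      exact h1 R i (by push_cast at hi; omega)
    | succ k ih =>
      intro i hi
      rw [Function.iterate_succ_apply', wipe_right_nth]
      split
      · rfl
      · exact ih _ (by push_cast at hi; omega)
  exact tape_eq_blank fun i => h2 (R + R) i (by push_cast; omega)

/-- The tapes after `k` times `wipe`. -/
def Tapes.wipedN (m : ℕ) (x : Turing.Dir) (k : ℕ) (T : Tapes) : Tapes := fun t =>
  if numTapes ≤ t ∧ t < numTapes + m then (Action.run (some 0, some x))^[k] (T t) else T t

theorem wiped_clock (m : ℕ) (x : Turing.Dir) (T : Tapes) :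
    T.wiped m x clockTape = T clockTape := by
  simp [Tapes.wiped, numTapes, clockTape]

theorem wipedN_step (m : ℕ) (x : Turing.Dir) (k : ℕ) (T : Tapes) (S S' : Turing.Tape ℕ) :
    Function.update (Tapes.wipedN m x k (Function.update (T.wiped m x) clockTape S)) clockTape S' =
      Function.update (T.wipedN m x (k + 1)) clockTape S' := by
  funext t
  by_cases ht : t = clockTape
  · subst ht; simp
  · simp only [Function.update_of_ne ht, Tapes.wipedN, Tapes.wiped]
    split <;> simp

theorem wipedN_zero (m : ℕ) (x : Turing.Dir) (T : Tapes) : T.wipedN m x 0 = T := by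
  funext t; simp [Tapes.wipedN]

theorem Runs.wipe (x : Turing.Dir) (T : Tapes) :
    Runs P (.wipe x) T 1 (T.wiped (tapeBound P.1) x) := ⟨1, le_rfl, .wipe x T⟩

theorem runs_wipeLeft (a : ℕ) {T : Tapes} {R : List ℕ}
    (h : T clockTape = zip (List.replicate a 2) (2 :: R)) :
    Runs P (.loop clockTape 0 (.seq (.wipe .left) (.act clockTape (none, some .left)))) T
      (4 * (a + 1) + 1) (Function.update (T.wipedN (tapeBound P.1) .left (a + 1)) clockTape
        (zip [] (0 :: (List.replicate (a + 1) 2 ++ R)))) := by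
  induction a generalizing T R with
  | zero =>
    have h1 := (Runs.wipe (P := P) .left T).seq (Runs.act' (by rw [wiped_clock, h]; rfl)
      (zip_left_nil (2 :: R)))
    have h2 := Runs.loop_step (t := clockTape) (a := 0) (by rw [h]; simp [zip_head_cons]) h1
      (Runs.loop_end _ (by simp [zip_head_cons]))
    refine h2.to (by simp) ?_
    rw [← wipedN_zero (tapeBound P.1) .left (Function.update (T.wiped _ _) _ _)]
    have := wipedN_step (tapeBound P.1) .left 0 T (zip [] (0 :: 2 :: R)) (zip [] (0 :: 2 :: R))
    simpa [wipedN_zero] using this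
  | succ a ih =>
    rw [List.replicate_succ] at h
    have h1 := (Runs.wipe (P := P) .left T).seq (Runs.act' (by rw [wiped_clock, h])
      (zip_left _ _ _))
    have h2 := Runs.loop_step (t := clockTape) (a := 0) (by rw [h]; simp [zip_head_cons]) h1
      (ih (R := 2 :: R) (by simp))
    refine h2.to (by omega) ?_
    rw [wipedN_step]
    congr 3
    simp [List.replicate_succ', List.append_assoc]

theorem runs_wipeRight (a : ℕ) {T : Tapes} {L : List ℕ}
    (h : T clockTape = zip L (List.replicate a 2)) :
    Runs P (.loop clockTape 0 (.seq (.wipe .right) (.act clockTape (none, some .right)))) T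
      (4 * a + 1) (Function.update (T.wipedN (tapeBound P.1) .right a) clockTape
        (zip (List.replicate a 2 ++ L) [])) := by
  induction a generalizing T L with
  | zero =>
    refine (Runs.loop_end _ (by rw [h]; rfl)).to (by simp) ?_
    rw [wipedN_zero, eq_comm, Function.update_eq_self_iff, h]; rfl
  | succ a ih =>
    rw [List.replicate_succ] at h
    have h1 := (Runs.wipe (P := P) .right T).seq (Runs.act' (by rw [wiped_clock, h])
      (zip_right _ _ _))
    have h2 := Runs.loop_step (t := clockTape) (a := 0) (by rw [h]; simp [zip_head_cons]) h1
      (ih (L := 2 :: L) (by simp))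
    refine h2.to (by omega) ?_
    rw [wipedN_step]
    congr 2
    simp [List.replicate_succ', List.append_assoc]

theorem runs_wipeErase (a : ℕ) {T : Tapes}
    (h : T clockTape = zip (List.replicate a 2) [2]) :
    Runs P (.loop clockTape 0 (.seq (.wipe .right) (.act clockTape (some 0, some .left)))) T
      (4 * (a + 1) + 1) (Function.update (T.wipedN (tapeBound P.1) .right (a + 1)) clockTape
        (zip [] [])) := by
  induction a generalizing T with
  | zero =>
    have h1 := (Runs.wipe (P := P) .right T).seq (Runs.act' (by rw [wiped_clock, h]; rfl)
      (zip_erase_left_nil 2))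
    have h2 := Runs.loop_step (t := clockTape) (a := 0) (by rw [h]; decide) h1
      (Runs.loop_end _ (by simp [zip_head_nil]))
    refine h2.to (by simp) ?_
    have := wipedN_step (tapeBound P.1) .right 0 T (zip [] []) (zip [] [])
    simpa [wipedN_zero] using this
  | succ a ih =>
    rw [List.replicate_succ] at h
    have h1 := (Runs.wipe (P := P) .right T).seq (Runs.act' (by rw [wiped_clock, h])
      (zip_erase_left _ _ _))
    have h2 := Runs.loop_step (t := clockTape) (a := 0) (by rw [h]; simp [zip_head_cons]) h1
      (ih (by simp))
    refine h2.to (by omega) ?_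
    rw [wipedN_step]

/-- Erase the tapes of the simulated machine, as far as the clock tells, and the clock. -/
def cleanUp : Cmd :=
  .seq (.act clockTape (none, some .left))
  (.seq (.loop clockTape 0 (.seq (.wipe .left) (.act clockTape (none, some .left))))
  (.seq (.act clockTape (none, some .right))
  (.seq (.loop clockTape 0 (.seq (.wipe .right) (.act clockTape (none, some .right))))
  (.seq (.act clockTape (none, some .left))
  (.loop clockTape 0 (.seq (.wipe .right) (.act clockTape (some 0, some .left))))))))

/-- The `R` marks on the clock are traversed three times, once with wipes to the left and twice with
wipes to the right, which is the pattern of `Near.wiped`; the last pass also erases the marks. -/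
theorem runs_cleanUp {R : ℕ} (hR : 1 ≤ R) {T : Tapes}
    (h : T clockTape = zip (List.replicate R 2) []) (hT : ∀ t, numTapes ≤ t → Near R (T t))
    (hb : ∀ t, numTapes + tapeBound P.1 ≤ t → T t = num 0) :
    Runs P cleanUp T (12 * R + 6)
      (fun t => if numTapes ≤ t ∨ t = clockTape then num 0 else T t) := by
  obtain ⟨a, rfl⟩ : ∃ a, R = a + 1 := ⟨R - 1, by omega⟩
  have h0 := h
  rw [List.replicate_succ] at h
  have h1 := Runs.act' (P := P) h (zip_left _ _ _)
  have h2 := runs_wipeLeft (P := P) a (T := Function.update T clockTape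
    (zip (List.replicate a 2) [2])) (R := []) (by simp)
  have h3 := Runs.act' (P := P) (T := Function.update (Tapes.wipedN (tapeBound P.1) .left (a + 1)
      (Function.update T clockTape (zip (List.replicate a 2) [2]))) clockTape
      (zip [] (0 :: (List.replicate (a + 1) 2 ++ [])))) (t := clockTape) (by simp)
      (zip_right [] (List.replicate (a + 1) 2 ++ []) 0)
  rw [zip_zero_left, List.append_nil, Function.update_idem] at h3
  rw [List.append_nil] at h2
  have h4 := runs_wipeRight (P := P) (a + 1) (T := Function.update
      (Tapes.wipedN (tapeBound P.1) .left (a + 1)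
      (Function.update T clockTape (zip (List.replicate a 2) [2]))) clockTape
      (zip [] (List.replicate (a + 1) 2))) (L := []) (by simp)
  rw [List.append_nil] at h4
  have h5 := Runs.act' (P := P) (t := clockTape) (Function.update_self clockTape
    (zip (List.replicate (a + 1) 2) []) (Tapes.wipedN (tapeBound P.1) .right (a + 1)
    (Function.update (Tapes.wipedN (tapeBound P.1) .left (a + 1)
      (Function.update T clockTape (zip (List.replicate a 2) [2]))) clockTape
      (zip [] (List.replicate (a + 1) 2))))) (zip_left (List.replicate a 2) [] 2)
  have h6 := runs_wipeErase (P := P) a (T := _) (Function.update_self clockTape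
    (zip (List.replicate a 2) [2]) (Function.update (Tapes.wipedN (tapeBound P.1) .right (a + 1)
    (Function.update (Tapes.wipedN (tapeBound P.1) .left (a + 1)
      (Function.update T clockTape (zip (List.replicate a 2) [2]))) clockTape
      (zip [] (List.replicate (a + 1) 2)))) clockTape (zip (List.replicate (a + 1) 2) [])))
  refine (h1.seq (h2.seq (h3.seq (h4.seq (h5.seq h6))))).to (by omega) ?_
  funext t
  by_cases ht : t = clockTape
  · subst ht; simp [num_zero]
  · by_cases ht2 : numTapes ≤ t
    · by_cases ht3 : t < numTapes + tapeBound P.1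
      · have := (hT t ht2).wiped
        rw [Function.iterate_add_apply] at this
        simp only [Function.update_of_ne ht, Tapes.wipedN, ht2, ht3, and_self, if_true, true_or,
          this, num_zero]
      · simp [Function.update_of_ne ht, Tapes.wipedN, ht2, ht3, hb t (by omega)]
    · simp [Tapes.wipedN, ht2, ht]

theorem iterate_tick (k : ℕ) (L : List ℕ) :
    (Action.run tick)^[k] (zip L []) = zip (List.replicate k 2 ++ L) [] := by
  induction k with
  | zero => rfl
  | succ k ih =>
    rw [Function.iterate_succ_apply', ih, tick, zip_write_right_nil]; rfl

/-- Advance the clock by one more than the length of the input word of the machine. -/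
def walk : Cmd :=
  .seq (.act clockTape tick)
  (.seq (.loop numTapes 0 (.seq (.act numTapes (none, some .right)) (.act clockTape tick)))
  (rewind numTapes))

theorem runs_walkLoop (w : List ℕ) (hw : ∀ a ∈ w, a ≠ 0) {T : Tapes} {L C : List ℕ}
    (h : T numTapes = zip L w) (hc : T clockTape = zip C []) :
    Runs P (.loop numTapes 0 (.seq (.act numTapes (none, some .right)) (.act clockTape tick))) T
      (4 * w.length + 1) (Function.update (Function.update T numTapes (zip (w.reverse ++ L) []))
        clockTape (zip (List.replicate w.length 2 ++ C) [])) := by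
  have hne : clockTape ≠ numTapes := by decide
  induction w generalizing T L C with
  | nil =>
    refine (Runs.loop_end _ (by rw [h]; rfl)).to (by simp) ?_
    funext t
    by_cases ht : t = clockTape
    · subst ht; simp [hc]
    · by_cases ht2 : t = numTapes
      · subst ht2; simp [ht, h]
      · simp [ht, ht2]
  | cons a w ih =>
    have h1 := (Runs.act' (P := P) h (zip_right _ _ _)).seq
      (Runs.act' (t := clockTape) (x := tick) (by simpa [hne] using hc) (zip_write_right_nil _ _))
    have h2 := Runs.loop_step (t := numTapes) (a := 0)
      (by rw [h]; exact hw a (by simp)) h1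
      (ih (fun b hb => hw b (by simp [hb])) (L := a :: L) (C := 2 :: C) (by simp [hne.symm])
        (by simp))
    refine h2.to (by simp; omega) ?_
    funext t
    by_cases ht : t = clockTape
    · subst ht; simp [List.replicate_succ', List.append_assoc]
    · by_cases ht2 : t = numTapes
      · subst ht2; simp [ht]
      · simp [ht, ht2]

theorem runs_walk {x : ℕ} {T : Tapes} (h : T numTapes = num x) (hc : T clockTape = num 0) :
    Runs P walk T (7 * x.size + 6)
      (Function.update T clockTape (zip (List.replicate (x.size + 1) 2) [])) := by
  have hne : clockTape ≠ numTapes := by decide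
  have h1 := Runs.act' (P := P) (x := tick) hc (zip_write_right_nil [] 2)
  have h2 := runs_walkLoop (P := P) (digits x) (digits_ne_zero x)
    (T := Function.update T clockTape (zip [2] [])) (L := []) (C := [2])
    (by simpa [hne.symm, num] using h) (by simp)
  have h3 := runs_rewind (P := P) (t := numTapes) (L := (digits x).reverse) (R := [])
    (by simpa using digits_ne_zero x) (T := Function.update (Function.update (Function.update T
      clockTape (zip [2] [])) numTapes (zip ((digits x).reverse ++ []) []))
        clockTape (zip (List.replicate (digits x).length 2 ++ [2]) [])) (by simp [hne.symm])
  refine (h1.seq (h2.seq h3)).to (by simp [length_digits]; omega) ?_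
  funext t
  by_cases ht : t = numTapes
  · subst ht; simp [hne.symm, h, num]
  · by_cases ht2 : t = clockTape
    · subst ht2; simp [ht, length_digits, List.replicate_succ']
    · simp [ht, ht2]

/-- Copy the output word of the machine to tape `g`, and advance the clock by its length. -/
def readOut (g : ℕ) : Cmd :=
  .seq (.loop (numTapes + 1) 0 (.seq
    (.ite (numTapes + 1) 2 (.act g (some 2, some .right)) (.act g (some 1, some .right)))
    (.seq (.act (numTapes + 1) (none, some .right)) (.act clockTape tick)))) (rewind g)

theorem runs_readLoop {g : ℕ} (hg : g < clockTape) (w : List ℕ) (hw : ∀ a ∈ w, a = 1 ∨ a = 2)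
    {T : Tapes} {L C G : List ℕ} {R : ℕ} (hR : 1 ≤ R)
    (h : T (numTapes + 1) = zip L w) (hc : T clockTape = zip C []) (hG : T g = zip G [])
    (hN : Near R (T (numTapes + 1))) :
    Runs P (.loop (numTapes + 1) 0 (.seq
    (.ite (numTapes + 1) 2 (.act g (some 2, some .right)) (.act g (some 1, some .right)))
    (.seq (.act (numTapes + 1) (none, some .right)) (.act clockTape tick)))) T
      (7 * w.length + 1) (Function.update (Function.update (Function.update T g
        (zip (w.reverse ++ G) [])) (numTapes + 1) (zip (w.reverse ++ L) []))
        clockTape (zip (List.replicate w.length 2 ++ C) [])) ∧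
      Near (R + w.length) (zip (w.reverse ++ L) []) := by
  have hne : clockTape ≠ numTapes + 1 := by decide
  have hg1 : g ≠ clockTape := hg.ne
  have hg2 : g ≠ numTapes + 1 := by simp only [clockTape, numTapes] at *; omega
  induction w generalizing T L C G R with
  | nil =>
    refine ⟨(Runs.loop_end _ (by rw [h]; rfl)).to (by simp) ?_, by simpa [h] using hN⟩
    funext t
    by_cases ht : t = clockTape
    · subst ht; simp [hc]
    · by_cases ht2 : t = numTapes + 1
      · subst ht2; simp [ht, h]
      · by_cases ht3 : t = g
        · subst ht3; simp [ht, ht2, hG]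
        · simp [ht, ht2, ht3]
  | cons a w ih =>
    have h0 : Runs P (.ite (numTapes + 1) 2 (.act g (some 2, some .right))
        (.act g (some 1, some .right))) T 3 (Function.update T g (zip (a :: G) [])) := by
      rcases hw a (by simp) with rfl | rfl
      · exact Runs.ite_neg _ (by rw [h, zip_head_cons]; decide)
          (Runs.act' hG (zip_write_right_nil _ _))
      · exact Runs.ite_pos _ (by rw [h, zip_head_cons])
          (Runs.act' hG (zip_write_right_nil _ _))
    have h1 := h0.seq ((Runs.act' (t := numTapes + 1) (by simpa [hg2.symm] using h)
      (zip_right L w a)).seq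
      (Runs.act' (t := clockTape) (x := tick) (by simpa [hne, hg1.symm] using hc)
        (zip_write_right_nil C 2)))
    have h3 := hN.run hR (none, some .right)
    rw [h, zip_right] at h3
    obtain ⟨h4, h5⟩ := ih (fun b hb => hw b (by simp [hb])) (L := a :: L) (C := 2 :: C)
      (G := a :: G) (R := R + 1) (by omega) (T := Function.update (Function.update
        (Function.update T g (zip (a :: G) [])) (numTapes + 1) (zip (a :: L) w)) clockTape
          (zip (2 :: C) [])) (by simp [hne.symm])
        (by simp) (by simp [hg1, hg2]) (by simpa [hne.symm] using h3)
    have h2 := Runs.loop_step (t := numTapes + 1) (a := 0)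
      (by rw [h, zip_head_cons]; rcases hw a (by simp) with rfl | rfl <;> decide) h1 h4
    refine ⟨h2.to (by simp; omega) ?_, ?_⟩
    · funext t
      by_cases ht : t = clockTape
      · subst ht; simp [List.replicate_succ', List.append_assoc]
      · by_cases ht2 : t = numTapes + 1
        · subst ht2; simp [ht]
        · by_cases ht3 : t = g
          · subst ht3; simp [ht, ht2]
          · simp [ht, ht2, ht3]
    · simpa [Nat.add_assoc, Nat.add_comm 1] using h5

/-- Run the machine on the number on its input tape and write its output to tape `g`. -/
def call (g : ℕ) : Cmd := .seq walk (.seq .sim (.seq (readOut g) cleanUp))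

/-- The clock receives `x.size + 1` marks for the input, one for each simulated step and one for
each output digit read. Each stage enlarges the nonblank zone around the heads by no more than that,
so `cleanUp` erases everything and the machine can be called again. -/
theorem runs_call {g : ℕ} (hg : g < clockTape) {T : Tapes} {x v k : ℕ}
    (h1 : T numTapes = num x) (h2 : ∀ t, numTapes < t → T t = num 0)
    (h3 : T clockTape = num 0) (h4 : T g = num 0)
    (h5 : Machine.ComputesWithin P.1 (Computability.encodeNat x) (Computability.encodeNat v) k) :
    Runs P (call g) T (60 * (x.size + k + 1))
      (Function.update (Function.update T numTapes (num 0)) g (num v)) ∧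
      v.size ≤ x.size + k + 1 := by
  obtain ⟨l, hl, c, h6, h7, h8⟩ := h5
  have hl : l ≤ k := by exact_mod_cast hl
  have hne : ∀ t, clockTape ≠ numTapes + t := by intro t; simp only [clockTape, numTapes]; omega
  have hg2 : ∀ t, g ≠ numTapes + t := by
    intro t; simp only [clockTape, numTapes] at *; omega
  have a1 := runs_walk (P := P) h1 h3
  set T₁ : Tapes := Function.update T clockTape (zip (List.replicate (x.size + 1) 2) []) with hT₁
  have hin : T₁.inner = (Machine.init (Computability.encodeNat x)).tape := by
    funext t
    simp only [Tapes.inner, hT₁, Function.update_of_ne (hne t).symm, Machine.init]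
    by_cases ht : t = 0
    · subst ht; simp [h1]; rfl
    · rw [if_neg ht, h2 _ (by omega)]; rfl
  have a2 : Steps P.1 ⟨0, T₁.inner⟩ l c := by rw [hin]; exact h6
  have a3 : Runs P .sim T₁ (l + 1) (T₁.simulated c.tape l) := ⟨_, le_rfl, .sim a2 h7⟩
  set T₂ : Tapes := T₁.simulated c.tape l with hT₂
  have hclk : T₂ clockTape = zip (List.replicate (l + (x.size + 1)) 2) [] := by
    have : T₂ clockTape = (Action.run tick)^[l] (T₁ clockTape) := by
      simp [hT₂, Tapes.simulated, numTapes, clockTape]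
    rw [this, hT₁, Function.update_self, iterate_tick, List.replicate_append_replicate]
  have hT₂in : ∀ t, T₂ (numTapes + t) = c.tape t := by
    intro t; simp [hT₂, Tapes.simulated]
  have hout : ∀ t, t < clockTape → T₂ t = T t := by
    intro t ht
    have ht1 : ¬ numTapes ≤ t := by simp only [clockTape, numTapes] at *; omega
    simp [hT₂, Tapes.simulated, ht1, ht.ne, hT₁]
  have hnear : ∀ t, Near (x.size + 1 + l) (c.tape t) := by
    refine a2.near (by omega) fun t => ?_
    simp only [hin, Machine.init]
    by_cases ht : t = 0
    · rw [if_pos ht, ← length_digits]; exact near_word _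
    · rw [if_neg ht]; exact near_blank _
  -- The output convention says nothing about the cells to the left of the output word, which may
  -- contain garbage.
  obtain ⟨Lg, hLg⟩ : ∃ Lg, c.tape 1 = zip Lg (digits v) := by
    obtain ⟨Lg, hLg⟩ := Quotient.exists_rep (c.tape 1).left
    refine ⟨Lg, ?_⟩
    rw [← Turing.Tape.mk'_left_right₀ (c.tape 1), h8, ← hLg]; rfl
  have hvlen : v.size ≤ x.size + 1 + l := by
    rw [← length_digits v]
    have := hnear 1
    rw [hLg] at this
    exact this.length_le (digits_ne_zero v)
  obtain ⟨a4, a5⟩ := runs_readLoop (P := P) hg (digits v) (by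
      intro a ha
      simp only [digits, tapeWord, List.mem_map] at ha
      obtain ⟨b, _, rfl⟩ := ha
      cases b <;> simp) (T := T₂) (L := Lg) (C := List.replicate (l + (x.size + 1)) 2) (G := [])
    (R := x.size + 1 + l) (by omega) (by rw [hT₂in, hLg]) hclk (by rw [hout g hg, h4]; rfl)
    (by rw [hT₂in]; exact hnear 1)
  set T₃ : Tapes := Function.update (Function.update (Function.update T₂ g
    (zip ((digits v).reverse ++ []) [])) (numTapes + 1) (zip ((digits v).reverse ++ Lg) []))
    clockTape (zip (List.replicate (digits v).length 2 ++ List.replicate (l + (x.size + 1)) 2) [])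
    with hT₃
  have a6 := runs_rewind (P := P) (t := g) (L := (digits v).reverse) (R := []) (T := T₃)
    (by simpa using digits_ne_zero v) (by
      simp [hT₃, hg.ne, hg2 1])
  have a7 := runs_cleanUp (P := P) (R := x.size + 1 + l + v.size) (by omega)
    (T := Function.update T₃ g (zip [] ((digits v).reverse.reverse ++ []))) (by
      rw [Function.update_of_ne hg.ne', hT₃, Function.update_self,
        List.replicate_append_replicate, length_digits]
      congr 2; omega) (by
      intro t ht
      obtain ⟨t, rfl⟩ := Nat.exists_eq_add_of_le ht
      rw [Function.update_of_ne (hg2 t).symm, hT₃, Function.update_of_ne (hne t).symm]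
      by_cases ht1 : t = 1
      · subst ht1
        rw [Function.update_self, ← length_digits v]
        exact a5
      · rw [Function.update_of_ne (by omega), Function.update_of_ne (hg2 t).symm, hT₂in]
        exact (hnear t).mono (by omega)) (by
      intro t ht
      obtain ⟨t, rfl⟩ := Nat.exists_eq_add_of_le (le_of_add_le_left ht)
      -- The tapes that are not wiped are untouched by the machine. Since the bound is at least `2`,
      -- they are neither its input tape nor its output tape, and so they were blank all along.
      have := two_le_tapeBound P.1
      rw [Function.update_of_ne (hg2 t).symm, hT₃, Function.update_of_ne (hne t).symm,
        Function.update_of_ne (by omega), Function.update_of_ne (hg2 t).symm, hT₂in,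
        a2.tape_eq (by omega), hin]
      simp only [Machine.init]
      rw [if_neg (by omega)]; rfl)
  refine ⟨(a1.seq (a3.seq ((a4.seq a6).seq a7))).to ?_ ?_, by omega⟩
  · simp only [List.length_reverse, length_digits]; omega
  · funext t
    by_cases ht : t = g
    · subst ht
      have ht1 : ¬ numTapes ≤ t := by simp only [clockTape, numTapes] at *; omega
      simp [hg.ne, ht1, num]
    · by_cases ht1 : numTapes ≤ t
      · obtain ⟨t, rfl⟩ := Nat.exists_eq_add_of_le ht1
        by_cases ht2 : t = 0
        · subst ht2
          have : numTapes ≠ g := ht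
          simp [this]
        · simp [ht, ht2, h2 (numTapes + t) (by omega)]
      · by_cases ht3 : t = clockTape
        · subst ht3
          have : clockTape ≠ numTapes := hne 0
          simp [ht, this, h3]
        · have ht4 : t < clockTape := by simp only [clockTape, numTapes] at *; omega
          have ht5 : t ≠ numTapes := by omega
          have ht6 : t ≠ numTapes + 1 := by omega
          simp [ht, ht1, ht3, ht5, hT₃, ht6, hout t ht4]

variable {D : ℕ}

/-! ### Programs on natural numbers -/

/-- The tapes that hold the given numbers. -/
def tapesOf (σ : ℕ → ℕ) : Tapes := fun t => num (σ t)

theorem update_tapesOf (σ : ℕ → ℕ) (t x : ℕ) :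
    Function.update (tapesOf σ) t (num x) = tapesOf (Function.update σ t x) := by
  funext s
  by_cases h : s = t
  · subst h; simp [tapesOf]
  · simp [tapesOf, h]

/-- The program takes the numbers `σ` to the numbers `σ'` in at most `k` operations. An operation
makes the numbers at most one digit longer, or `D` digits long, and takes time linear
in the number of digits. -/
def Sem (P : Machine × ℕ) (D : ℕ) (p : Cmd) (σ : ℕ → ℕ) (k : ℕ) (σ' : ℕ → ℕ) : Prop :=
  ∀ S, D ≤ S → (∀ t, (σ t).size ≤ S) → (∀ t, (σ' t).size ≤ S + k) ∧
    Runs P p (tapesOf σ) (k * (60 * (S + k + 1))) (tapesOf σ')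

theorem Sem.mono {p : Cmd} {σ σ' : ℕ → ℕ} {k l : ℕ} (h : Sem P D p σ k σ') (hkl : k ≤ l) :
    Sem P D p σ l σ' := by
  intro S hS hσ
  obtain ⟨h1, h2⟩ := h S hS hσ
  exact ⟨fun t => (h1 t).trans (by omega), h2.mono (by gcongr)⟩

/-- After `k` operations all numbers have at most `S + k` digits, and the time bound is
superadditive in the number of operations; so only operation counts need to be added. -/
theorem Sem.seq {p q : Cmd} {σ₁ σ₂ σ₃ : ℕ → ℕ} {k l : ℕ} (h : Sem P D p σ₁ k σ₂)
    (h' : Sem P D q σ₂ l σ₃) : Sem P D (.seq p q) σ₁ (k + l) σ₃ := by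
  intro S hS hσ
  obtain ⟨h1, h2⟩ := h S hS hσ
  obtain ⟨h3, h4⟩ := h' (S + k) (by omega) h1
  refine ⟨fun t => (h3 t).trans (by omega), (h2.seq h4).mono ?_⟩
  rw [Nat.add_mul, Nat.add_assoc S k l]
  gcongr
  omega

theorem Sem.ite_pos {t a : ℕ} {p : Cmd} (q : Cmd) {σ₁ σ₂ : ℕ → ℕ} {k : ℕ}
    (ht : (num (σ₁ t)).head = a) (h : Sem P D p σ₁ k σ₂) :
    Sem P D (.ite t a p q) σ₁ (k + 1) σ₂ := by
  intro S hS hσ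
  obtain ⟨h1, h2⟩ := h S hS hσ
  refine ⟨fun t => (h1 t).trans (by omega), (Runs.ite_pos (T₁ := tapesOf σ₁) (t := t) q ht h2).mono
      ?_⟩
  rw [Nat.add_mul]
  gcongr <;> omega

theorem Sem.ite_neg {t a : ℕ} (p : Cmd) {q : Cmd} {σ₁ σ₂ : ℕ → ℕ} {k : ℕ}
    (ht : (num (σ₁ t)).head ≠ a) (h : Sem P D q σ₁ k σ₂) :
    Sem P D (.ite t a p q) σ₁ (k + 1) σ₂ := by
  intro S hS hσ
  obtain ⟨h1, h2⟩ := h S hS hσ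
  refine ⟨fun t => (h1 t).trans (by omega), (Runs.ite_neg (T₁ := tapesOf σ₁) (t := t) p ht h2).mono
      ?_⟩
  rw [Nat.add_mul]
  gcongr <;> omega

theorem Sem.loop_end {t a : ℕ} (p : Cmd) {σ : ℕ → ℕ} (ht : (num (σ t)).head = a) :
    Sem P D (.loop t a p) σ 1 σ := by
  intro S hS hσ
  exact ⟨fun t => (hσ t).trans (by omega), (Runs.loop_end (T := tapesOf σ) (t := t) p ht).mono
      (by omega)⟩

theorem Sem.loop_step {t a : ℕ} {p : Cmd} {σ₁ σ₂ σ₃ : ℕ → ℕ} {k l : ℕ}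
    (ht : (num (σ₁ t)).head ≠ a) (h : Sem P D p σ₁ k σ₂) (h' : Sem P D (.loop t a p) σ₂ l σ₃) :
    Sem P D (.loop t a p) σ₁ (k + 1 + l) σ₃ := by
  intro S hS hσ
  obtain ⟨h1, h2⟩ := h S hS hσ
  obtain ⟨h3, h4⟩ := h' (S + k) (by omega) h1
  refine ⟨fun t => (h3 t).trans (by omega), (Runs.loop_step (T₁ := tapesOf σ₁) (t := t) ht h2
      h4).mono ?_⟩
  have e1 := Nat.mul_le_mul_left k (show 60 * (S + k + 1) ≤ 60 * (S + (k + 1 + l) + 1) by omega)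
  have e2 := Nat.mul_le_mul_left l
    (show 60 * (S + k + l + 1) ≤ 60 * (S + (k + 1 + l) + 1) by omega)
  rw [Nat.add_mul, Nat.add_mul]
  omega

theorem Sem.rep {p : Cmd} (σ : ℕ → ℕ → ℕ) (k : ℕ)
    (h : ∀ i < P.2, Sem P D p (σ i) k (σ (i + 1))) :
    Sem P D (.rep p) (σ 0) (P.2 * k) (σ P.2) := by
  intro S hS hσ
  have h1 : ∀ i ≤ P.2, ∀ t, (σ i t).size ≤ S + i * k := by
    intro i
    induction i with
    | zero => simpa using hσ
    | succ i ih =>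
      intro hi t
      have := (h i (by omega) (S + i * k) (by omega) (ih (by omega))).1 t
      rw [Nat.succ_mul]
      omega
  have h2 : ∀ i, ∃ l ≤ k * (60 * (S + P.2 * k + 1)), i < P.2 →
      Exec P p (tapesOf (σ i)) l (tapesOf (σ (i + 1))) := by
    intro i
    by_cases hi : i < P.2
    · obtain ⟨l, hl, h3⟩ := (h i hi (S + i * k) (by omega) (h1 i hi.le)).2
      refine ⟨l, hl.trans ?_, fun _ => h3⟩
      have : (i + 1) * k ≤ P.2 * k := Nat.mul_le_mul_right _ hi
      rw [Nat.succ_mul] at this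
      gcongr k * (60 * (?_ + 1))
      omega
    · exact ⟨0, by omega, fun h => absurd h hi⟩
  choose l hl h3 using h2
  refine ⟨h1 _ le_rfl, _, ?_, Exec.rep (fun i => tapesOf (σ i)) l h3⟩
  calc ∑ i ∈ Finset.range P.2, l i ≤ ∑ i ∈ Finset.range P.2, k * (60 * (S + P.2 * k + 1)) :=
        Finset.sum_le_sum fun i _ => hl i
    _ = _ := by simp [Nat.mul_assoc]

/-- An operation that changes one number. -/
theorem Sem.of_update {p : Cmd} {σ : ℕ → ℕ} {t x : ℕ}
    (hx : ∀ S, D ≤ S → (∀ t, (σ t).size ≤ S) → x.size ≤ S + 1 ∧ Runs P p (tapesOf σ)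
      (60 * (S + 2)) (Function.update (tapesOf σ) t (num x))) :
    Sem P D p σ 1 (Function.update σ t x) := by
  intro S hS hσ
  obtain ⟨h1, h2⟩ := hx S hS hσ
  refine ⟨fun s => ?_, ?_⟩
  · by_cases h : s = t
    · subst h; simpa using h1
    · simpa [h] using (hσ s).trans (Nat.le_succ _)
  · rw [← update_tapesOf]
    exact h2.mono (by omega)

theorem size_add_le (a b S : ℕ) (ha : a.size ≤ S) (hb : b.size ≤ S) :
    (a + b).size ≤ S + 1 := by
  rw [Nat.size_le] at *
  rw [pow_succ]
  omega

theorem Sem.skip (σ : ℕ → ℕ) : Sem P D skip σ 1 σ := fun S _ hσ =>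
  ⟨fun t => (hσ t).trans (by omega), (runs_skip _).mono (by omega)⟩

theorem Sem.inc {σ : ℕ → ℕ} {t : ℕ} (ht : t < 14) (h : σ flagTape = 0) :
    Sem P D (inc t) σ 1 (Function.update σ t (σ t + 1)) :=
  Sem.of_update fun S _ hσ => by
    have := hσ t
    refine ⟨?_, (runs_inc (T := tapesOf σ) (a := σ t) ht.ne rfl (by simp [tapesOf, h])).mono
        (by omega)⟩
    rw [Nat.size_le] at *
    rw [pow_succ]
    omega

theorem Sem.dec {σ : ℕ → ℕ} {t : ℕ} (ht : t < 14) (h : σ flagTape = 0) (h0 : σ t ≠ 0) :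
    Sem P D (dec t) σ 1 (Function.update σ t (σ t - 1)) :=
  Sem.of_update fun S _ hσ => by
    have := hσ t
    exact ⟨((Nat.size_le_size (Nat.sub_le _ _)).trans this).trans (by omega),
      (runs_dec (T := tapesOf σ) (a := σ t) ht.ne h0 rfl (by simp [tapesOf, h])).mono (by omega)⟩

theorem Sem.pop {σ : ℕ → ℕ} (t : ℕ) : Sem P D (pop t) σ 1 (Function.update σ t (σ t / 2)) :=
  Sem.of_update fun S _ hσ =>
    ⟨((Nat.size_le_size (Nat.div_le_self _ _)).trans (hσ t)).trans (by omega),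
      (runs_pop (T := tapesOf σ) (x := σ t) rfl).mono (by omega)⟩

theorem Sem.zero {σ : ℕ → ℕ} (t : ℕ) : Sem P D (zero t) σ 1 (Function.update σ t 0) :=
  Sem.of_update fun S _ hσ => ⟨by simp, (runs_zero (T := tapesOf σ) (x := σ t) rfl).mono
      (by have := hσ t; omega)⟩

theorem Sem.dbl {σ : ℕ → ℕ} (t : ℕ) : Sem P D (dbl t) σ 1 (Function.update σ t (2 * σ t)) :=
  Sem.of_update fun S _ hσ =>
    ⟨by rw [two_mul]; exact size_add_le _ _ _ (hσ t) (hσ t),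
        (runs_dbl (T := tapesOf σ) (x := σ t) rfl).mono (by omega)⟩

theorem Sem.add {σ : ℕ → ℕ} {x y : ℕ} (hx : x ≠ flagTape) (hy : y ≠ flagTape) (hxy : x ≠ y)
    (h : σ flagTape = 0) : Sem P D (add x y) σ 1 (Function.update σ x (σ x + σ y)) :=
  Sem.of_update fun S _ hσ =>
    ⟨size_add_le _ _ _ (hσ x) (hσ y), (runs_add (T := tapesOf σ) (a := σ x) (b := σ y) hx hy hxy rfl
        rfl (by simp [tapesOf, h])).mono
      (by have := hσ x; have := hσ y; omega)⟩

/-- Copy the number on tape `y` to tape `x`. -/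
def copy (x y : ℕ) : Cmd := .seq (zero x) (add x y)

theorem Sem.copy {σ : ℕ → ℕ} {x y : ℕ} (hx : x ≠ flagTape) (hy : y ≠ flagTape) (hxy : x ≠ y)
    (h : σ flagTape = 0) : Sem P D (copy x y) σ 2 (Function.update σ x (σ y)) := by
  have := (Sem.zero (P := P) (D := D) (σ := σ) x).seq (Sem.add hx hy hxy (by simp [hx.symm, h]))
  rw [Function.update_self, Function.update_of_ne hxy.symm, Nat.zero_add,
    Function.update_idem] at this
  exact this

/-- Call the machine with the number on tape `x`, and write the result to tape `g`. -/
def callOn (x g : ℕ) : Cmd := .seq (add numTapes x) (.seq (zero g) (call g))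

/-- A call counts as a single operation because `D` dominates input length plus running time, and
thereby also the length of the result. -/
theorem Sem.callOn {σ : ℕ → ℕ} {x g v k : ℕ} (hx : x < 14) (hg : g < 14)
    (hσ : ∀ t, 14 ≤ t → σ t = 0)
    (h : Machine.ComputesWithin P.1 (Computability.encodeNat (σ x)) (Computability.encodeNat v) k)
    (hD : (σ x).size + k + 1 ≤ D) : Sem P D (callOn x g) σ 3 (Function.update σ g v) := by
  have hxn : x ≠ numTapes := by simp only [numTapes]; omega
  have hgn : g ≠ numTapes := by simp only [numTapes]; omega
  have hgc : g ≠ clockTape := by simp only [clockTape]; omega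
  have h1 : Sem P D _ σ 1 _ := Sem.add (σ := σ) (x := numTapes) (y := x) (by decide)
    (by simp only [flagTape]; omega) hxn.symm (hσ _ le_rfl)
  have h2 := h1.seq (Sem.zero g)
  have h3 : Sem P D (call g) (Function.update (Function.update σ numTapes (σ numTapes + σ x)) g 0)
      1 (Function.update σ g v) := by
    intro S hS hs
    obtain ⟨h4, h5⟩ := runs_call (P := P) (g := g) (T := tapesOf (Function.update
      (Function.update σ numTapes (σ numTapes + σ x)) g 0)) (x := σ x) (v := v) (k := k)
      (by simp only [clockTape]; omega) (by simp [tapesOf, hgn.symm, hσ numTapes (by decide)])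
      (by
        intro t ht
        have : numTapes = 16 := rfl
        have ht1 : t ≠ g := by omega
        have ht2 : t ≠ numTapes := by omega
        simp [tapesOf, ht1, ht2, hσ t (by omega)])
      (by
        have : clockTape ≠ numTapes := by decide
        simp [tapesOf, hgc.symm, this, hσ clockTape (by decide)])
      (by simp [tapesOf]) h
    refine ⟨fun t => ?_, h4.to ?_ ?_⟩
    · by_cases ht : t = g
      · subst ht; simp; omega
      · have := hs t
        by_cases ht2 : t = numTapes
        · subst ht2; simp [ht, hσ numTapes (by decide)]
        · simp [ht, ht2] at this ⊢; omega
    · omega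
    · rw [update_tapesOf, update_tapesOf]
      congr 1
      funext t
      by_cases ht : t = g
      · subst ht; simp
      · by_cases ht2 : t = numTapes
        · subst ht2; simp [ht, hσ numTapes (by decide)]
        · simp [ht, ht2]
  have h4 := h1.seq ((Sem.zero g).seq h3)
  exact h4

/-- Decrease the number on a tape, if it is positive. -/
def pred (t : ℕ) : Cmd := .ite t 0 skip (dec t)

theorem Sem.pred {σ : ℕ → ℕ} {t : ℕ} (ht : t < 14) (h : σ flagTape = 0) :
    Sem P D (pred t) σ 2 (Function.update σ t (σ t - 1)) := by
  by_cases h0 : σ t = 0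
  · have := Sem.ite_pos (P := P) (D := D) (t := t) (a := 0) (Pio.dec t) (by rw [h0]; rfl)
      (Sem.skip σ)
    rwa [show Function.update σ t (σ t - 1) = σ by simp [h0]]
  · exact Sem.ite_neg _ (by rwa [Ne, head_num_eq_zero]) (Sem.dec ht h h0)

/-- Carry out `p` as often as the number on tape `c` says. -/
def forLoop (c : ℕ) (p : Cmd) : Cmd := .loop c 0 (.seq (dec c) p)

/-- The counter is decreased before the body, which therefore sees `m - i - 1`. Besides the body, a
round costs two operations, the decrement and the test. -/
theorem Sem.forLoop {p : Cmd} {c k m : ℕ} (hc : c < 14) (σ : ℕ → ℕ → ℕ)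
    (hf : ∀ i ≤ m, σ i flagTape = 0) (hm : ∀ i ≤ m, σ i c = m - i)
    (h : ∀ i < m, Sem P D p (Function.update (σ i) c (m - i - 1)) k (σ (i + 1))) :
    Sem P D (forLoop c p) (σ 0) (m * (k + 2) + 1) (σ m) := by
  have : ∀ j ≤ m, Sem P D (Pio.forLoop c p) (σ (m - j)) (j * (k + 2) + 1) (σ m) := by
    intro j
    induction j with
    | zero =>
      intro _
      exact (Sem.loop_end _ (by rw [head_num_eq_zero, hm _ (by omega)]; omega)).mono (by omega)
    | succ j ih =>
      intro hj
      have h1 : Sem P D _ _ _ _ := Sem.dec (σ := σ (m - (j + 1))) hc (hf _ (by omega))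
        (by rw [hm _ (by omega)]; omega)
      rw [hm _ (by omega)] at h1
      have h2 := h1.seq (h (m - (j + 1)) (by omega))
      rw [show m - (j + 1) + 1 = m - j by omega] at h2
      refine (Sem.loop_step (by rw [Ne, head_num_eq_zero, hm _ (by omega)]; omega) h2
        (ih (by omega))).mono ?_
      rw [Nat.succ_mul]
      omega
  simpa using this m le_rfl

/-! ### The program for `restMult` -/

/-- The numbers on the program tapes, given as a list. -/
def st (L : List ℕ) : ℕ → ℕ := fun t => L.getD t 0

theorem update_st {L : List ℕ} (hL : L.length = 14) {t : ℕ} (ht : t < 14) (x : ℕ) :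
    Function.update (st L) t x = st (L.set t x) := by
  funext s
  by_cases h : s = t
  · subst h; simp [st, hL, ht]
  · simp [st, h, List.getElem?_set_ne (Ne.symm h)]

theorem st_eq_zero {L : List ℕ} (hL : L.length = 14) {t : ℕ} (ht : 14 ≤ t) : st L t = 0 :=
  List.getD_eq_default _ _ (by omega)

section

variable {L L' : List ℕ}

/-- With the 14 registers as an explicit list, the effect of an operation can be verified by `rfl`.
Register `0` holds `n`, `1` the result, `2` and `3` the old and the growing product, `4` a shifted
copy, `5` and `6` the indices of factor and term, `7` the value returned by `M`, `8` the width, and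
`9` to `13` mostly serve as counters. -/
theorem Sem.inc_st (t : ℕ) (ht : t < 14 := by decide) (hL : L.length = 14 := by rfl)
    (h : L.set t (L.getD t 0 + 1) = L' := by rfl) : Sem P D (Pio.inc t) (st L) 1 (st L') := by
  subst h
  rw [← update_st hL ht]
  exact Sem.inc ht (st_eq_zero hL le_rfl)

theorem Sem.pred_st (t : ℕ) (ht : t < 14 := by decide) (hL : L.length = 14 := by rfl)
    (h : L.set t (L.getD t 0 - 1) = L' := by rfl) : Sem P D (Pio.pred t) (st L) 2 (st L') := by
  subst h
  rw [← update_st hL ht]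
  exact Sem.pred ht (st_eq_zero hL le_rfl)

theorem Sem.pop_st (t : ℕ) (ht : t < 14 := by decide) (hL : L.length = 14 := by rfl)
    (h : L.set t (L.getD t 0 / 2) = L' := by rfl) : Sem P D (Pio.pop t) (st L) 1 (st L') := by
  subst h
  rw [← update_st hL ht]
  exact Sem.pop t

theorem Sem.zero_st (t : ℕ) (ht : t < 14 := by decide) (hL : L.length = 14 := by rfl)
    (h : L.set t 0 = L' := by rfl) : Sem P D (Pio.zero t) (st L) 1 (st L') := by
  subst h
  rw [← update_st hL ht]
  exact Sem.zero t

theorem Sem.dbl_st (t : ℕ) (ht : t < 14 := by decide) (hL : L.length = 14 := by rfl)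
    (h : L.set t (2 * L.getD t 0) = L' := by rfl) : Sem P D (Pio.dbl t) (st L) 1 (st L') := by
  subst h
  rw [← update_st hL ht]
  exact Sem.dbl t

theorem Sem.add_st (x y : ℕ) (hx : x < 14 := by decide) (hy : y < 14 := by decide)
    (hxy : x ≠ y := by decide) (hL : L.length = 14 := by rfl)
    (h : L.set x (L.getD x 0 + L.getD y 0) = L' := by rfl) :
    Sem P D (Pio.add x y) (st L) 1 (st L') := by
  subst h
  rw [← update_st hL hx]
  exact Sem.add hx.ne hy.ne hxy (st_eq_zero hL le_rfl)

theorem Sem.copy_st (x y : ℕ) (hx : x < 14 := by decide) (hy : y < 14 := by decide)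
    (hxy : x ≠ y := by decide) (hL : L.length = 14 := by rfl)
    (h : L.set x (L.getD y 0) = L' := by rfl) :
    Sem P D (Pio.copy x y) (st L) 2 (st L') := by
  subst h
  rw [← update_st hL hx]
  exact Sem.copy hx.ne hy.ne hxy (st_eq_zero hL le_rfl)

theorem Sem.for_st {p : Cmd} {c k m : ℕ} (hc : c < 14) (f : ℕ → List ℕ)
    (hL : ∀ i, (f i).length = 14) (hm : ∀ i, (f i).getD c 0 = m - i)
    (h : ∀ i < m, Sem P D p (st ((f i).set c (m - i - 1))) k (st (f (i + 1))))
    (h0 : f 0 = L) (h1 : f m = L') :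
    Sem P D (Pio.forLoop c p) (st L) (m * (k + 2) + 1) (st L') := by
  subst h0 h1
  refine Sem.forLoop hc (fun i => st (f i)) (fun i _ => st_eq_zero (hL i) le_rfl)
    (fun i _ => hm i) fun i hi => ?_
  rw [update_st (hL i) hc]
  exact h i hi

end

/-! ### Reduction of the input modulo `d` -/

/-- Reduce the number on tape `v` once modulo the parameter `d`. -/
def reduce (v : ℕ) : Cmd :=
  .seq (copy 13 v) (.seq (inc 13) (.seq (.rep (pred 13))
    (.seq (.ite 13 0 skip (.seq (copy v 13) (dec v))) (zero 13))))

/-- Decreasing `v + 1` exactly `d` times, with truncation at zero, gives zero iff `v < d`, and `v -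
d + 1` otherwise; without the extra one, `v = d` would look like `v < d`. -/
theorem Sem.reduce {σ : ℕ → ℕ} {v : ℕ} (hv : v < 13) (h : σ flagTape = 0) (h13 : σ 13 = 0) :
    Sem P D (reduce v) σ (2 * P.2 + 8)
      (Function.update σ v (if σ v < P.2 then σ v else σ v - P.2)) := by
  have hv' : v ≠ flagTape := by simp only [flagTape]; omega
  have hf : flagTape ≠ 13 := by decide
  have h1 : Sem P D _ σ 2 _ := Sem.copy (x := 13) (y := v) hf.symm hv' (by omega) h
  have h2 : Sem P D _ _ 1 _ := Sem.inc (σ := Function.update σ 13 (σ v)) (t := 13) (by decide)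
    (by simp [hf, h])
  rw [Function.update_self, Function.update_idem] at h2
  have h3 : Sem P D (.rep (Pio.pred 13)) _ _ _ :=
    Sem.rep (fun i => Function.update σ 13 (σ v + 1 - i)) 2 fun i _ => by
      have := Sem.pred (P := P) (D := D) (σ := Function.update σ 13 (σ v + 1 - i)) (t := 13)
        (by decide) (by simp [hf, h])
      rwa [Function.update_self, Function.update_idem, Nat.sub_sub] at this
  have h5 : ∀ x, Sem P D (Pio.zero 13) (Function.update (Function.update σ 13 x) v
      (if σ v < P.2 then σ v else σ v - P.2)) 1
      (Function.update σ v (if σ v < P.2 then σ v else σ v - P.2)) := by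
    intro x
    have := Sem.zero (P := P) (D := D) (σ := Function.update (Function.update σ 13 x) v
      (if σ v < P.2 then σ v else σ v - P.2)) 13
    convert this using 1
    funext t
    by_cases ht : t = 13
    · subst ht; simp [h13, hv.ne']
    · by_cases ht2 : t = v
      · subst ht2; simp [ht]
      · simp [ht, ht2]
  have h4 : Sem P D (.ite 13 0 Pio.skip (.seq (Pio.copy v 13) (Pio.dec v)))
      (Function.update σ 13 (σ v + 1 - P.2)) 4 (Function.update
      (Function.update σ 13 (σ v + 1 - P.2)) v (if σ v < P.2 then σ v else σ v - P.2)) := by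
    by_cases hlt : σ v < P.2
    · have h6 := Sem.ite_pos (P := P) (D := D) (t := 13) (a := 0)
        (.seq (Pio.copy v 13) (Pio.dec v))
        (by rw [head_num_eq_zero, Function.update_self]; omega)
        (Sem.skip (Function.update σ 13 (σ v + 1 - P.2)))
      rw [if_pos hlt]
      rw [show Function.update (Function.update σ 13 (σ v + 1 - P.2)) v (σ v) =
        Function.update σ 13 (σ v + 1 - P.2) by
          rw [Function.update_eq_self_iff, Function.update_of_ne (by omega)]]
      exact h6.mono (by omega)
    · have h6 : Sem P D _ _ 2 _ := Sem.copy (σ := Function.update σ 13 (σ v + 1 - P.2)) (x := v)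
        (y := 13) hv' hf.symm (by omega) (by simp [hf, h])
      have h7 := h6.seq (Sem.dec (t := v) (by omega) (by simp [hv'.symm, hf, h])
        (by simp; omega))
      have h8 := Sem.ite_neg (P := P) (D := D) (t := 13) (a := 0) Pio.skip
        (by rw [Ne, head_num_eq_zero, Function.update_self]; omega) h7
      rw [Function.update_self, Function.update_self, Function.update_idem,
        show σ v + 1 - P.2 - 1 = σ v - P.2 by omega] at h8
      rw [if_neg hlt]
      exact h8
  exact (h1.seq (h2.seq (h3.seq (h4.seq (h5 _))))).mono (by omega)

theorem Sem.reduce_st {L L' : List ℕ} (v : ℕ) (hL : L.length = 14) (h : L.getD 13 0 = 0)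
    (h' : L.set v (if L.getD v 0 < P.2 then L.getD v 0 else L.getD v 0 - P.2) = L')
    (hv : v < 13 := by decide) :
    Sem P D (Pio.reduce v) (st L) (2 * P.2 + 8) (st L') := by
  subst h'
  rw [← update_st hL (by omega)]
  exact Sem.reduce hv (st_eq_zero hL le_rfl) h

/-- The loop of `modProg`. -/
def modLoop : Cmd := .loop 2 0 (.seq (.ite 2 2 (.seq (add 4 3) (reduce 4)) skip)
  (.seq (pop 2) (.seq (dbl 3) (reduce 3))))

theorem reduce_mod (x d : ℕ) : (if x < d then x else x - d) % d = x % d := by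
  split
  · rfl
  · rw [← Nat.mod_eq_sub_mod (by omega)]

/-- Binary method: `p` runs through the powers of two modulo `d`, and `r + p m` is invariant modulo
`d`. There is one round per binary digit, which is what the case `d ∤ n` requires. Only `p ≤ d` is
demanded, because `p` starts at `1` and `d` may be `1`. -/
theorem sem_modLoop (n m : ℕ) {p r : ℕ} (hr : r < P.2) (hp : p ≤ P.2) :
    ∃ p' r', Sem P D modLoop (st [n, 0, m, p, r, 0, 0, 0, 0, 0, 0, 0, 0, 0])
      (m.size * (4 * P.2 + 21) + 1) (st [n, 0, 0, p', r', 0, 0, 0, 0, 0, 0, 0, 0, 0]) ∧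
      r' < P.2 ∧ r' % P.2 = (r + p * m) % P.2 := by
  induction m using binary_induction generalizing p r with
  | h0 => exact ⟨p, r, (Sem.loop_end (t := 2) (a := 0) _ rfl).mono (by omega), hr, by simp⟩
  | h1 a ha ih =>
    obtain ⟨p', r', h1, h2, h3⟩ := ih (p := if 2 * p < P.2 then 2 * p else 2 * p - P.2) hr
      (by split <;> omega)
    refine ⟨p', r', ?_, h2, ?_⟩
    · have h4 : Sem P D (.ite 2 2 (.seq (add 4 3) (reduce 4)) skip)
          (st [n, 0, 2 * a, p, r, 0, 0, 0, 0, 0, 0, 0, 0, 0]) 2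
          (st [n, 0, 2 * a, p, r, 0, 0, 0, 0, 0, 0, 0, 0, 0]) := by
        refine Sem.ite_neg _ ?_ (Sem.skip _)
        rw [Ne, head_num_eq_two]
        change ¬ (2 * a) % 2 = 1
        omega
      have h5 : Sem P D (pop 2) (st [n, 0, 2 * a, p, r, 0, 0, 0, 0, 0, 0, 0, 0, 0]) 1
          (st [n, 0, a, p, r, 0, 0, 0, 0, 0, 0, 0, 0, 0]) := Sem.pop_st 2 (h := by simp)
      have h6 : Sem P D (dbl 3) (st [n, 0, a, p, r, 0, 0, 0, 0, 0, 0, 0, 0, 0]) 1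
          (st [n, 0, a, 2 * p, r, 0, 0, 0, 0, 0, 0, 0, 0, 0]) := Sem.dbl_st 3
      have h7 := h4.seq (h5.seq (h6.seq (Sem.reduce_st 3 rfl rfl rfl)))
      refine (Sem.loop_step (t := 2) (a := 0) ?_ h7 h1).mono ?_
      · rw [Ne, head_num_eq_zero]
        change ¬ 2 * a = 0
        omega
      · rw [size_even ha, Nat.succ_mul a.size]; omega
    · rw [h3, Nat.add_mod, Nat.mul_mod, reduce_mod, ← Nat.mul_mod, ← Nat.add_mod]
      congr 1; ring
  | h2 a ih =>
    obtain ⟨p', r', h1, h2, h3⟩ := ih (p := if 2 * p < P.2 then 2 * p else 2 * p - P.2)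
      (r := if r + p < P.2 then r + p else r + p - P.2) (by split <;> omega)
      (by split <;> omega)
    refine ⟨p', r', ?_, h2, ?_⟩
    · have h4 : Sem P D (.ite 2 2 (.seq (add 4 3) (reduce 4)) skip)
          (st [n, 0, 2 * a + 1, p, r, 0, 0, 0, 0, 0, 0, 0, 0, 0]) (1 + (2 * P.2 + 8) + 1)
          (st [n, 0, 2 * a + 1, p, if r + p < P.2 then r + p else r + p - P.2,
            0, 0, 0, 0, 0, 0, 0, 0, 0]) := by
        refine Sem.ite_pos _ ?_ (Sem.seq (Sem.add_st 4 3
          (L' := [n, 0, 2 * a + 1, p, r + p, 0, 0, 0, 0, 0, 0, 0, 0, 0]))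
          (Sem.reduce_st 4 rfl rfl rfl))
        rw [head_num_eq_two]
        change (2 * a + 1) % 2 = 1
        omega
      have h5 : Sem P D (pop 2) (st [n, 0, 2 * a + 1, p,
            if r + p < P.2 then r + p else r + p - P.2, 0, 0, 0, 0, 0, 0, 0, 0, 0]) 1
          (st [n, 0, a, p, if r + p < P.2 then r + p else r + p - P.2,
            0, 0, 0, 0, 0, 0, 0, 0, 0]) := Sem.pop_st 2 (h := by simp; omega)
      have h6 : Sem P D (dbl 3) (st [n, 0, a, p,
            if r + p < P.2 then r + p else r + p - P.2, 0, 0, 0, 0, 0, 0, 0, 0, 0]) 1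
          (st [n, 0, a, 2 * p, if r + p < P.2 then r + p else r + p - P.2,
            0, 0, 0, 0, 0, 0, 0, 0, 0]) := Sem.dbl_st 3
      have h7 := h4.seq (h5.seq (h6.seq (Sem.reduce_st 3 rfl rfl rfl)))
      refine (Sem.loop_step (t := 2) (a := 0) ?_ h7 h1).mono ?_
      · rw [Ne, head_num_eq_zero]
        change ¬ 2 * a + 1 = 0
        omega
      · rw [size_odd, Nat.succ_mul a.size]; omega
    · rw [h3, Nat.add_mod, Nat.mul_mod, reduce_mod, reduce_mod, ← Nat.mul_mod, ← Nat.add_mod]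
      congr 1; ring

/-- Compute the input modulo `d` on tape `4`. -/
def modProg : Cmd := .seq (copy 2 0) (.seq (inc 3) (.seq modLoop (zero 3)))

theorem sem_modProg (n : ℕ) (hd : 1 ≤ P.2) :
    Sem P D modProg (st [n, 0, 0, 0, 0, 0, 0, 0, 0, 0, 0, 0, 0, 0])
      (n.size * (4 * P.2 + 21) + 5) (st [n, 0, 0, 0, n % P.2, 0, 0, 0, 0, 0, 0, 0, 0, 0]) := by
  obtain ⟨p', r', h1, h2, h3⟩ := sem_modLoop (P := P) (D := D) n n (p := 1) (r := 0) hd hd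
  have h4 : r' = n % P.2 := by
    rw [← Nat.mod_eq_of_lt h2, h3]; simp
  rw [← h4]
  refine ((Sem.copy_st 2 0 (L' := [n, 0, n, 0, 0, 0, 0, 0, 0, 0, 0, 0, 0, 0])).seq
    ((Sem.inc_st 3).seq (h1.seq (Sem.zero_st 3)))).mono (by omega)

/-! ### The Kronecker product and its digits -/

/-- Compute the width `(n + 1) ^ 2` on tape `8`. -/
def widthProg : Cmd := .seq (copy 9 0) (.seq (inc 9)
  (forLoop 9 (.seq (copy 10 0) (.seq (inc 10) (forLoop 10 (inc 8))))))

theorem sem_widthProg (n : ℕ) : Sem P D widthProg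
    (st [n, 0, 0, 0, 0, 0, 0, 0, 0, 0, 0, 0, 0, 0]) ((n + 1) * ((n + 1) * 3 + 6) + 4)
    (st [n, 0, 0, 0, 0, 0, 0, 0, (n + 1) * (n + 1), 0, 0, 0, 0, 0]) := by
  have h1 (w a : ℕ) : Sem P D (forLoop 10 (inc 8))
      (st [n, 0, 0, 0, 0, 0, 0, 0, w, a, n + 1, 0, 0, 0]) ((n + 1) * 3 + 1)
      (st [n, 0, 0, 0, 0, 0, 0, 0, w + (n + 1), a, 0, 0, 0, 0]) :=
    Sem.for_st (m := n + 1) (by decide)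
      (fun t => [n, 0, 0, 0, 0, 0, 0, 0, w + t, a, n + 1 - t, 0, 0, 0]) (fun _ => rfl)
      (fun _ => rfl) (fun i _ => Sem.inc_st 8) rfl (by simp)
  have h2 : Sem P D (forLoop 9 (.seq (copy 10 0) (.seq (inc 10) (forLoop 10 (inc 8)))))
      (st [n, 0, 0, 0, 0, 0, 0, 0, 0, n + 1, 0, 0, 0, 0])
      ((n + 1) * ((2 + (1 + ((n + 1) * 3 + 1))) + 2) + 1)
      (st [n, 0, 0, 0, 0, 0, 0, 0, (n + 1) * (n + 1), 0, 0, 0, 0, 0]) := by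
    refine Sem.for_st (m := n + 1) (by decide)
      (fun t => [n, 0, 0, 0, 0, 0, 0, 0, t * (n + 1), n + 1 - t, 0, 0, 0, 0]) (fun _ => rfl)
      (fun _ => rfl) (fun i _ => ?_) (by simp) (by simp)
    rw [Nat.succ_mul i]
    exact (Sem.copy_st 10 0).seq ((Sem.inc_st 10).seq (h1 _ _))
  exact ((Sem.copy_st 9 0).seq ((Sem.inc_st 9).seq h2)).mono (by
    rw [show 2 + (1 + ((n + 1) * 3 + 1)) + 2 = (n + 1) * 3 + 6 by omega]; omega)

/-- Multiply the number on tape `4` by `2 ^ (c i w)`, where `c`, `i` and `w` are the numbers on the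
tapes `11`, `5` and `8`. -/
def shiftProg : Cmd :=
  forLoop 11 (.seq (copy 12 5) (forLoop 12 (.seq (copy 13 8) (forLoop 13 (dbl 4)))))

theorem sem_shiftProg (n X Z Y i j g W a b c : ℕ) : Sem P D shiftProg
    (st [n, 0, X, Z, Y, i, j, g, W, a, b, c, 0, 0]) (c * (i * (3 * W + 5) + 5) + 1)
    (st [n, 0, X, Z, 2 ^ (c * (i * W)) * Y, i, j, g, W, a, b, 0, 0, 0]) := by
  have h1 (Y c d : ℕ) : Sem P D (forLoop 13 (dbl 4))
      (st [n, 0, X, Z, Y, i, j, g, W, a, b, c, d, W]) (W * 3 + 1)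
      (st [n, 0, X, Z, 2 ^ W * Y, i, j, g, W, a, b, c, d, 0]) :=
    Sem.for_st (m := W) (by decide)
      (fun t => [n, 0, X, Z, 2 ^ t * Y, i, j, g, W, a, b, c, d, W - t]) (fun _ => rfl)
      (fun _ => rfl) (fun t _ => Sem.dbl_st 4 (h := by simp [pow_succ']; exact ⟨by ring, rfl⟩))
      (by simp) (by simp)
  have h2 (Y c : ℕ) : Sem P D (forLoop 12 (.seq (copy 13 8) (forLoop 13 (dbl 4))))
      (st [n, 0, X, Z, Y, i, j, g, W, a, b, c, i, 0]) (i * (2 + (W * 3 + 1) + 2) + 1)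
      (st [n, 0, X, Z, 2 ^ (i * W) * Y, i, j, g, W, a, b, c, 0, 0]) := by
    refine Sem.for_st (m := i) (by decide)
      (fun t => [n, 0, X, Z, 2 ^ (t * W) * Y, i, j, g, W, a, b, c, i - t, 0]) (fun _ => rfl)
      (fun _ => rfl) (fun t _ => ?_) (by simp) (by simp)
    rw [Nat.succ_mul, Nat.add_comm (t * W) W, pow_add, Nat.mul_assoc]
    exact (Sem.copy_st 13 8).seq (h1 _ _ _)
  have h3 := Sem.for_st (P := P) (D := D) (p := .seq (copy 12 5) (forLoop 12 (.seq (copy 13 8)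
      (forLoop 13 (dbl 4))))) (c := 11) (k := 2 + (i * (2 + (W * 3 + 1) + 2) + 1)) (m := c)
      (L := [n, 0, X, Z, Y, i, j, g, W, a, b, c, 0, 0])
      (L' := [n, 0, X, Z, 2 ^ (c * (i * W)) * Y, i, j, g, W, a, b, 0, 0, 0]) (by decide)
      (fun t => [n, 0, X, Z, 2 ^ (t * (i * W)) * Y, i, j, g, W, a, b, c - t, 0, 0])
      (fun _ => rfl) (fun _ => rfl) (fun t _ => by
        rw [Nat.succ_mul, Nat.add_comm (t * _) (i * W), pow_add, Nat.mul_assoc]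
        exact (Sem.copy_st 12 5).seq (h2 _ _)) (by simp) (by simp)
  refine h3.mono ?_
  rw [show 2 + (W * 3 + 1) + 2 = 3 * W + 5 by omega]
  gcongr c * ?_ + 1
  omega

/-- The summand `2 ^ (W i g)` for a term `g` of the sequence with `1 ≤ g ≤ n`, and `0` for other
values of `g`. -/
def summand (n W i g : ℕ) : ℕ := if g ≤ n ∧ g ≠ 0 then 2 ^ (g * (i * W)) else 0

/-- Treat the next term of the sequence. -/
def termProg : Cmd :=
  .seq (inc 6) (.seq (callOn 6 7) (.seq (copy 13 7) (.seq (copy 11 0)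
    (.seq (forLoop 11 (pred 13))
    (.seq (.ite 13 0 (.ite 7 0 skip (.seq (copy 4 2) (.seq (copy 11 7) (.seq shiftProg
      (.seq (add 3 4) (zero 4)))))) (zero 13)) (zero 7))))))

/-- A bound for the number of operations of `termProg`. -/
def termCost (n W : ℕ) : ℕ := 4 * n + 20 + (n * (n * (3 * W + 5) + 5) + 1)

theorem sem_termProg {n X Z i j W a b k v : ℕ} (hi : i ≤ n)
    (hv : Machine.ComputesWithin P.1 (Computability.encodeNat (j + 1))
      (Computability.encodeNat v) k) (hD : (j + 1).size + k + 1 ≤ D) :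
    Sem P D termProg (st [n, 0, X, Z, 0, i, j, 0, W, a, b, 0, 0, 0]) (termCost n W)
      (st [n, 0, X, Z + X * summand n W i v, 0, i, j + 1, 0, W, a, b, 0, 0, 0]) := by
  have h1 : Sem P D (callOn 6 7) (st [n, 0, X, Z, 0, i, j + 1, 0, W, a, b, 0, 0, 0]) 3
      (st [n, 0, X, Z, 0, i, j + 1, v, W, a, b, 0, 0, 0]) := by
    have := Sem.callOn (P := P) (D := D) (σ := st [n, 0, X, Z, 0, i, j + 1, 0, W, a, b, 0, 0, 0])
      (x := 6) (g := 7) (by decide) (by decide) (fun t ht => st_eq_zero rfl ht) hv hD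
    rwa [update_st rfl (by decide)] at this
  have h2 : Sem P D (forLoop 11 (pred 13)) (st [n, 0, X, Z, 0, i, j + 1, v, W, a, b, n, 0, v])
      (n * 4 + 1) (st [n, 0, X, Z, 0, i, j + 1, v, W, a, b, 0, 0, v - n]) :=
    Sem.for_st (m := n) (by decide)
      (fun t => [n, 0, X, Z, 0, i, j + 1, v, W, a, b, n - t, 0, v - t]) (fun _ => rfl)
      (fun _ => rfl) (fun t _ => Sem.pred_st 13) rfl (by simp)
  have h3 : Sem P D (.ite 13 0 (.ite 7 0 skip (.seq (copy 4 2) (.seq (copy 11 7) (.seq shiftProg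
      (.seq (add 3 4) (zero 4)))))) (zero 13))
      (st [n, 0, X, Z, 0, i, j + 1, v, W, a, b, 0, 0, v - n])
      (8 + (n * (n * (3 * W + 5) + 5) + 1))
      (st [n, 0, X, Z + X * summand n W i v, 0, i, j + 1, v, W, a, b, 0, 0, 0]) := by
    -- Register `13` holds the truncated difference `v - n`. Values above `n` are discarded before
    -- any loop counts up to `v`, so the cost depends only on `n` and `W`, however large `v` is.
    by_cases hvn : v ≤ n
    · rw [Nat.sub_eq_zero_of_le hvn]
      by_cases hv0 : v = 0
      · subst hv0
        refine (Sem.ite_pos _ (by rfl) (Sem.ite_pos _ (by rfl) (Sem.skip _))).mono (by omega)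
      · have h4 := (Sem.copy_st (P := P) (D := D) 4 2
          (L := [n, 0, X, Z, 0, i, j + 1, v, W, a, b, 0, 0, 0])
          (L' := [n, 0, X, Z, X, i, j + 1, v, W, a, b, 0, 0, 0])).seq ((Sem.copy_st 11 7
          (L' := [n, 0, X, Z, X, i, j + 1, v, W, a, b, v, 0, 0])).seq
          ((sem_shiftProg n X Z X i (j + 1) v W a b v).seq ((Sem.add_st 3 4
          (L' := [n, 0, X, Z + 2 ^ (v * (i * W)) * X, 2 ^ (v * (i * W)) * X, i, j + 1, v, W, a, b,
            0, 0, 0])).seq (Sem.zero_st 4))))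
        rw [summand, if_pos ⟨hvn, hv0⟩, Nat.mul_comm X]
        refine (Sem.ite_pos _ (by rfl) (Sem.ite_neg _ ?_ h4)).mono ?_
        · rw [Ne, head_num_eq_zero]
          exact hv0
        · have : v * (i * (3 * W + 5) + 5) + 1 ≤ n * (n * (3 * W + 5) + 5) + 1 := by gcongr
          omega
    · rw [summand, if_neg (by simp [hvn]), Nat.mul_zero, Nat.add_zero]
      refine (Sem.ite_neg _ ?_ (Sem.zero_st 13)).mono (by omega)
      rw [Ne, head_num_eq_zero]
      change ¬ v - n = 0
      omega
  exact ((Sem.inc_st 6).seq (h1.seq ((Sem.copy_st 13 7).seq ((Sem.copy_st 11 0).seq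
    (h2.seq (h3.seq (Sem.zero_st 7))))))).mono (by unfold termCost; omega)

/-- Multiply the number on tape `2` by the next factor. -/
def factorProg : Cmd :=
  .seq (inc 5) (.seq (copy 3 2) (.seq (copy 10 0) (.seq (forLoop 10 termProg)
    (.seq (copy 2 3) (.seq (zero 3) (zero 6))))))

/-- A bound for the number of operations of `factorProg`. -/
def factorCost (n W : ℕ) : ℕ := n * (termCost n W + 2) + 10

theorem sem_factorProg {n X i W a : ℕ} {G : ℕ → ℕ} (hi : i < n)
    (hG : ∀ j, 1 ≤ j → j ≤ n → ∃ k : ℕ, Machine.ComputesWithin P.1 (Computability.encodeNat j)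
      (Computability.encodeNat (G j)) k ∧ j.size + k + 1 ≤ D) :
    Sem P D factorProg (st [n, 0, X, 0, 0, i, 0, 0, W, a, 0, 0, 0, 0]) (factorCost n W)
      (st [n, 0, X * (1 + ∑ j ∈ Finset.range n, summand n W (i + 1) (G (j + 1))), 0, 0, i + 1,
        0, 0, W, a, 0, 0, 0, 0]) := by
  have h1 : Sem P D (forLoop 10 termProg) (st [n, 0, X, X, 0, i + 1, 0, 0, W, a, n, 0, 0, 0])
      (n * (termCost n W + 2) + 1)
      (st [n, 0, X, X * (1 + ∑ j ∈ Finset.range n, summand n W (i + 1) (G (j + 1))), 0, i + 1,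
        n, 0, W, a, 0, 0, 0, 0]) := by
    refine Sem.for_st (m := n) (by decide)
      (fun t => [n, 0, X, X * (1 + ∑ j ∈ Finset.range t, summand n W (i + 1) (G (j + 1))), 0,
        i + 1, t, 0, W, a, n - t, 0, 0, 0]) (fun _ => rfl) (fun _ => rfl) (fun t ht => ?_)
      (by simp) (by simp)
    obtain ⟨k, hk, hkD⟩ := hG (t + 1) (by omega) ht
    rw [Finset.sum_range_succ, ← Nat.add_assoc, Nat.mul_add X (1 + _)]
    exact sem_termProg hi hk hkD
  exact ((Sem.inc_st 5).seq ((Sem.copy_st 3 2).seq ((Sem.copy_st 10 0).seq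
    (h1.seq ((Sem.copy_st 2 3).seq ((Sem.zero_st 3).seq (Sem.zero_st 6))))))).mono
    (by unfold factorCost; omega)

/-- Write the digits from number `n w` to number `(n + 1) w` of the number on tape `2` to tape `1`,
where `w` is the number on tape `8`. -/
def extractProg : Cmd :=
  .seq (copy 9 0) (.seq (forLoop 9 (.seq (copy 10 8) (forLoop 10 (pop 2))))
  (.seq (inc 3) (.seq (copy 9 8)
    (forLoop 9 (.seq (.ite 2 2 (add 1 3) skip) (.seq (pop 2) (dbl 3)))))))

theorem sem_extractProg (n X i W : ℕ) : ∃ Y Z, Sem P D extractProg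
    (st [n, 0, X, 0, 0, i, 0, 0, W, 0, 0, 0, 0, 0]) (n * (W * 3 + 5) + W * 6 + 7)
    (st [n, X / 2 ^ (n * W) % 2 ^ W, Y, Z, 0, i, 0, 0, W, 0, 0, 0, 0, 0]) := by
  have h1 (X a : ℕ) : Sem P D (forLoop 10 (pop 2))
      (st [n, 0, X, 0, 0, i, 0, 0, W, a, W, 0, 0, 0]) (W * 3 + 1)
      (st [n, 0, X / 2 ^ W, 0, 0, i, 0, 0, W, a, 0, 0, 0, 0]) :=
    Sem.for_st (m := W) (by decide)
      (fun t => [n, 0, X / 2 ^ t, 0, 0, i, 0, 0, W, a, W - t, 0, 0, 0]) (fun _ => rfl)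
      (fun _ => rfl) (fun t _ => Sem.pop_st 2 (h := by
        rw [pow_succ, ← Nat.div_div_eq_div_mul]; rfl)) (by simp) (by simp)
  have h2 : Sem P D (forLoop 9 (.seq (copy 10 8) (forLoop 10 (pop 2))))
      (st [n, 0, X, 0, 0, i, 0, 0, W, n, 0, 0, 0, 0]) (n * (2 + (W * 3 + 1) + 2) + 1)
      (st [n, 0, X / 2 ^ (n * W), 0, 0, i, 0, 0, W, 0, 0, 0, 0, 0]) := by
    refine Sem.for_st (m := n) (by decide)
      (fun t => [n, 0, X / 2 ^ (t * W), 0, 0, i, 0, 0, W, n - t, 0, 0, 0, 0]) (fun _ => rfl)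
      (fun _ => rfl) (fun t _ => ?_) (by simp) (by simp)
    rw [Nat.succ_mul, pow_add, ← Nat.div_div_eq_div_mul]
    exact (Sem.copy_st 10 8).seq (h1 _ _)
  have h3 (X : ℕ) : Sem P D (forLoop 9 (.seq (.ite 2 2 (add 1 3) skip) (.seq (pop 2) (dbl 3))))
      (st [n, 0, X, 1, 0, i, 0, 0, W, W, 0, 0, 0, 0]) (W * ((2 + (1 + 1)) + 2) + 1)
      (st [n, X % 2 ^ W, X / 2 ^ W, 2 ^ W, 0, i, 0, 0, W, 0, 0, 0, 0, 0]) := by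
    refine Sem.for_st (m := W) (by decide)
      (fun t => [n, X % 2 ^ t, X / 2 ^ t, 2 ^ t, 0, i, 0, 0, W, W - t, 0, 0, 0, 0]) (fun _ => rfl)
      (fun _ => rfl) (fun t _ => ?_) (by simp [Nat.mod_one]) (by simp)
    have h4 : Sem P D (.ite 2 2 (add 1 3) skip)
        (st [n, X % 2 ^ t, X / 2 ^ t, 2 ^ t, 0, i, 0, 0, W, W - t - 1, 0, 0, 0, 0]) 2
        (st [n, X % 2 ^ (t + 1), X / 2 ^ t, 2 ^ t, 0, i, 0, 0, W, W - t - 1, 0, 0, 0, 0]) := by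
      by_cases hX : X / 2 ^ t % 2 = 1
      · refine Sem.ite_pos _ (head_num_eq_two.2 hX) (Sem.add_st 1 3 (h := ?_))
        rw [Nat.mod_pow_succ, hX, Nat.mul_one]; rfl
      · refine Sem.ite_neg _ (head_num_eq_two.not.2 hX) ?_
        rw [Nat.mod_pow_succ, Nat.mod_two_ne_one.1 hX, Nat.mul_zero, Nat.add_zero]
        exact Sem.skip _
    refine h4.seq (Sem.seq (Sem.pop_st 2 (L' := [n, X % 2 ^ (t + 1), X / 2 ^ (t + 1), 2 ^ t, 0, i,
      0, 0, W, W - t - 1, 0, 0, 0, 0]) (h := ?_)) (Sem.dbl_st 3 (h := ?_)))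
    · rw [pow_succ, ← Nat.div_div_eq_div_mul]; rfl
    · rw [pow_succ' 2 t]; rfl
  refine ⟨_, _, ((Sem.copy_st 9 0).seq (h2.seq ((Sem.inc_st 3
    (L' := [n, 0, X / 2 ^ (n * W), 1, 0, i, 0, 0, W, 0, 0, 0, 0, 0])).seq
    ((Sem.copy_st 9 8).seq (h3 _))))).mono ?_⟩
  rw [show 2 + (W * 3 + 1) + 2 = W * 3 + 5 by omega]
  omega

/-- The program for inputs that are divisible by `d`. -/
def mainProg : Cmd :=
  .seq widthProg (.seq (inc 2) (.seq (copy 9 0) (.seq (forLoop 9 factorProg) extractProg)))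

/-- The number that `mainProg` computes on tape `2`. -/
def kronecker (G : ℕ → ℕ) (n W : ℕ) : ℕ := ∏ i ∈ Finset.range n,
  (1 + ∑ j ∈ Finset.range n, summand n W (i + 1) (G (j + 1)))

/-- A bound for the number of operations of `mainProg`. -/
def mainCost (n : ℕ) : ℕ :=
  (n + 1) * ((n + 1) * 3 + 6) + n * (factorCost n ((n + 1) * (n + 1)) + 2) +
    (n * ((n + 1) * (n + 1) * 3 + 5) + (n + 1) * (n + 1) * 6) + 15

theorem sem_mainProg {n : ℕ} {G : ℕ → ℕ}
    (hG : ∀ j, 1 ≤ j → j ≤ n → ∃ k : ℕ, Machine.ComputesWithin P.1 (Computability.encodeNat j)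
      (Computability.encodeNat (G j)) k ∧ j.size + k + 1 ≤ D) :
    ∃ L, Sem P D mainProg (st [n, 0, 0, 0, 0, 0, 0, 0, 0, 0, 0, 0, 0, 0]) (mainCost n) (st (n ::
      (kronecker G n ((n + 1) * (n + 1)) / 2 ^ (n * ((n + 1) * (n + 1))) %
        2 ^ ((n + 1) * (n + 1))) :: L)) := by
  set W := (n + 1) * (n + 1) with hW
  have h1 : Sem P D (forLoop 9 factorProg) (st [n, 0, 1, 0, 0, 0, 0, 0, W, n, 0, 0, 0, 0])
      (n * (factorCost n W + 2) + 1)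
      (st [n, 0, kronecker G n W, 0, 0, n, 0, 0, W, 0, 0, 0, 0, 0]) := by
    refine Sem.for_st (m := n) (by decide)
      (fun t => [n, 0, ∏ i ∈ Finset.range t,
        (1 + ∑ j ∈ Finset.range n, summand n W (i + 1) (G (j + 1))), 0, 0, t, 0, 0, W, n - t,
        0, 0, 0, 0]) (fun _ => rfl) (fun _ => rfl) (fun t ht => ?_) (by simp)
      (by simp [kronecker])
    rw [Finset.prod_range_succ]
    exact sem_factorProg ht hG
  obtain ⟨Y, Z, h2⟩ := sem_extractProg (P := P) (D := D) n (kronecker G n W) n W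
  refine ⟨_, ((sem_widthProg n).seq ((Sem.inc_st 2
    (L' := [n, 0, 1, 0, 0, 0, 0, 0, W, 0, 0, 0, 0, 0])).seq
    ((Sem.copy_st 9 0).seq (h1.seq h2)))).mono ?_⟩
  unfold mainCost
  rw [← hW]
  omega

/-! ### The generating function -/

open Classical in
/-- The weight of a part that occurs `c` times. -/
noncomputable def weight (A : Set ℕ) (_ c : ℕ) : ℕ := if c ∈ A then 1 else 0

/-- The coefficient of `genFun` sums the products of weights over all partitions, and with weights
`0` and `1` each product is the indicator of the condition. -/
theorem coeff_genFun_weight (A : Set ℕ) (n : ℕ) :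
    (Nat.Partition.genFun (weight A)).coeff n = restMult A n := by
  classical
  rw [Nat.Partition.coeff_genFun, restMult, Finset.card_filter]
  refine Finset.sum_congr rfl fun p _ => ?_
  rw [Finsupp.prod, Multiset.toFinsupp_support]
  simp only [Multiset.toFinsupp_apply, weight]
  split_ifs with h
  · exact Finset.prod_eq_one fun i hi => if_pos (h i (Multiset.mem_toFinset.1 hi))
  · push Not at h
    obtain ⟨i, hi, hc⟩ := h
    exact Finset.prod_eq_zero (Multiset.mem_toFinset.2 hi) (if_neg hc)

theorem restMult_eq_mk (A : Set ℕ) :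
    (PowerSeries.mk fun n => restMult A n) = Nat.Partition.genFun (weight A) := by
  ext n
  rw [PowerSeries.coeff_mk, coeff_genFun_weight]

variable {N : ℕ∞} {g : ℕ → ℕ}

theorem IsIncreasingSeq.injOn (h : IsIncreasingSeq N g) {i j : ℕ} (hi : 1 ≤ i)
    (hiN : (i : ℕ∞) ≤ N) (hj : 1 ≤ j) (hjN : (j : ℕ∞) ≤ N) (hij : g i = g j) : i = j := by
  rcases lt_trichotomy i j with h1 | h1 | h1
  · have := h.2.2 i j hi h1 hjN; omega
  · exact h1
  · have := h.2.2 j i hj h1 hiN; omega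

theorem IsIncreasingSeq.le_apply (h : IsIncreasingSeq N g) {i : ℕ} (hi : 1 ≤ i)
    (hiN : (i : ℕ∞) ≤ N) : i ≤ g i := by
  induction i with
  | zero => omega
  | succ i ih =>
    rcases Nat.eq_zero_or_pos i with rfl | h0
    · exact h.2.1
    · have h1 : ((i : ℕ) : ℕ∞) ≤ N := le_trans (by exact_mod_cast Nat.le_succ i) hiN
      have := ih h0 h1
      have := h.2.2 i (i + 1) h0 (by omega) hiN
      omega

/-- Reindexing along `j ↦ g j - 1`, which is injective; outside its range the weight vanishes. -/
theorem tsum_terms (h : IsIncreasingSeq N g) (i : ℕ) :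
    ∑' j : {j : ℕ // 1 ≤ j ∧ (j : ℕ∞) ≤ N}, (PowerSeries.X : PowerSeries ℕ) ^ ((i + 1) * g j) =
    ∑' k, weight (terms N g) (i + 1) (k + 1) • (PowerSeries.X : PowerSeries ℕ) ^
      ((i + 1) * (k + 1)) := by
  classical
  have hpos : ∀ j : {j : ℕ // 1 ≤ j ∧ (j : ℕ∞) ≤ N}, g j - 1 + 1 = g j := fun j => by
    have := h.le_apply j.2.1 j.2.2
    have := j.2.1
    omega
  have hinj : Function.Injective fun j : {j : ℕ // 1 ≤ j ∧ (j : ℕ∞) ≤ N} => g j - 1 := by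
    intro j j' hjj
    have h1 := hpos j
    have h2 := hpos j'
    exact Subtype.ext (h.injOn j.2.1 j.2.2 j'.2.1 j'.2.2 (by simp only at hjj; omega))
  rw [← hinj.tsum_eq]
  · refine tsum_congr fun j => ?_
    have : g j ∈ terms N g := ⟨j, j.2.1, j.2.2, rfl⟩
    rw [hpos j, weight, if_pos this, one_smul]
  · intro k hk
    have hk' : k + 1 ∈ terms N g := by
      by_contra hn
      exact hk (by simp only [weight, if_neg hn, zero_smul])
    obtain ⟨j, hj, hjN, hg⟩ := hk'
    exact ⟨⟨j, hj, hjN⟩, by simp [hg]⟩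

theorem hasProd_restMult (h : IsIncreasingSeq N g) : HasProd
    (fun i : ℕ => 1 + ∑' j : {j : ℕ // 1 ≤ j ∧ (j : ℕ∞) ≤ N},
      (PowerSeries.X : PowerSeries ℕ) ^ ((i + 1) * g j))
    (PowerSeries.mk fun n => restMult (terms N g) n) := by
  rw [restMult_eq_mk]
  simp only [tsum_terms h]
  exact Nat.Partition.hasProd_genFun (weight (terms N g))

theorem coeff_factor (A : Set ℕ) (i m n : ℕ) (hm : m ≤ n) :
    (1 + ∑' k, weight A (i + 1) (k + 1) • (PowerSeries.X : PowerSeries ℕ) ^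
      ((i + 1) * (k + 1))).coeff m =
    (1 + ∑ k ∈ Finset.range n, weight A (i + 1) (k + 1) • (PowerSeries.X : PowerSeries ℕ) ^
      ((i + 1) * (k + 1))).coeff m := by
  have h1 := (Nat.Partition.summable_genFun_term (weight A) i).map_tsum (PowerSeries.coeff m)
    (PowerSeries.WithPiTopology.continuous_coeff ℕ m)
  rw [map_add, map_add, map_sum]
  refine congrArg _ (h1.trans (tsum_eq_sum fun k hk => ?_))
  rw [Finset.mem_range, not_lt] at hk
  have : m ≠ (i + 1) * (k + 1) := by nlinarith [Nat.zero_le (i * (k + 1))]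
  rw [map_smul, PowerSeries.coeff_X_pow, if_neg this, smul_zero]

theorem coeff_factor_of_le (A : Set ℕ) (i m n : ℕ) (hm : m ≤ n) (hi : n ≤ i) :
    (1 + ∑' k, weight A (i + 1) (k + 1) • (PowerSeries.X : PowerSeries ℕ) ^
      ((i + 1) * (k + 1))).coeff m = (1 : PowerSeries ℕ).coeff m := by
  rw [coeff_factor A i m n hm, map_add, map_sum, Finset.sum_eq_zero, add_zero]
  intro k _
  have : m ≠ (i + 1) * (k + 1) := by nlinarith [Nat.zero_le (i * k)]
  rw [map_nsmul, PowerSeries.coeff_X_pow, if_neg this, smul_zero]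

/-- Two power series agree up to degree `n`. -/
def AgreeUpTo (n : ℕ) (p q : PowerSeries ℕ) : Prop := ∀ m ≤ n, p.coeff m = q.coeff m

theorem AgreeUpTo.mul {n : ℕ} {p q p' q' : PowerSeries ℕ} (h : AgreeUpTo n p q)
    (h' : AgreeUpTo n p' q') : AgreeUpTo n (p * p') (q * q') := by
  intro m hm
  rw [PowerSeries.coeff_mul, PowerSeries.coeff_mul]
  refine Finset.sum_congr rfl fun x hx => ?_
  have := Finset.HasAntidiagonal.mem_antidiagonal.1 hx
  rw [h _ (by omega), h' _ (by omega)]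

theorem AgreeUpTo.prod {ι : Type*} {n : ℕ} {s : Finset ι} {p q : ι → PowerSeries ℕ}
    (h : ∀ i ∈ s, AgreeUpTo n (p i) (q i)) : AgreeUpTo n (∏ i ∈ s, p i) (∏ i ∈ s, q i) := by
  classical
  induction s using Finset.induction_on with
  | empty => exact fun _ _ => rfl
  | insert a s ha ih =>
    rw [Finset.prod_insert ha, Finset.prod_insert ha]
    exact (h a (by simp)).mul (ih fun i hi => h i (by simp [hi]))

theorem restMult_eq_coeff (A : Set ℕ) (n : ℕ) : restMult A n =
    (∏ i ∈ Finset.range n, (1 + ∑ k ∈ Finset.range n, weight A (i + 1) (k + 1) •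
      (PowerSeries.X : PowerSeries ℕ) ^ ((i + 1) * (k + 1)))).coeff n := by
  have h1 := Nat.Partition.hasProd_genFun (weight A)
  rw [HasProd, PowerSeries.WithPiTopology.tendsto_iff_coeff_tendsto] at h1
  have h2 := h1 n
  -- Coefficients live in the discrete space `ℕ`, so convergence means that the coefficient is
  -- eventually constant: some finite partial product containing the first `n` factors already has
  -- the right one.
  rw [SummationFilter.unconditional_filter, nhds_discrete, Filter.tendsto_pure] at h2
  obtain ⟨s, hs, hn⟩ := (h2.and (Filter.eventually_ge_atTop (Finset.range n))).exists
  rw [← coeff_genFun_weight, ← hs, ← Finset.prod_sdiff hn]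
  have h3 : AgreeUpTo n _ (∏ _i ∈ s \ Finset.range n, 1) :=
    AgreeUpTo.prod fun i hi m hm => coeff_factor_of_le A i m n hm (by simpa using
      (Finset.mem_sdiff.1 hi).2)
  rw [Finset.prod_const_one] at h3
  refine (h3.mul (AgreeUpTo.prod fun i _ m hm => coeff_factor A i m n hm) n le_rfl).trans ?_
  rw [one_mul]

/-! ### Evaluation of the truncated product at a power of two -/

open Classical in
/-- The terms of a sequence of length `N`, followed by zeros. -/
noncomputable def padded (N : ℕ∞) (g : ℕ → ℕ) (j : ℕ) : ℕ := if (j : ℕ∞) ≤ N then g j else 0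

/-- Passing from indices of terms to their values loses nothing: a term with value at most `n` has
index at most `n`, because `j ≤ g j`. -/
theorem sum_padded {M : Type*} [AddCommMonoid M] (h : IsIncreasingSeq N g) (n : ℕ) (F : ℕ → M) :
    ∑ j ∈ Finset.range n, (if padded N g (j + 1) ≤ n ∧ padded N g (j + 1) ≠ 0 then
      F (padded N g (j + 1)) else 0) =
    ∑ k ∈ Finset.range n, weight (terms N g) 0 (k + 1) • F (k + 1) := by
  classical
  simp only [weight, ite_smul, one_smul, zero_smul]
  rw [← Finset.sum_filter, ← Finset.sum_filter]
  have key : ∀ j, padded N g (j + 1) ≠ 0 → ((j + 1 : ℕ) : ℕ∞) ≤ N ∧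
      padded N g (j + 1) = g (j + 1) := by
    intro j hj
    by_cases hN : ((j + 1 : ℕ) : ℕ∞) ≤ N
    · exact ⟨hN, if_pos hN⟩
    · exact absurd (if_neg hN) hj
  refine Finset.sum_bij (fun j _ => padded N g (j + 1) - 1) ?_ ?_ ?_ ?_
  · intro j hj
    rw [Finset.mem_filter, Finset.mem_range] at hj
    obtain ⟨hN, he⟩ := key j hj.2.2
    have : padded N g (j + 1) - 1 + 1 = padded N g (j + 1) := by omega
    rw [Finset.mem_filter, Finset.mem_range, this]
    exact ⟨by omega, j + 1, by omega, hN, he.symm⟩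
  · intro j hj j' hj' hjj
    rw [Finset.mem_filter, Finset.mem_range] at hj hj'
    obtain ⟨hN, he⟩ := key j hj.2.2
    obtain ⟨hN', he'⟩ := key j' hj'.2.2
    have := h.injOn (by omega) hN (by omega) hN' (by omega)
    omega
  · intro k hk
    rw [Finset.mem_filter, Finset.mem_range] at hk
    obtain ⟨hk, j, hj, hjN, hg⟩ := hk
    have h1 := h.le_apply hj hjN
    have h2 : padded N g (j - 1 + 1) = k + 1 := by
      rw [Nat.sub_add_cancel hj, padded, if_pos hjN, hg]
    refine ⟨j - 1, ?_, by rw [h2]; omega⟩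
    rw [Finset.mem_filter, Finset.mem_range, h2]
    omega
  · intro j hj
    rw [Finset.mem_filter, Finset.mem_range] at hj
    rw [Nat.sub_add_cancel (by omega)]

/-- The truncated product of the generating function as a polynomial. -/
noncomputable def productPoly (G : ℕ → ℕ) (n : ℕ) : Polynomial ℕ := ∏ i ∈ Finset.range n,
  (1 + ∑ j ∈ Finset.range n, if G (j + 1) ≤ n ∧ G (j + 1) ≠ 0 then
    Polynomial.X ^ (G (j + 1) * (i + 1)) else 0)

theorem coeff_productPoly (h : IsIncreasingSeq N g) (n : ℕ) :
    (productPoly (padded N g) n).coeff n = restMult (terms N g) n := by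
  rw [restMult_eq_coeff, ← Polynomial.coeff_coe, productPoly,
    ← Polynomial.coeToPowerSeries.ringHom_apply, map_prod]
  refine congrArg _ (Finset.prod_congr rfl fun i _ => ?_)
  rw [sum_padded h n fun k => (Polynomial.X : Polynomial ℕ) ^ (k * (i + 1)), map_add, map_one,
    map_sum]
  refine congrArg _ (Finset.sum_congr rfl fun k _ => ?_)
  rw [map_nsmul, map_pow, Polynomial.coeToPowerSeries.ringHom_apply, Polynomial.coe_X, mul_comm]
  rfl

theorem eval_productPoly (G : ℕ → ℕ) (n W : ℕ) :
    (productPoly G n).eval (2 ^ W) = kronecker G n W := by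
  rw [productPoly, kronecker, Polynomial.eval_prod]
  refine Finset.prod_congr rfl fun i _ => ?_
  rw [Polynomial.eval_add, Polynomial.eval_one, Polynomial.eval_finsetSum]
  refine congrArg _ (Finset.sum_congr rfl fun j _ => ?_)
  rw [summand]
  split_ifs
  · rw [Polynomial.eval_pow, Polynomial.eval_X, ← pow_mul]
    congr 1
    ring
  · exact Polynomial.eval_zero

theorem coeff_le_eval_one (p : Polynomial ℕ) (m : ℕ) : p.coeff m ≤ p.eval 1 := by
  rw [Polynomial.eval_eq_sum, Polynomial.sum]
  simp only [one_pow, mul_one]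
  by_cases hm : m ∈ p.support
  · exact Finset.single_le_sum (f := fun i => p.coeff i) (fun _ _ => Nat.zero_le _) hm
  · rw [Polynomial.notMem_support_iff.1 hm]
    exact Nat.zero_le _

/-- At `1` each of the `n` factors is at most `n + 1`, and `(n + 1) ^ n ≤ 2 ^ ((n + 1) n)`. Since
all coefficients are natural numbers, this value bounds each of them. -/
theorem eval_one_productPoly_lt (G : ℕ → ℕ) (n : ℕ) :
    (productPoly G n).eval 1 < 2 ^ ((n + 1) * (n + 1)) := by
  calc (productPoly G n).eval 1 ≤ ∏ _i ∈ Finset.range n, (n + 1) := by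
        rw [productPoly, Polynomial.eval_prod]
        refine Finset.prod_le_prod' fun i _ => ?_
        rw [Polynomial.eval_add, Polynomial.eval_one, Polynomial.eval_finsetSum, add_comm]
        refine Nat.add_le_add_right (le_trans (Finset.sum_le_sum (g := fun _ => 1) fun j _ => ?_)
          (by simp)) 1
        split_ifs <;> simp
    _ = (n + 1) ^ n := by simp
    _ ≤ (2 ^ (n + 1)) ^ n := Nat.pow_le_pow_left Nat.lt_two_pow_self.le n
    _ < 2 ^ ((n + 1) * (n + 1)) := by
        rw [← pow_mul]
        exact Nat.pow_lt_pow_right (by omega) (by nlinarith)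

/-- Coefficients below `B` are the base-`B` digits of the value at `B`; dividing by `B` corresponds
to `divX`. -/
theorem digit_eval {B : ℕ} (p : Polynomial ℕ) (hp : ∀ m, p.coeff m < B) (n : ℕ) :
    p.eval B / B ^ n % B = p.coeff n := by
  have hB : 0 < B := (Nat.zero_le _).trans_lt (hp 0)
  have h0 : ∀ p : Polynomial ℕ, p.eval B = B * p.divX.eval B + p.coeff 0 := fun p => by
    conv_lhs => rw [← Polynomial.divX_mul_X_add p]
    simp [mul_comm]
  induction n generalizing p with
  | zero => rw [pow_zero, Nat.div_one, h0 p, Nat.mul_add_mod, Nat.mod_eq_of_lt (hp 0)]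
  | succ n ih =>
    rw [pow_succ', ← Nat.div_div_eq_div_mul, h0 p, Nat.mul_add_div hB,
      Nat.div_eq_of_lt (hp 0), add_zero, ih _ fun m => by
        rw [Polynomial.coeff_divX]; exact hp _, Polynomial.coeff_divX]

theorem kronecker_digit (h : IsIncreasingSeq N g) (n : ℕ) :
    kronecker (padded N g) n ((n + 1) * (n + 1)) / 2 ^ (n * ((n + 1) * (n + 1))) %
      2 ^ ((n + 1) * (n + 1)) = restMult (terms N g) n := by
  rw [← coeff_productPoly h, ← eval_productPoly, Nat.mul_comm n, pow_mul 2 _ n]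
  exact digit_eval _ (fun m => (coeff_le_eval_one _ m).trans_lt (eval_one_productPoly_lt _ n)) n

theorem restMult_eq_zero {A : Set ℕ} {d n : ℕ} (hd : IsGcd A d) (hn : ¬ d ∣ n) :
    restMult A n = 0 := by
  classical
  rw [restMult, Finset.card_eq_zero, Finset.filter_eq_empty_iff]
  intro p _ hp
  refine hn ?_
  rw [← p.parts_sum, Finset.sum_multiset_count]
  exact Finset.dvd_sum fun i hi => (((hd d).1 dvd_rfl) _
      (hp i (Multiset.mem_toFinset.1 hi))).mul_right _

/-! ### A lower bound for the counting function -/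

/-- The parts are positive and their multiplicities lie in `A`. -/
def Admissible (A : Set ℕ) (P : Multiset ℕ) : Prop := ∀ i ∈ P, 0 < i ∧ P.count i ∈ A

variable {A : Set ℕ}

theorem Admissible.map_add {P : Multiset ℕ} (h : Admissible A P) (t : ℕ) :
    Admissible A (P.map (· + t)) := by
  intro i hi
  obtain ⟨j, hj, rfl⟩ := Multiset.mem_map.1 hi
  rw [Multiset.count_map_eq_count' _ _ (add_left_injective t)]
  exact ⟨by have := (h j hj).1; omega, (h j hj).2⟩

theorem Admissible.add {P Q : Multiset ℕ} (hP : Admissible A P) (hQ : Admissible A Q)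
    (h : ∀ i ∈ P, i ∉ Q) : Admissible A (P + Q) := by
  intro i hi
  rw [Multiset.count_add]
  rcases Multiset.mem_add.1 hi with h1 | h1
  · rw [Multiset.count_eq_zero.2 (h i h1), add_zero]
    exact hP i h1
  · rw [Multiset.count_eq_zero.2 fun h2 => h i h2 h1, zero_add]
    exact hQ i h1

theorem admissible_nsmul {a : ℕ} (ha : a ∈ A) {V : Finset ℕ} (hV : ∀ i ∈ V, 0 < i) :
    Admissible A (a • V.val) := by
  intro i hi
  have hi' : i ∈ V := Multiset.mem_of_mem_nsmul hi
  refine ⟨hV i hi', ?_⟩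
  rw [Multiset.count_nsmul, Multiset.count_eq_one_of_mem V.nodup hi', mul_one]
  exact ha

theorem le_sum_of_mem {P : Multiset ℕ} {i : ℕ} (h : i ∈ P) : i ≤ P.sum :=
  Multiset.single_le_sum (fun _ _ => Nat.zero_le _) i h

/-- The residues modulo `a` of the sums of admissible multisets. -/
def residues (A : Set ℕ) {a : ℕ} (ha : 1 ≤ a) : AddSubgroup ℤ :=
  let H : AddSubmonoid ℤ :=
    { carrier := {z | ∃ P, Admissible A P ∧ (P.sum : ℤ) ≡ z [ZMOD a]}
      zero_mem' := ⟨0, fun i hi => absurd hi (Multiset.notMem_zero i), by simp⟩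
      add_mem' := by
        rintro y z ⟨P, hP, hy⟩ ⟨Q, hQ, hz⟩
        -- Shifting the parts of `Q` by `a * P.sum` preserves its sum modulo `a` and makes them
        -- larger than every part of `P`, so that no multiplicities are merged.
        refine ⟨P + Q.map (· + a * P.sum), hP.add (hQ.map_add _) ?_, ?_⟩
        · intro i hi hi'
          obtain ⟨j, hj, rfl⟩ := Multiset.mem_map.1 hi'
          have h1 := le_sum_of_mem hi
          have h2 := (hQ j hj).1
          have h3 := Nat.le_mul_of_pos_left P.sum ha
          omega
        · rw [Multiset.sum_add, Multiset.sum_map_add, Multiset.map_id', Multiset.map_const',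
            Multiset.sum_replicate]
          rw [Nat.cast_add, Nat.cast_add]
          refine hy.add ?_
          rw [← add_zero z]
          refine hz.add ?_
          rw [Int.modEq_zero_iff_dvd, smul_eq_mul, Int.natCast_dvd_natCast]
          exact (dvd_mul_right a P.sum).mul_left Q.card }
  { H with
    neg_mem' := by
      intro z hz
      -- Modulo `a`, the multiple `(a - 1) z` is `-z`; so the submonoid is a group.
      have h1 : (a - 1) • z ∈ H := H.nsmul_mem hz (a - 1)
      obtain ⟨P, hP, h2⟩ := h1
      refine ⟨P, hP, h2.trans ?_⟩
      rw [Int.modEq_iff_dvd, nsmul_eq_mul, Nat.cast_sub ha]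
      exact ⟨-z, by push_cast; ring⟩ }

theorem mem_residues {a : ℕ} {ha : 1 ≤ a} {z : ℤ} :
    z ∈ residues A ha ↔ ∃ P, Admissible A P ∧ (P.sum : ℤ) ≡ z [ZMOD a] := Iff.rfl

/-- The group of residues is cyclic and contains every `b ∈ A`, as the sum of `b` ones. Its
generator therefore divides `d`, so the group contains all multiples of `d`. -/
theorem exists_admissible_modEq {d : ℕ} (hd : IsGcd A d) {a : ℕ} (ha : 1 ≤ a) {n : ℕ}
    (hn : d ∣ n) : ∃ P, Admissible A P ∧ P.sum ≡ n [MOD a] := by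
  obtain ⟨e, he⟩ := Int.subgroup_cyclic (residues A ha)
  rw [← AddSubgroup.zmultiples_eq_closure] at he
  have h1 : e.natAbs ∣ d := by
    refine (hd _).2 fun b hb => ?_
    have h2 : (b : ℤ) ∈ residues A ha := by
      refine mem_residues.2 ⟨Multiset.replicate b 1, fun i hi => ?_, by simp⟩
      obtain ⟨_, rfl⟩ := Multiset.mem_replicate.1 hi
      rw [Multiset.count_replicate_self]
      exact ⟨one_pos, hb⟩
    rw [he, Int.mem_zmultiples_iff] at h2
    exact Int.natAbs_dvd_natAbs.2 h2
  have h3 : (n : ℤ) ∈ residues A ha := by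
    rw [he, Int.mem_zmultiples_iff]
    exact Int.natAbs_dvd.1 (Int.natCast_dvd_natCast.2 (h1.trans hn))
  obtain ⟨P, hP, h⟩ := mem_residues.1 h3
  exact ⟨P, hP, (Int.natCast_modEq_iff).1 h⟩

/-- One multiset for each residue modulo `a` suffices. As `d ∣ a`, the residue of a multiple of `d`
is again a multiple of `d`. -/
theorem exists_admissible_bounded {d : ℕ} (hd : IsGcd A d) {a : ℕ} (ha : 1 ≤ a) (haA : a ∈ A) :
    ∃ L, ∀ n, d ∣ n → ∃ P, Admissible A P ∧ P.sum ≡ n [MOD a] ∧ P.sum ≤ L := by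
  have h1 : ∀ r : ℕ, ∃ P, d ∣ r → Admissible A P ∧ P.sum ≡ r [MOD a] := fun r => by
    by_cases hr : d ∣ r
    · obtain ⟨P, hP⟩ := exists_admissible_modEq hd ha hr
      exact ⟨P, fun _ => hP⟩
    · exact ⟨0, fun h => absurd h hr⟩
  choose P hP using h1
  refine ⟨∑ r ∈ Finset.range a, (P r).sum, fun n hn => ⟨P (n % a), ?_⟩⟩
  obtain ⟨h2, h3⟩ := hP (n % a) ((Nat.dvd_mod_iff ((hd d).1 dvd_rfl a haA)).2 hn)
  exact ⟨h2, h3.trans (Nat.mod_modEq n a), Finset.single_le_sum (f := fun r => (P r).sum)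
    (fun _ _ => Nat.zero_le _) (Finset.mem_range.2 (Nat.mod_lt _ ha))⟩

theorem exists_pow_le_restMult {d : ℕ} (hd : IsGcd A d) {a : ℕ} (ha : 1 ≤ a) (haA : a ∈ A) :
    ∃ C, 1 ≤ C ∧ ∀ n s, d ∣ n → C * (s + 1) ^ 2 ≤ n → 2 ^ s ≤ restMult A n := by
  classical
  obtain ⟨L, hL⟩ := exists_admissible_bounded hd ha haA
  -- The summand `L` pays for `P`, and `a * (L + 2)` leaves `m ≥ (s + 1) ^ 2 (L + 2)`, enough for
  -- the `s` medium parts and a still larger filling part.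
  refine ⟨L + a * (L + 2), by nlinarith, fun n s hn hs => ?_⟩
  obtain ⟨P, hP, hmod, hPL⟩ := hL n hn
  have hPn : P.sum ≤ n := by
    have h1 := Nat.le_mul_of_pos_right (L + a * (L + 2)) (by positivity : 0 < (s + 1) ^ 2)
    omega
  obtain ⟨m, hm⟩ := (Nat.modEq_iff_dvd' hPn).1 hmod
  have hm' : (s + 1) ^ 2 * (L + 2) ≤ m := by
    refine Nat.le_of_mul_le_mul_left ?_ ha
    nlinarith [Nat.sub_add_cancel hPn, Nat.zero_le (L * (s * s + 2 * s))]
  have hm'' : s * (s + L) + (s + L) < m := by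
    nlinarith [Nat.zero_le (s * s * L), Nat.zero_le (s * L), Nat.zero_le (s * s)]
  have hsub : ∀ U ∈ (Finset.range s).powerset, ∑ u ∈ U, (u + (L + 1)) ≤ s * (s + L) := by
    intro U hU
    rw [Finset.mem_powerset] at hU
    calc ∑ u ∈ U, (u + (L + 1)) ≤ ∑ u ∈ Finset.range s, (u + (L + 1)) :=
          Finset.sum_le_sum_of_subset hU
      _ ≤ ∑ _u ∈ Finset.range s, (s + L) := Finset.sum_le_sum fun u hu => by
          have := Finset.mem_range.1 hu; omega
      _ = s * (s + L) := by simp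
  rw [restMult, ← Finset.card_range s, ← Finset.card_powerset]
  -- A partition is mapped to the set of `u < s` for which `u + (L + 1)` is a part; every subset `U`
  -- is shown to be attained.
  refine Finset.card_le_card_of_surjOn
    (fun p => (Finset.range s).filter fun u => u + (L + 1) ∈ p.parts) ?_
  intro U hU
  have hU' := hsub U hU
  have hUs : U ⊆ Finset.range s := Finset.mem_powerset.1 hU
  set b := m - ∑ u ∈ U, (u + (L + 1)) with hb
  have hbm : b + ∑ u ∈ U, (u + (L + 1)) = m := by
    rw [hb]
    exact Nat.sub_add_cancel (by omega)
  -- The filling part exceeds all candidates `u + (L + 1)`, so it neither collides with a chosen one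
  -- nor is mistaken for one when `U` is read off. The parts of `P` are at most `L`, below all
  -- candidates.
  have hbig : s + L < b := by omega
  set V := insert b (U.image (· + (L + 1))) with hV
  have hbU : b ∉ U.image (· + (L + 1)) := by
    intro h
    obtain ⟨u, hu, h⟩ := Finset.mem_image.1 h
    have := Finset.mem_range.1 (hUs hu)
    omega
  have hVL : ∀ i ∈ V, L < i := by
    intro i hi
    rcases Finset.mem_insert.1 hi with rfl | hi
    · omega
    · obtain ⟨u, hu, rfl⟩ := Finset.mem_image.1 hi
      omega
  have hVsum : V.val.sum = m := by
    have : V.val.sum = ∑ i ∈ V, i := by rw [Finset.sum, Multiset.map_id']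
    rw [this, hV, Finset.sum_insert hbU, Finset.sum_image fun _ _ _ _ h => by simpa using h, hbm]
  have hQ : Admissible A (P + a • V.val) := by
    refine hP.add (admissible_nsmul haA fun i hi => (Nat.zero_le _).trans_lt (hVL i hi)) ?_
    intro i hi hi'
    have h1 := hVL i (Multiset.mem_of_mem_nsmul hi')
    have h2 := le_sum_of_mem hi
    omega
  refine ⟨⟨P + a • V.val, fun {i} hi => (hQ i hi).1, ?_⟩, ?_, ?_⟩
  · rw [Multiset.sum_add, Multiset.sum_nsmul, hVsum, smul_eq_mul]
    omega
  · rw [Finset.mem_coe, Finset.mem_filter]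
    exact ⟨Finset.mem_univ _, fun i hi => (hQ i hi).2⟩
  · ext u
    rw [Finset.mem_filter, Multiset.mem_add, Multiset.mem_nsmul_of_ne_zero (by omega),
      Finset.mem_val, hV, Finset.mem_insert, Finset.mem_image, Finset.mem_range]
    constructor
    · rintro ⟨hu, h1 | h1 | ⟨v, hv, h1⟩⟩
      · have := le_sum_of_mem h1; omega
      · omega
      · obtain rfl : v = u := by omega
        exact hv
    · exact fun hu => ⟨Finset.mem_range.1 (hUs hu), Or.inr (Or.inr ⟨u, hu, rfl⟩)⟩

/-! ### The complexity bounds the input from below -/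

theorem one_le_complexity (f : ℕ → ℤ) {n : ℕ} (hn : 1 ≤ n) : 1 ≤ complexity f n := by
  have h1 : Real.log 2 ≤ Real.log (1 + (n : ℝ)) :=
    Real.log_le_log (by norm_num) (by have : (1 : ℝ) ≤ n := by exact_mod_cast hn
                                      linarith)
  have h2 : Real.log 2 ≤ Real.log (2 + |(f n : ℝ)|) :=
    Real.log_le_log (by norm_num) (by linarith [abs_nonneg (f n : ℝ)])
  have := Real.log_two_gt_d9
  rw [complexity]
  linarith

/-- From `k log 2 ≤ m` and `1 ≤ m` one gets `k + 1 ≤ (1 / log 2 + 1) m`, and `1 / log 2 < 2`. -/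
theorem succ_le_of_pow_le {k : ℕ} {x m : ℝ} (hk : (2 : ℝ) ^ k ≤ x) (hx : Real.log x ≤ m)
    (hm : 1 ≤ m) : (k : ℝ) + 1 ≤ 3 * m := by
  have h1 := Real.log_le_log (by positivity) hk
  rw [Real.log_pow] at h1
  have := Real.log_two_gt_d9
  nlinarith [(Nat.cast_nonneg k : (0 : ℝ) ≤ k)]

theorem log_le_complexity (f : ℕ → ℤ) (n : ℕ) : Real.log (1 + (n : ℝ)) ≤ complexity f n ∧
    Real.log (2 + |(f n : ℝ)|) ≤ complexity f n := by
  have h1 : 0 ≤ Real.log (1 + (n : ℝ)) :=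
    Real.log_nonneg (by linarith [(Nat.cast_nonneg n : (0 : ℝ) ≤ n)])
  have h2 : 0 ≤ Real.log (2 + |(f n : ℝ)|) :=
    Real.log_nonneg (by linarith [abs_nonneg (f n : ℝ)])
  rw [complexity]
  exact ⟨by linarith, by linarith⟩

theorem size_le_complexity (f : ℕ → ℤ) {n : ℕ} (hn : 1 ≤ n) :
    (n.size : ℝ) ≤ 3 * complexity f n := by
  obtain ⟨k, hk⟩ : ∃ k, n.size = k + 1 :=
    ⟨n.size - 1, by have := Nat.size_pos.2 hn; omega⟩
  have h1 : 2 ^ k ≤ n := Nat.lt_size.1 (by omega)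
  rw [hk]
  push_cast
  refine succ_le_of_pow_le (x := 1 + n) ?_ (log_le_complexity f n).1 (one_le_complexity f hn)
  have : (2 : ℝ) ^ k ≤ n := by exact_mod_cast h1
  linarith

theorem exists_le_complexity_sq {A : Set ℕ} {d : ℕ} (hd : IsGcd A d) {a : ℕ} (ha : 1 ≤ a)
    (haA : a ∈ A) : ∃ C : ℕ, ∀ n, 1 ≤ n → d ∣ n →
      (n : ℝ) ≤ C * complexity (fun n => (restMult A n : ℤ)) n ^ 2 := by
  obtain ⟨C, hC, h⟩ := exists_pow_le_restMult hd ha haA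
  -- The integer square root `q` of `n / C` is at most `3 m`, by the lower bound with `s + 1 = q`.
  -- Thus `n ≤ C (q + 1) ^ 2 ≤ C (4 m) ^ 2`.
  refine ⟨C * 16, fun n hn hdn => ?_⟩
  set m := complexity (fun n => (restMult A n : ℤ)) n with hm
  have hm1 : 1 ≤ m := one_le_complexity _ hn
  have hq : ((n / C).sqrt : ℝ) ≤ 3 * m := by
    rcases Nat.eq_zero_or_pos (n / C).sqrt with h0 | h0
    · rw [h0, Nat.cast_zero]
      linarith
    · obtain ⟨s, hs⟩ : ∃ s, (n / C).sqrt = s + 1 := ⟨(n / C).sqrt - 1, by omega⟩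
      have h1 : C * (s + 1) ^ 2 ≤ n := by
        rw [← hs]
        exact (Nat.mul_le_mul_left C (Nat.sqrt_le' _)).trans (Nat.mul_div_le n C)
      have h2 := h n s hdn h1
      rw [hs]
      push_cast
      refine succ_le_of_pow_le ?_ (log_le_complexity (fun n => (restMult A n : ℤ)) n).2 hm1
      have : (2 : ℝ) ^ s ≤ restMult A n := by exact_mod_cast h2
      have h3 := le_abs_self ((restMult A n : ℤ) : ℝ)
      push_cast at h3 ⊢
      linarith
  have h1 : n ≤ C * ((n / C).sqrt + 1) ^ 2 :=
    ((Nat.div_lt_iff_lt_mul hC).1 (Nat.lt_succ_sqrt' (n / C))).le.trans_eq (Nat.mul_comm _ _)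
  have h2 : (n : ℝ) ≤ C * (((n / C).sqrt : ℝ) + 1) ^ 2 := by exact_mod_cast h1
  have h3 : (((n / C).sqrt : ℝ) + 1) ^ 2 ≤ (4 * m) ^ 2 :=
    pow_le_pow_left₀ (by positivity) (by linarith) 2
  calc (n : ℝ) ≤ C * (4 * m) ^ 2 := h2.trans (mul_le_mul_of_nonneg_left h3 (Nat.cast_nonneg C))
    _ = _ := by push_cast; ring

/-! ### The PIO algorithm -/

/-- Compute the input modulo `d`; if it is `0`, compute the counting function. In both cases, put
the sign bit in front of the result. -/
def pioProg : Cmd :=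
  .seq modProg (.ite 4 0
    (.seq mainProg (.seq (.act 1 (none, some .left)) (.act 1 (some 1, none))))
    (.act 1 (some 1, none)))

/-- The contents of the tapes for the input `n`. -/
def inputTapes (n : ℕ) : Tapes := tapesOf (st [n, 0, 0, 0, 0, 0, 0, 0, 0, 0, 0, 0, 0, 0])

theorem init_encodeNat (n : ℕ) :
    Machine.init (Computability.encodeNat n) = ⟨0, inputTapes n⟩ := by
  unfold Machine.init inputTapes
  congr 1
  funext t
  by_cases h0 : t = 0
  · subst h0; rfl
  · rw [if_neg h0]
    have : st [n, 0, 0, 0, 0, 0, 0, 0, 0, 0, 0, 0, 0, 0] t = 0 := by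
      by_cases h : t < 14
      · interval_cases t
        · exact absurd rfl h0
        all_goals rfl
      · exact st_eq_zero rfl (by omega)
    rw [tapesOf, this]
    rfl

/-- The leading symbol `1` is the sign bit `false`, as the value is a natural number. -/
theorem Runs.computesWithin {p : Cmd} {n x k : ℕ} {T : Tapes}
    (h : Runs P p (inputTapes n) k T) (hT : T 1 = zip [] (1 :: digits x)) {s : ℝ}
    (hs : (k : ℝ) ≤ s) :
    Machine.ComputesWithin (p.code P 0) (Computability.encodeNat n) (encodeInt (x : ℤ)) s := by
  obtain ⟨l, hl, h⟩ := h
  refine ⟨l, (Nat.cast_le.2 hl).trans hs, ⟨0 + p.size P, T⟩, ?_, ?_, ?_⟩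
  · rw [init_encodeNat]
    exact h.steps _ _ fun _ _ _ => rfl
  · refine step_eq_none fun r hr => ?_
    have := Cmd.code_state hr
    simp only
    omega
  · simp only [hT, zip, Turing.Tape.mk'_right₀]
    congr 1

theorem runs_pioProg_of_not_dvd (hd : 1 ≤ P.2) {n : ℕ} (hn : ¬ P.2 ∣ n) :
    ∃ T, Runs P pioProg (inputTapes n) ((n.size * (4 * P.2 + 21) + 5) *
      (60 * (n.size + (n.size * (4 * P.2 + 21) + 5) + 1)) + 3) T ∧
      T 1 = zip [] (1 :: digits 0) := by
  obtain ⟨-, h1⟩ := sem_modProg (D := 0) n hd n.size (Nat.zero_le _) fun t => by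
    by_cases h : t < 14
    · interval_cases t <;> simp [st]
    · rw [st_eq_zero rfl (by omega)]; simp
  have h2 := Runs.act' (P := P) (t := 1) (T := tapesOf (st
    [n, 0, 0, 0, n % P.2, 0, 0, 0, 0, 0, 0, 0, 0, 0])) (S := zip [] []) rfl (zip_write_nil [] 1)
  refine ⟨_, h1.seq (Runs.ite_neg _ ?_ h2), by simp [digits_zero]⟩
  change (num (n % P.2)).head ≠ 0
  rw [Ne, head_num_eq_zero]
  exact fun h => hn (Nat.dvd_of_mod_eq_zero h)

theorem runs_pioProg_of_dvd (hd : 1 ≤ P.2) {n D : ℕ} (hn : P.2 ∣ n) {G : ℕ → ℕ}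
    (hG : ∀ j, 1 ≤ j → j ≤ n → ∃ k : ℕ, Machine.ComputesWithin P.1 (Computability.encodeNat j)
      (Computability.encodeNat (G j)) k ∧ j.size + k + 1 ≤ D) (hnD : n.size ≤ D) :
    ∃ T, Runs P pioProg (inputTapes n) ((n.size * (4 * P.2 + 21) + 5) *
      (60 * (D + (n.size * (4 * P.2 + 21) + 5) + 1)) + (mainCost n *
      (60 * (D + (n.size * (4 * P.2 + 21) + 5) + mainCost n + 1)) + 4)) T ∧
      T 1 = zip [] (1 :: digits (kronecker G n ((n + 1) * (n + 1)) /
        2 ^ (n * ((n + 1) * (n + 1))) % 2 ^ ((n + 1) * (n + 1)))) := by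
  obtain ⟨h0, h1⟩ := sem_modProg (D := D) n hd D le_rfl fun t => by
    by_cases h : t < 14
    · interval_cases t <;> simp [st, hnD]
    · rw [st_eq_zero rfl (by omega)]; simp
  rw [Nat.mod_eq_zero_of_dvd hn] at h0 h1
  obtain ⟨L, h2⟩ := sem_mainProg hG
  obtain ⟨-, h3⟩ := h2 (D + (n.size * (4 * P.2 + 21) + 5)) (by omega) h0
  have h4 := Runs.act' (P := P) (t := 1) (T := tapesOf (st (n :: (kronecker G n
    ((n + 1) * (n + 1)) / 2 ^ (n * ((n + 1) * (n + 1))) % 2 ^ ((n + 1) * (n + 1))) :: L)))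
    rfl (zip_left_nil _)
  have h5 := h4.seq (Runs.act' (t := 1) (Function.update_self _ _ _) (zip_write [] _ 0 1))
  exact ⟨_, h1.seq (Runs.ite_pos _ rfl (h3.seq h5)), Function.update_self _ _ _⟩

/-! ### Polynomial bounds -/

/-- The function is bounded by a polynomial. -/
def PolyBounded (F : ℕ → ℕ) : Prop := ∃ c e : ℕ, ∀ n, F n ≤ c * (n + 1) ^ e

theorem PolyBounded.const (k : ℕ) : PolyBounded fun _ => k := ⟨k, 0, fun n => by simp⟩

theorem PolyBounded.id : PolyBounded fun n => n := ⟨1, 1, fun n => by simp⟩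

theorem PolyBounded.add {F G : ℕ → ℕ} (hF : PolyBounded F) (hG : PolyBounded G) :
    PolyBounded fun n => F n + G n := by
  obtain ⟨c, e, h⟩ := hF
  obtain ⟨c', e', h'⟩ := hG
  refine ⟨c + c', e + e', fun n => (Nat.add_le_add (h n) (h' n)).trans ?_⟩
  rw [Nat.add_mul]
  gcongr <;> omega

theorem PolyBounded.mul {F G : ℕ → ℕ} (hF : PolyBounded F) (hG : PolyBounded G) :
    PolyBounded fun n => F n * G n := by
  obtain ⟨c, e, h⟩ := hF
  obtain ⟨c', e', h'⟩ := hG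
  refine ⟨c * c', e + e', fun n => (Nat.mul_le_mul (h n) (h' n)).trans_eq ?_⟩
  ring

theorem PolyBounded.mono {F G : ℕ → ℕ} (hF : PolyBounded F) (h : ∀ n, G n ≤ F n) :
    PolyBounded G :=
  let ⟨c, e, h'⟩ := hF
  ⟨c, e, fun n => (h n).trans (h' n)⟩

theorem size_le_self (n : ℕ) : n.size ≤ n := Nat.size_le.2 Nat.lt_two_pow_self

theorem polyBounded_size : PolyBounded Nat.size := PolyBounded.id.mono size_le_self

theorem polyBounded_mainCost : PolyBounded mainCost := by
  unfold mainCost factorCost termCost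
  repeat' first
    | with_reducible exact PolyBounded.const _
    | with_reducible exact PolyBounded.id
    | with_reducible refine PolyBounded.add ?_ ?_
    | with_reducible refine PolyBounded.mul ?_ ?_

theorem polyBounded_time_of_not_dvd (d : ℕ) : PolyBounded fun x =>
    (x * (4 * d + 21) + 5) * (60 * (x + (x * (4 * d + 21) + 5) + 1)) + 3 := by
  repeat' first
    | with_reducible exact PolyBounded.const _
    | with_reducible exact PolyBounded.id
    | with_reducible refine PolyBounded.add ?_ ?_
    | with_reducible refine PolyBounded.mul ?_ ?_

theorem polyBounded_time_of_dvd (d : ℕ) {D : ℕ → ℕ} (hD : PolyBounded D) : PolyBounded fun n =>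
    (n.size * (4 * d + 21) + 5) * (60 * (D n + (n.size * (4 * d + 21) + 5) + 1)) +
      (mainCost n * (60 * (D n + (n.size * (4 * d + 21) + 5) + mainCost n + 1)) + 4) := by
  repeat' first
    | with_reducible exact PolyBounded.const _
    | with_reducible exact polyBounded_size
    | with_reducible exact polyBounded_mainCost
    | with_reducible exact hD
    | with_reducible refine PolyBounded.add ?_ ?_
    | with_reducible refine PolyBounded.mul ?_ ?_

theorem PolyBounded.le_of_le {F : ℕ → ℕ} (hF : PolyBounded F) (C k : ℕ) : ∃ c e : ℕ,
    ∀ (m : ℝ) (x : ℕ), 1 ≤ m → (x : ℝ) ≤ C * m ^ k → (F x : ℝ) ≤ c * m ^ e := by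
  obtain ⟨c, e, h⟩ := hF
  refine ⟨c * (C + 1) ^ e, k * e, fun m x hm hx => ?_⟩
  have h1 : (x : ℝ) + 1 ≤ (C + 1) * m ^ k := by
    have := one_le_pow₀ (n := k) hm
    linarith
  calc (F x : ℝ) ≤ c * ((x : ℝ) + 1) ^ e := by exact_mod_cast h x
    _ ≤ c * ((C + 1) * m ^ k) ^ e := by gcongr
    _ = _ := by push_cast; rw [mul_pow, pow_mul, mul_assoc]

theorem le_sum_mul_pow {c c' e e' : ℕ} {m : ℝ} (hm : 1 ≤ m) :
    (c : ℝ) * m ^ e ≤ ((c + c' : ℕ) : ℝ) * m ^ (e + e') := by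
  push_cast
  have := pow_le_pow_right₀ hm (Nat.le_add_right e e')
  gcongr
  · linarith [(Nat.cast_nonneg c' : (0 : ℝ) ≤ c')]

theorem isPIOAlgorithm_pioProg (hg : IsIncreasingSeq N g) {M : Machine}
    (hM : IsPolyAlgorithm M N g) {d : ℕ} (hd : IsGcd (terms N g) d) :
    IsPIOAlgorithm (pioProg.code (M, d) 0) fun n => (restMult (terms N g) n : ℤ) := by
  have hmem : g 1 ∈ terms N g := ⟨1, le_rfl, hg.1, rfl⟩
  have hd1 : 1 ≤ d := Nat.pos_of_dvd_of_pos ((hd d).1 dvd_rfl _ hmem) hg.2.1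
  obtain ⟨c, e, hM⟩ := hM
  -- For all arguments `j ≤ n`, this exceeds the length of `j` plus the time of `M` on `j`, as
  -- `callOn` requires.
  set D : ℕ → ℕ := fun n => n + c * (1 + n) ^ e + 1 with hD
  have hDb : PolyBounded D := (PolyBounded.id.add ⟨c, e, fun n => by rw [Nat.add_comm 1 n]⟩).add
    (PolyBounded.const 1)
  obtain ⟨C, hC⟩ := exists_le_complexity_sq hd hg.2.1 hmem
  -- The two cases use different size parameters: if `d ∤ n`, the time is polynomial in `n.size ≤ 3
  -- m`; if `d ∣ n`, it is polynomial in `n ≤ C m ^ 2`.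
  obtain ⟨c₁, e₁, h₁⟩ := (polyBounded_time_of_not_dvd d).le_of_le 3 1
  obtain ⟨c₂, e₂, h₂⟩ := (polyBounded_time_of_dvd d hDb).le_of_le C 2
  refine ⟨c₁ + c₂, e₁ + e₂, fun n hn => ?_⟩
  have hm := one_le_complexity (fun n => (restMult (terms N g) n : ℤ)) hn
  by_cases hdn : d ∣ n
  · obtain ⟨T, hT, hT1⟩ := runs_pioProg_of_dvd (P := (M, d)) (D := D n) hd1 hdn
      (G := padded N g) (fun j hj hjn => ⟨c * (1 + j) ^ e, by exact_mod_cast hM j hj, by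
        have h3 := size_le_self j
        have h4 : c * (1 + j) ^ e ≤ c * (1 + n) ^ e := by gcongr
        simp only [hD]
        omega⟩) (by have := size_le_self n; simp only [hD]; omega)
    rw [kronecker_digit hg] at hT1
    refine hT.computesWithin hT1 ((h₂ _ n hm (hC n hn hdn)).trans ?_)
    rw [Nat.add_comm c₁, Nat.add_comm e₁]
    exact le_sum_mul_pow hm
  · obtain ⟨T, hT, hT1⟩ := runs_pioProg_of_not_dvd (P := (M, d)) hd1 hdn
    rw [← restMult_eq_zero hd hdn] at hT1
    refine hT.computesWithin hT1 ((h₁ _ n.size hm ?_).trans (le_sum_mul_pow hm))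
    have := size_le_complexity (fun n => (restMult (terms N g) n : ℤ)) hn
    simpa using this

/-- The set may be infinite, so the gcd is obtained as a generator of the ideal of `ℤ` spanned by
it. -/
theorem exists_isGcd (A : Set ℕ) : ∃ d, IsGcd A d := by
  obtain ⟨e, he⟩ := (IsPrincipalIdealRing.principal (Ideal.span ((fun a : ℕ => (a : ℤ)) '' A)))
  refine ⟨e.natAbs, fun k => ?_⟩
  rw [← Int.natCast_dvd, ← Ideal.span_singleton_le_span_singleton, Ideal.span, ← he,
    Ideal.span_le]
  simp [Set.subset_def, Ideal.mem_span_singleton, Int.natCast_dvd_natCast]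

theorem computable_pioProg : Computable fun x : Machine × ℕ × List ℕ =>
    pioProg.code (x.1, x.2.1) 0 :=
  (pioProg.primrec_code.comp (Primrec.pair Primrec.fst (Primrec.fst.comp Primrec.snd))
    (Primrec.const 0)).to_comp

end Pio

theorem mainTheorem8 :
    -- the generating function, and `f_A` is a PIO function
    (∀ (N : ℕ∞) (g : ℕ → ℕ), Pio.IsIncreasingSeq N g →
      HasProd
        (fun i : ℕ => 1 + ∑' j : {j : ℕ // 1 ≤ j ∧ (j : ℕ∞) ≤ N},
          (PowerSeries.X : PowerSeries ℕ) ^ ((i + 1) * g j))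
        (PowerSeries.mk fun n => Pio.restMult (Pio.terms N g) n) ∧
      ((∃ M : Pio.Machine, Pio.IsPolyAlgorithm M N g) →
        Pio.IsPIO (fun n => (Pio.restMult (Pio.terms N g) n : ℤ)))) ∧
    -- a PIO algorithm is computed from an algorithm for `g`, the gcd `d` and a finite set `B`
    (∃ Φ : Pio.Machine × ℕ × List ℕ → Pio.Machine, Computable Φ ∧
      ∀ (N : ℕ∞) (g : ℕ → ℕ), Pio.IsIncreasingSeq N g →
        ∀ M : Pio.Machine, Pio.IsPolyAlgorithm M N g →
          ∀ (d : ℕ) (B : List ℕ),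
            Pio.IsGcd (Pio.terms N g) d →
            (∀ b ∈ B, b ∈ Pio.terms N g) → Pio.IsGcd {b | b ∈ B} d →
              Pio.IsPIOAlgorithm (Φ (M, d, B))
                (fun n => (Pio.restMult (Pio.terms N g) n : ℤ))) := by
  refine ⟨fun N g hg => ⟨Pio.hasProd_restMult hg, fun ⟨M, hM⟩ => ?_⟩,
    fun x => Pio.pioProg.code (x.1, x.2.1) 0, Pio.computable_pioProg,
    fun N g hg M hM d _ hd _ _ => Pio.isPIOAlgorithm_pioProg hg hM hd⟩
  obtain ⟨d, hd⟩ := Pio.exists_isGcd (Pio.terms N g)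
  exact ⟨_, Pio.isPIOAlgorithm_pioProg hg hM hd⟩
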